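/- Let $d\ge 3$ and write points of $d$-dimensional Minkowski space as $y=(y^0,\vec y)\in\mathbb R\times\mathbb R^{d-1}$. For $m\ge 0$ let $$\Delta^{+(d)}_m(y)=\frac1{(2\pi)^{d-1}}\int_{\mathbb R^{d-1}}\frac{d^{d-1}p}{2\omega_m(p)}\,e^{-i\omega_m(p)y^0+i\vec p\cdot\vec y},\qquad \omega_m(p)=\sqrt{|\vec p|^2+m^2},$$ be the Wightman two-point function of the free scalar field $\varphi$ of mass $m$ (a distribution in $\mathcal D'(\mathbb R^d)$), and let $\Delta^F_m(y)=\theta(y^0)\Delta^{+(d)}_m(y)+\theta(-y^0)\Delta^{+(d)}_m(-y)$ be the Feynman propagator. Fix a mass scale $M>0$. A family $f^{(m)}\in\mathcal D'(\mathbb R^k)$, $m\ge 0$, *fulfils the sm-expansion with degree $D$* if for all $l,L\in\mathbb N_0$ there are distributions $u^{(m)}_l,\mathfrak r^{(m)}_{L+1}\in\mathcal D'(\mathbb R^k)$ with $f^{(m)}=\sum_{l=0}^L m^l u^{(m)}_l+\mathfrak r^{(m)}_{L+1}$ for all $L\in\mathbb N_0$ (at $m=0$ the terms with $l\ge1$ are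 read as $0$) such that, all properties being meant in the weak sense, * (A) $u_0=u_0^{(m)}$ is independent of $m$ and equals $f^{(0)}$; * (B) $u^{(m)}_l=\sum_{p=0}^{P_l}(\log\frac mM)^p\,u_{l,p}$ with $P_l<\infty$ and $m$-independent $u_{l,p}\in\mathcal D'(\mathbb R^k)$; * (C) $u^{(m)}_l$, and hence each $u_{l,p}$, scales almost homogeneously with degree $D-l$, i.e. $(\rho\partial_\rho)^N\big(\rho^{D-l}u_{l,p}(\rho x)\big)=0$ for $\rho>0$ and some $N$; * (D) $\mathfrak r^{(m)}_{L+1}$ is almost homogeneous with degree $D$ under $(x,m)\mapsto(\rho x,m/\rho)$, i.e. $(\rho\partial_\rho)^N\big(\rho^{D}\mathfrak r^{(m/\rho)}_{L+1}(\rho x)\big)=0$ for $\rho>0$ and some $N$; * (E) $\mathfrak r^{(m)}_{L+1}$ is smooth in $m>0$ and $\lim_{m\downarrow0}(\frac mM)^{-(L+1)+\varepsilon}\,\mathfrak r^{(m)}_{L+1}=0$ for all $\varepsilon>0$. Then: 1. $\Delta^{+(d)}_m$ fulfils the sm-expansion with degree $D=d-2$. 2. If $d$ is odd, then $m\mapsto\langle\Delta^{+(d)}_m,h\rangle$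 is smooth on $[0,\infty)$ for every test function $h$, and the sm-expansion of $\Delta^{+(d)}_m$ is its Taylor expansion in $m$ at $m=0$: in every sm-expansion of it with degree $d-2$, $\langle u^{(m)}_l,h\rangle=\frac1{l!}\,\partial_{m'}^l\langle\Delta^{+(d)}_{m'},h\rangle\big|_{m'=0}$ for all $l$, all $m>0$ and all $h$. 3. Let $\dim\prod_{j=1}^J\partial^{\beta_j}\varphi=J\,\frac{d-2}2+\sum_j|\beta_j|$ be the mass dimension of field monomials, so that $\dim\varphi=\frac{d-2}{2}$. Then $t^{(m)}(\varphi,\varphi):=\hbar\,\Delta^F_m$ satisfies the scaling-and-mass-expansion axiom for the pair $(\varphi,\varphi)$: it fulfils the sm-expansion with degree $\dim\varphi+\dim\varphi=d-2$. -/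

import Mathlib

open MeasureTheory Filter Topology TopologicalSpace Set
open scoped Distributions ContDiff Nat

noncomputable section

/-! ### Distributions on a finite-dimensional real space and almost homogeneous scaling -/

/-- The test functions `𝓓(E)` on the whole space `E` (smooth, compactly supported).  As in Mathlib,
complex distributions are tested against real-valued test functions. -/
abbrev Test (E : Type) [NormedAddCommGroup E] [NormedSpace ℝ E] : Type :=
  𝓓((⊤ : Opens E), ℝ)

/-- The complex-valued distributions `𝓓'(E)` on the whole space `E`. -/
abbrev Dist' (E : Type) [NormedAddCommGroup E] [NormedSpace ℝ E] : Type :=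
  𝓓'((⊤ : Opens E), ℂ)

section

variable {E : Type} [NormedAddCommGroup E] [NormedSpace ℝ E]

/-- The dilated test function `x ↦ h (ρ⁻¹ x)` (with the value `0` for the irrelevant `ρ = 0`). -/
def dilate (ρ : ℝ) (h : Test E) : Test E :=
  if hρ : ρ = 0 then 0 else
    { toFun := fun x => h (ρ⁻¹ • x)
      contDiff' := h.contDiff.comp (contDiff_const_smul ρ⁻¹)
      hasCompactSupport' :=
        h.hasCompactSupport.comp_homeomorph (Homeomorph.smulOfNeZero ρ⁻¹ (inv_ne_zero hρ))
      tsupport_subset' := fun _ _ => trivial }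

/-- The operator `ρ ∂_ρ`. -/
def rhoDeriv (g : ℝ → ℂ) (ρ : ℝ) : ℂ := ρ * deriv g ρ

/-- `⟨ρ ^ D f^{(m/ρ)}(ρ x), h(x)⟩` as a function of `ρ > 0`, for a family `m ↦ f^{(m)}` of
distributions on `E`; by definition `⟨f(ρ x), h(x)⟩ = ρ ^ (- dim E) ⟨f(x), h(x / ρ)⟩`. -/
def scaledPairing (D : ℝ) (f : ℝ → Dist' E) (m : ℝ) (h : Test E) (ρ : ℝ) : ℂ :=
  ((ρ ^ D * (ρ ^ Module.finrank ℝ E)⁻¹ : ℝ) : ℂ) * f (m / ρ) (dilate ρ h)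

/-- The family `f^{(m)}`, `m ≥ 0`, is almost homogeneous with degree `D` under the scaling
`(x, m) ↦ (ρ x, m / ρ)`: for some `N`, `(ρ ∂_ρ) ^ N (ρ ^ D f^{(m/ρ)}(ρ x)) = 0` in the weak sense
(the pairings being smooth in `ρ > 0`, so that the derivatives are genuine).  Applied to a constant
family this is almost homogeneous scaling of a single distribution under `x ↦ ρ x`. -/
def AlmostHomogeneous (D : ℝ) (f : ℝ → Dist' E) : Prop :=
  ∃ N : ℕ, ∀ m : ℝ, 0 ≤ m → ∀ h : Test E,
    ContDiffOn ℝ ∞ (scaledPairing D f m h) (Ioi 0) ∧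
      ∀ ρ : ℝ, 0 < ρ → (rhoDeriv^[N] (scaledPairing D f m h)) ρ = 0

/-! ### The scaling and mass expansion -/

/-- `u^{(m)} = ∑_{p ≤ P} (log (m / M)) ^ p u_p`. -/
def logPoly (M : ℝ) (P : ℕ) (u : ℕ → Dist' E) (m : ℝ) : Dist' E :=
  ∑ p ∈ Finset.range (P + 1), (Real.log (m / M)) ^ p • u p

/-- The data `P l`, `u l p`, `r (L + 1) m` are an sm-expansion with degree `D` and mass scale `M`
of the family `f^{(m)}`, `m ≥ 0`, of distributions on `E`.

At `m = 0` the terms `m ^ l u_l^{(m)}` with `l ≥ 1` vanish, in accordance with their limits. -/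
structure IsSmExpansion (M D : ℝ) (f : ℝ → Test E → ℂ)
    (P : ℕ → ℕ) (u : ℕ → ℕ → Dist' E) (r : ℕ → ℝ → Dist' E) : Prop where
  /-- each `f^{(m)}` is a distribution -/
  distribution : ∀ m : ℝ, 0 ≤ m → ∃ T : Dist' E, ∀ h, f m h = T h
  /-- `f^{(m)} = ∑_{l ≤ L} m ^ l u_l^{(m)} + r_{L+1}^{(m)}` for all `L`,
  where `u_l^{(m)} = ∑_{p ≤ P l} (log (m / M)) ^ p u_{l,p}` -/
  expansion : ∀ (L : ℕ) (m : ℝ), 0 ≤ m → ∀ h : Test E,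
    f m h = ∑ l ∈ Finset.range (L + 1), ((m ^ l : ℝ) : ℂ) * logPoly M (P l) (u l) m h
      + r (L + 1) m h
  /-- `u_0` does not depend on `m` and equals `f^{(0)}` -/
  zeroth : P 0 = 0 ∧ ∀ h : Test E, u 0 0 h = f 0 h
  /-- all `u_{l,p}` (equivalently, all `u_l^{(m)}`) scale almost homogeneously with degree
  `D - l` under `x ↦ ρ x` -/
  coeff_scaling : ∀ l p : ℕ, p ≤ P l → AlmostHomogeneous (D - l) (fun _ => u l p)
  /-- the remainders are almost homogeneous with degree `D` under `(x, m) ↦ (ρ x, m / ρ)` -/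
  remainder_scaling : ∀ L : ℕ, AlmostHomogeneous D (r (L + 1))
  /-- the remainders are smooth in `m > 0` -/
  remainder_smooth : ∀ (L : ℕ) (h : Test E), ContDiffOn ℝ ∞ (fun m => r (L + 1) m h) (Ioi 0)
  /-- `lim_{m ↓ 0} (m / M) ^ (-(L + 1) + ε) r_{L+1}^{(m)} = 0` for all `ε > 0` -/
  remainder_limit : ∀ (L : ℕ) (h : Test E) (ε : ℝ), 0 < ε →
    Tendsto (fun m : ℝ => (((m / M) ^ (-((L : ℝ) + 1) + ε) : ℝ) : ℂ) * r (L + 1) m h)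
      (𝓝[>] 0) (𝓝 0)

/-- The family `f^{(m)}`, `m ≥ 0`, fulfils the sm-expansion with degree `D` (and mass scale `M`). -/
def FulfilsSmExpansion (M D : ℝ) (f : ℝ → Test E → ℂ) : Prop :=
  ∃ (P : ℕ → ℕ) (u : ℕ → ℕ → Dist' E) (r : ℕ → ℝ → Dist' E), IsSmExpansion M D f P u r

end

/-! ### The two-point functions of the free scalar field -/

/-- Position (and momentum) space `ℝ^{d-1}`. -/
abbrev Space (d : ℕ) : Type := EuclideanSpace ℝ (Fin (d - 1))

/-- `d`-dimensional Minkowski space, with points `(y⁰, y⃗)`. -/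
abbrev Minkowski (d : ℕ) : Type := ℝ × Space d

/-- The energy `ω(p) = √(|p|² + m²)`. -/
def energy {d : ℕ} (m : ℝ) (p : Space d) : ℝ := Real.sqrt (‖p‖ ^ 2 + m ^ 2)

/-- The Wightman two-point function at fixed time `t`,
`Δ⁺_m(t, x) = (2π)^{-(d-1)} ∫ d^{d-1}p / (2 ω(p)) exp (- i ω(p) t + i p·x)`,
as a distribution in `x`, evaluated on the function `g`. -/
def wightmanAt (d : ℕ) (m t : ℝ) (g : Space d → ℝ) : ℂ :=
  (((2 * Real.pi) ^ (d - 1))⁻¹ : ℝ) *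
    ∫ p : Space d, ((2 * energy m p)⁻¹ : ℝ) * Complex.exp (-Complex.I * (energy m p * t : ℝ)) *
      ∫ x : Space d, Complex.exp (Complex.I * (inner ℝ p x : ℝ)) * (g x : ℂ)

/-- The Wightman two-point function `Δ⁺_m` in `d` dimensions, `⟨Δ⁺_m, h⟩`. -/
def wightman (d : ℕ) (m : ℝ) (h : Test (Minkowski d)) : ℂ :=
  ∫ t : ℝ, wightmanAt d m t (fun x => h (t, x))

/-- The Feynman propagator `Δ^F_m(y) = θ(y⁰) Δ⁺_m(y) + θ(-y⁰) Δ⁺_m(-y)`, `⟨Δ^F_m, h⟩`;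
note that `∫ Δ⁺_m(-t, -x) g(x) dx = ∫ Δ⁺_m(-t, x) g(-x) dx`. -/
def feynman (d : ℕ) (m : ℝ) (h : Test (Minkowski d)) : ℂ :=
  (∫ t in Ioi (0 : ℝ), wightmanAt d m t (fun x => h (t, x))) +
    ∫ t in Iio (0 : ℝ), wightmanAt d m (-t) (fun x => h (t, -x))

/-- A field monomial `∏_j ∂^{β_j} φ`, given by the multiset of its multi-indices `β_j ∈ ℕ₀^d`. -/
abbrev FieldMonomial (d : ℕ) : Type := Multiset (Fin d → ℕ)

/-- The basic field `φ`. -/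
def basicField (d : ℕ) : FieldMonomial d := {0}

/-- The mass dimension `dim ∏_{j=1}^J ∂^{β_j} φ = J (d - 2) / 2 + ∑_j |β_j|`. -/
def massDim {d : ℕ} (A : FieldMonomial d) : ℝ :=
  (Multiset.card A : ℝ) * (((d : ℝ) - 2) / 2) + (A.map (fun β => ((∑ i, β i : ℕ) : ℝ))).sum

/-- `t^{(m)}(φ, φ) = ħ Δ^F_m`, the vacuum expectation value of the time-ordered product of
`φ(x₁)` and `φ(x₂)`, as a distribution in `y = x₁ - x₂`. -/
def timeOrderedVev (d : ℕ) (ħ m : ℝ) (h : Test (Minkowski d)) : ℂ := ħ * feynman d m h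

end

/-!
The dependence of the two-point functions on the mass is made explicit by separating, under the
momentum integral, the part of the kernel `exp (-i a(t) ω) / ω`, `ω = √(|p|² + m²)`, which is
singular at `ω = 0`; here `a(t) = t` for the Wightman function and `a(t) = |t|` for the Feynman
propagator (`feynman_eq_twoPoint`).

* `sin (a ω) / ω` is an entire function of `ω²`.
* `cos (t ω) / ω` is, up to entire functions of `ω²`, the integral
  `∫_1^∞ τ ^ (-1/2) exp (-τ ω² + t² / (4 τ)) dτ` over large Schwinger parameters.  As a function
  of `t` this integral solves the oscillator equation with frequency `ω`, with a Gaussian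
  inhomogeneity, and Duhamel's formula gives the difference (`cos_div_eq`).

The entire parts are superpositions of functions `cos (b ω) exp (-τ ω²)` with `|b| ≤ |t|` and
`0 ≤ τ ≤ 1`.  All derivatives of `cos √y` are bounded on `y ≥ 0`, and the spatial Fourier transform
of a test function decays rapidly, so these parts are smooth in `m²`, with derivatives which are
distributions (`exists_dist_chain`).  Such functions are handled as finite chains of derivatives
with respect to `m²`, see `IsMassChain`.

In the singular part the momentum integral is Gaussian.  It becomes
`∫_1^∞ τ ^ (-d/2) exp (-m² τ) b(1/τ) dτ`, where `b` is the smooth function `lorentzAverage h`, and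
the convergence at `m = 0` is due to `d ≥ 3`.  Taylor's formula for `b` produces the exponential
integrals `E_{d/2+j}(m²)` and a remainder which is as often differentiable in `m²` as desired
(`exists_dist_chain_largeSchwinger`).  The recursion of the exponential integrals shows that
`E_{d/2+j}(m²)` is the sum of a smooth function of `m` and of a multiple of `m ^ (d-2+2j) log m`,
which is absent for odd `d`: the recursion ends at `E_1`, which contains `log m`, for even `d`, and
at `E_{1/2}`, which contains `1/m`, for odd `d` (`expIntegral_half_dim`).

Thus the two-point functions have expansions to all orders in powers of `m` with at most one factor
`log m`.  The coefficients of such expansions are unique (`IsLogExpansion.unique`), since a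
polynomial of `log m` which tends to zero with `m` vanishes.  Uniqueness, applied to the exact
homogeneity of the two-point functions (`twoPoint_div_mass`), gives the almost homogeneous scaling
of the coefficients and then of the remainders (`fulfilsSmExpansion_of_isLogExpansion`).  Uniqueness
also identifies every sm-expansion with the Taylor expansion when the family is smooth on `m ≥ 0`,
as it is for odd `d` (`IsSmExpansion.logPoly_eq_taylor`).
-/

/-! ### Chains of derivatives with respect to the squared mass -/

/-- `Φ 0, …, Φ K` are the successive derivatives of `Φ 0` with respect to `μ = m²`, expressed in the
variable `m ∈ ℝ`: since `∂_m = 2 m ∂_μ`, one has `(Φ k)'(m) = 2 m Φ (k + 1) (m)`. -/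
def IsMassChain (K : ℕ) (Φ : ℕ → ℝ → ℂ) : Prop :=
  (∀ k ≤ K, Continuous (Φ k)) ∧
    ∀ k < K, ∀ m : ℝ, HasDerivAt (Φ k) ((2 * m : ℝ) * Φ (k + 1) m) m

namespace IsMassChain

variable {K : ℕ} {Φ Ψ : ℕ → ℝ → ℂ}

theorem shift (h : IsMassChain (K + 1) Φ) : IsMassChain K (fun k => Φ (k + 1)) :=
  ⟨fun k hk => h.1 (k + 1) (by omega), fun k hk m => h.2 (k + 1) (by omega) m⟩

theorem add (h : IsMassChain K Φ) (h' : IsMassChain K Ψ) :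
    IsMassChain K (fun k m => Φ k m + Ψ k m) :=
  ⟨fun k hk => (h.1 k hk).add (h'.1 k hk), fun k hk m => by
    simpa [mul_add] using (h.2 k hk m).fun_add (h'.2 k hk m)⟩

theorem const_mul (c : ℂ) (h : IsMassChain K Φ) : IsMassChain K (fun k m => c * Φ k m) :=
  ⟨fun k hk => continuous_const.mul (h.1 k hk), fun k hk m => by
    simpa [mul_left_comm] using (h.2 k hk m).const_mul c⟩

theorem contDiff (h : IsMassChain K Φ) : ContDiff ℝ K (Φ 0) := by
  induction K generalizing Φ with
  | zero => exact contDiff_zero.2 (h.1 0 le_rfl)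
  | succ K ih =>
    push_cast
    refine contDiff_succ_iff_deriv.2 ⟨fun m => (h.2 0 (by omega) m).differentiableAt, ?_, ?_⟩
    · intro hK
      exact absurd hK (by simp)
    · have : deriv (Φ 0) = fun m => ((2 * m : ℝ) : ℂ) * Φ (0 + 1) m :=
        funext fun m => (h.2 0 (by omega) m).deriv
      rw [this]
      refine ContDiff.mul ?_ (ih h.shift)
      exact Complex.ofRealCLM.contDiff.comp (contDiff_const.mul contDiff_id)

/-- The Taylor expansion in `m²` of the head of a chain. -/
theorem taylor (h : IsMassChain K Φ) :
    ∃ C : ℝ, ∀ m ∈ Icc (0 : ℝ) 1,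
      ‖Φ 0 m - ∑ k ∈ Finset.range K, ((m ^ (2 * k) : ℝ) : ℂ) * (Φ k 0 / (k ! : ℂ))‖
        ≤ C * m ^ (2 * K) := by
  induction K generalizing Φ with
  | zero =>
    obtain ⟨C, hC⟩ := (isCompact_Icc (a := (0 : ℝ)) (b := 1)).exists_bound_of_continuousOn
      (h.1 0 le_rfl).continuousOn
    exact ⟨C, fun m hm => by simpa using hC m hm⟩
  | succ K ih =>
    obtain ⟨C, hC⟩ := ih h.shift
    refine ⟨2 * C, fun m hm => ?_⟩
    set R : ℝ → ℂ := fun m => Φ 0 m -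
      ∑ k ∈ Finset.range (K + 1), ((m ^ (2 * k) : ℝ) : ℂ) * (Φ k 0 / (k ! : ℂ)) with hR
    have hR0 : R 0 = 0 := by
      simp [hR, Finset.sum_range_succ']
    have hd : ∀ x : ℝ, HasDerivAt R (((2 * x : ℝ) : ℂ) * (Φ (0 + 1) x -
        ∑ k ∈ Finset.range K, ((x ^ (2 * k) : ℝ) : ℂ) * (Φ (k + 1) 0 / (k ! : ℂ)))) x := by
      intro x
      have hs : HasDerivAt (fun y : ℝ =>
          ∑ k ∈ Finset.range (K + 1), ((y ^ (2 * k) : ℝ) : ℂ) * (Φ k 0 / (k ! : ℂ)))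
          (∑ k ∈ Finset.range (K + 1),
            (((2 * k : ℕ) * x ^ (2 * k - 1) : ℝ) : ℂ) * (Φ k 0 / (k ! : ℂ))) x :=
        HasDerivAt.fun_sum fun k _ => ((hasDerivAt_pow (2 * k) x).ofReal_comp).mul_const _
      refine ((h.2 0 (by omega) x).sub hs).congr_deriv ?_
      rw [Finset.sum_range_succ', mul_sub, Finset.mul_sum]
      simp only [Nat.cast_zero, mul_zero, zero_mul, Complex.ofReal_zero, add_zero]
      congr 1
      refine Finset.sum_congr rfl fun k _ => ?_
      have : (k ! : ℂ) ≠ 0 := by exact_mod_cast k.factorial_ne_zero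
      have : ((k : ℂ) + 1) ≠ 0 := by exact_mod_cast k.succ_ne_zero
      rw [Nat.factorial_succ, show 2 * (k + 1) - 1 = 2 * k + 1 by omega]
      push_cast
      field_simp
      ring
    have hC0 : 0 ≤ C := by
      have := (norm_nonneg _).trans (hC 1 ⟨by norm_num, le_rfl⟩)
      simpa using this
    have key := Convex.norm_image_sub_le_of_norm_hasDerivWithin_le (s := Icc 0 m)
      (C := 2 * m * (C * m ^ (2 * K)))
      (fun x _ => (hd x).hasDerivWithinAt) (fun x hx => ?_) (convex_Icc 0 m)
      (left_mem_Icc.2 hm.1) (right_mem_Icc.2 hm.1)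
    · rw [hR0, sub_zero, sub_zero] at key
      refine key.trans (le_of_eq ?_)
      rw [Real.norm_of_nonneg hm.1]
      ring
    · rw [norm_mul, Complex.norm_real, Real.norm_of_nonneg (by linarith [hx.1])]
      have hm0 := hm.1
      have hx0 := hx.1
      gcongr
      · exact hx.2
      · exact (hC x ⟨hx.1, hx.2.trans hm.2⟩).trans (by gcongr; exact hx.2)

end IsMassChain

/-- Integrals of a dominated family of chains form a chain. -/
theorem isMassChain_integral {X : Type*} [MeasurableSpace X] {ν : Measure X} {K : ℕ}
    {e : ℕ → X → ℝ → ℂ} {g : X → ℝ} (hg : Integrable g ν)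
    (hmeas : ∀ k ≤ K, ∀ m, AEStronglyMeasurable (fun x => e k x m) ν)
    (hbound : ∀ k ≤ K, ∀ᵐ x ∂ν, ∀ m, ‖e k x m‖ ≤ g x)
    (he : ∀ x, IsMassChain K (fun k => e k x)) :
    IsMassChain K (fun k m => ∫ x, e k x m ∂ν) := by
  refine ⟨fun k hk => ?_, fun k hk m => ?_⟩
  · exact continuous_of_dominated (hmeas k hk)
      (fun m => (hbound k hk).mono fun x hx => hx m) hg
      (Eventually.of_forall fun x => (he x).1 k hk)
  · have key := hasDerivAt_integral_of_dominated_loc_of_deriv_le (μ := ν)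
      (F := fun m x => e k x m) (F' := fun m x => ((2 * m : ℝ) : ℂ) * e (k + 1) x m)
      (bound := fun x => 2 * (|m| + 1) * g x) (x₀ := m) (Metric.ball_mem_nhds m one_pos)
      (Eventually.of_forall fun m' => hmeas k hk.le m')
      (hg.mono' (hmeas k hk.le m) ((hbound k hk.le).mono fun x hx => hx m))
      ((hmeas (k + 1) hk m).const_mul _) ?_ (hg.const_mul _)
      (Eventually.of_forall fun x m' _ => (he x).2 k hk m')
    · have h2 := key.2
      rwa [integral_const_mul] at h2
    · filter_upwards [hbound (k + 1) hk] with x hx m' hm'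
      rw [norm_mul, Complex.norm_real]
      have : |m'| ≤ |m| + 1 := by
        have := abs_sub_abs_le_abs_sub m' m
        rw [Metric.mem_ball, Real.dist_eq] at hm'
        linarith
      have h2 : ‖2 * m'‖ ≤ 2 * (|m| + 1) := by
        rw [Real.norm_eq_abs, abs_mul, abs_two]; linarith
      exact mul_le_mul h2 (hx m') (norm_nonneg _) (by positivity)

/-! ### The entire function `cos √y` and its derivatives -/

/-- `cosSqrt k` is the `k`-th derivative of `y ↦ cos √y`, for `y ≥ 0`.  The recursion comes from
`∂_y cos √y = -sin √y / (2 √y) = -(1/2) ∫_0^1 cos √(θ² y) dθ`. -/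
noncomputable def cosSqrt : ℕ → ℝ → ℝ
  | 0, y => Real.cos (Real.sqrt y)
  | k + 1, y => -(1 / 2) * ∫ θ in (0 : ℝ)..1, θ ^ (2 * k) * cosSqrt k (θ ^ 2 * y)

theorem continuous_cosSqrt (k : ℕ) : Continuous (cosSqrt k) := by
  induction k with
  | zero => exact Real.continuous_cos.comp Real.continuous_sqrt
  | succ k ih =>
    refine continuous_const.mul ?_
    exact intervalIntegral.continuous_parametric_intervalIntegral_of_continuous'
      (f := fun y θ => θ ^ (2 * k) * cosSqrt k (θ ^ 2 * y)) (by fun_prop) 0 1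

theorem abs_cosSqrt_le (k : ℕ) (y : ℝ) : |cosSqrt k y| ≤ 1 := by
  induction k generalizing y with
  | zero => exact Real.abs_cos_le_one _
  | succ k ih =>
    rw [cosSqrt, abs_mul]
    have : ‖∫ θ in (0 : ℝ)..1, θ ^ (2 * k) * cosSqrt k (θ ^ 2 * y)‖ ≤ 1 * |1 - 0| := by
      refine intervalIntegral.norm_integral_le_of_norm_le_const fun θ hθ => ?_
      rw [uIoc_of_le zero_le_one] at hθ
      rw [Real.norm_eq_abs, abs_mul, abs_of_nonneg (pow_nonneg hθ.1.le _)]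
      exact mul_le_one₀ (pow_le_one₀ hθ.1.le hθ.2) (abs_nonneg _) (ih _)
    rw [Real.norm_eq_abs] at this
    norm_num at this ⊢
    linarith

/-- Only the composition with `s ↦ s²` is differentiated, so that no one-sided derivative at `y = 0`
is needed. -/
theorem hasDerivAt_cosSqrt_sq (k : ℕ) (s : ℝ) :
    HasDerivAt (fun s => cosSqrt k (s ^ 2)) (2 * s * cosSqrt (k + 1) (s ^ 2)) s := by
  induction k generalizing s with
  | zero =>
    have h0 : (fun s : ℝ => cosSqrt 0 (s ^ 2)) = Real.cos := by
      funext s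
      simp [cosSqrt, Real.sqrt_sq_eq_abs]
    have h1 : ∀ s : ℝ, cosSqrt 0 (s ^ 2) = Real.cos s := fun s => congrFun h0 s
    rw [h0]
    convert! Real.hasDerivAt_cos s using 1
    have h2 : ∀ θ : ℝ, θ ^ (2 * 0) * cosSqrt 0 (θ ^ 2 * s ^ 2) = Real.cos (s * θ) := by
      intro θ
      rw [← mul_pow, h1, mul_comm s]; simp
    have h3 : ∫ θ in (0 : ℝ)..1, s * Real.cos (s * θ) = Real.sin (s * 1) - Real.sin (s * 0) := by
      refine intervalIntegral.integral_eq_sub_of_hasDerivAt (f := fun θ => Real.sin (s * θ))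
        (fun θ _ => ?_)
        (Continuous.intervalIntegrable (by fun_prop) _ _)
      simpa [mul_comm] using ((hasDerivAt_id θ).const_mul s).sin
    rw [intervalIntegral.integral_const_mul] at h3
    rw [cosSqrt]
    simp only [h2]
    simp only [mul_one, mul_zero, Real.sin_zero, sub_zero] at h3
    linear_combination -h3
  | succ k ih =>
    have hcont : ∀ j, Continuous (cosSqrt j) := continuous_cosSqrt
    have key := intervalIntegral.hasDerivAt_integral_of_dominated_loc_of_deriv_le
      (μ := volume) (a := 0) (b := 1) (x₀ := s)
      (F := fun s θ => θ ^ (2 * k) * cosSqrt k (θ ^ 2 * s ^ 2))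
      (F' := fun s θ => θ ^ (2 * k) * (θ * (2 * (θ * s) * cosSqrt (k + 1) (θ ^ 2 * s ^ 2))))
      (bound := fun _ => 2 * (|s| + 1)) (Metric.ball_mem_nhds s one_pos)
      (Eventually.of_forall fun s' => by
        have := hcont k
        exact Continuous.aestronglyMeasurable (by fun_prop))
      (by have := hcont k
          exact Continuous.intervalIntegrable (by fun_prop) _ _)
      (by have := hcont (k + 1)
          exact Continuous.aestronglyMeasurable (by fun_prop))
      (Eventually.of_forall fun θ hθ s' hs' => ?_) (by simp)
      (Eventually.of_forall fun θ hθ s' hs' => ?_)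
    · have h2 := key.2.const_mul (-(1 / 2) : ℝ)
      convert! h2 using 1
      rw [cosSqrt, ← mul_assoc, mul_comm (2 * s), mul_assoc,
        ← intervalIntegral.integral_const_mul (2 * s)]
      congr 2
      funext θ
      ring
    · rw [uIoc_of_le zero_le_one] at hθ
      have h1 : |s'| ≤ |s| + 1 := by
        have := abs_sub_abs_le_abs_sub s' s
        rw [Metric.mem_ball, Real.dist_eq] at hs'
        linarith
      have h2 := abs_cosSqrt_le (k + 1) (θ ^ 2 * s' ^ 2)
      have h3 : θ ^ (2 * k) ≤ 1 := pow_le_one₀ hθ.1.le hθ.2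
      have h4 : θ ^ (2 * k) * (θ * (2 * (θ * s') * cosSqrt (k + 1) (θ ^ 2 * s' ^ 2))) =
        (θ ^ (2 * k) * (θ * θ)) * (2 * s' * cosSqrt (k + 1) (θ ^ 2 * s' ^ 2)) := by ring
      rw [h4, Real.norm_eq_abs, abs_mul, abs_mul (2 * s'), abs_mul 2 s', abs_two,
        abs_of_nonneg (by have := hθ.1; positivity)]
      have h5 : θ ^ (2 * k) * (θ * θ) ≤ 1 :=
        mul_le_one₀ h3 (by have := hθ.1; positivity) (mul_le_one₀ hθ.2 hθ.1.le hθ.2)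
      have h6 : 2 * |s'| * |cosSqrt (k + 1) (θ ^ 2 * s' ^ 2)| ≤ 2 * (|s| + 1) * 1 :=
        mul_le_mul (by linarith) h2 (abs_nonneg _) (by positivity)
      calc _ ≤ 1 * (2 * (|s| + 1) * 1) :=
            mul_le_mul h5 h6 (by positivity) zero_le_one
        _ = _ := by ring
    · have h1 := (ih (θ * s')).comp s' (hasDerivAt_const_mul θ)
      have h2 : (fun s => cosSqrt k (s ^ 2)) ∘ (fun s => θ * s) =
          fun s => cosSqrt k (θ ^ 2 * s ^ 2) := by
        funext s; simp [mul_pow]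
      rw [h2] at h1
      refine (h1.const_mul (θ ^ (2 * k))).congr_deriv ?_
      rw [mul_pow]; ring

theorem hasDerivAt_cosSqrt_mass (k : ℕ) (b : ℝ) {q : ℝ} (hq : 0 ≤ q) (m : ℝ) :
    HasDerivAt (fun m => cosSqrt k (b ^ 2 * (q + m ^ 2)))
      (2 * m * (b ^ 2 * cosSqrt (k + 1) (b ^ 2 * (q + m ^ 2)))) m := by
  rcases hq.eq_or_lt with rfl | hq
  · have h1 := (hasDerivAt_cosSqrt_sq k (b * m)).comp m (hasDerivAt_const_mul b)
    have h2 : (fun s => cosSqrt k (s ^ 2)) ∘ (fun s => b * s) =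
        fun m => cosSqrt k (b ^ 2 * (0 + m ^ 2)) := by
      funext s; simp [mul_pow]
    rw [h2] at h1
    refine h1.congr_deriv ?_
    rw [mul_pow, zero_add]; ring
  · have hpos : ∀ m : ℝ, 0 < q + m ^ 2 := fun m => by positivity
    have hsq : HasDerivAt (fun m : ℝ => b * Real.sqrt (q + m ^ 2))
        (b * (2 * m / (2 * Real.sqrt (q + m ^ 2)))) m := by
      have h0 : HasDerivAt (fun m : ℝ => q + m ^ 2) (2 * m) m := by
        simpa using (hasDerivAt_pow 2 m).const_add q
      exact (h0.sqrt (hpos m).ne').const_mul b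
    have h1 := (hasDerivAt_cosSqrt_sq k (b * Real.sqrt (q + m ^ 2))).comp m hsq
    have h2 : (fun s => cosSqrt k (s ^ 2)) ∘ (fun m => b * Real.sqrt (q + m ^ 2)) =
        fun m => cosSqrt k (b ^ 2 * (q + m ^ 2)) := by
      funext s; simp [mul_pow, Real.sq_sqrt (hpos s).le]
    rw [h2] at h1
    refine h1.congr_deriv ?_
    have := Real.sqrt_pos.2 (hpos m)
    rw [mul_pow, Real.sq_sqrt (hpos m).le]
    field_simp

/-- The derivatives with respect to `σ` of `cos (b √σ) exp (- τ σ)` and, more generally, of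
`b ^ (2 k) cosSqrt k (b² σ) τ ^ j exp (- τ σ)`; the index `n` counts the derivatives. -/
noncomputable def cosExp (b τ σ : ℝ) : ℕ → ℕ → ℕ → ℝ
  | 0, k, j => b ^ (2 * k) * cosSqrt k (b ^ 2 * σ) * (τ ^ j * Real.exp (-(τ * σ)))
  | n + 1, k, j => cosExp b τ σ n (k + 1) j - cosExp b τ σ n k (j + 1)

theorem hasDerivAt_cosExp (b τ : ℝ) {q : ℝ} (hq : 0 ≤ q) (n k j : ℕ) (m : ℝ) :
    HasDerivAt (fun m => cosExp b τ (q + m ^ 2) n k j)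
      (2 * m * cosExp b τ (q + m ^ 2) (n + 1) k j) m := by
  induction n generalizing k j with
  | zero =>
    have h0 : HasDerivAt (fun m : ℝ => -(τ * (q + m ^ 2))) (-(τ * (2 * m))) m := by
      simpa using (((hasDerivAt_pow 2 m).const_add q).const_mul τ).fun_neg
    have h1 := ((hasDerivAt_cosSqrt_mass k b hq m).const_mul (b ^ (2 * k))).mul
      (h0.exp.const_mul (τ ^ j))
    refine h1.congr_deriv ?_
    simp only [cosExp]
    ring
  | succ n ih =>
    refine ((ih (k + 1) j).sub (ih k (j + 1))).congr_deriv ?_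
    rw [cosExp.eq_def _ _ _ (n + 1 + 1)]
    ring

theorem abs_cosExp_le {b τ σ T : ℝ} (hT : 1 ≤ T) (hb : |b| ≤ T) (hτ : τ ∈ Icc (0 : ℝ) 1)
    (hσ : 0 ≤ σ) (n k j : ℕ) : |cosExp b τ σ n k j| ≤ 2 ^ n * T ^ (2 * (n + k)) := by
  induction n generalizing k j with
  | zero =>
    rw [cosExp, abs_mul, abs_mul, abs_mul, abs_pow, abs_pow, abs_of_nonneg hτ.1, Real.abs_exp]
    have h1 : |b| ^ (2 * k) ≤ T ^ (2 * k) := by gcongr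
    have h2 := abs_cosSqrt_le k (b ^ 2 * σ)
    have h3 : τ ^ j * Real.exp (-(τ * σ)) ≤ 1 := by
      refine mul_le_one₀ (pow_le_one₀ hτ.1 hτ.2) (Real.exp_pos _).le ?_
      rw [Real.exp_le_one_iff]
      have := mul_nonneg hτ.1 hσ
      linarith
    have h4 : |b| ^ (2 * k) * |cosSqrt k (b ^ 2 * σ)| ≤ T ^ (2 * k) * 1 :=
      mul_le_mul h1 h2 (abs_nonneg _) (by positivity)
    have h5 := mul_le_mul h4 h3 (by have := hτ.1; positivity) (by positivity)
    simpa using h5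
  | succ n ih =>
    rw [cosExp]
    refine (abs_sub _ _).trans ?_
    have h1 := ih (k + 1) j
    have h2 := ih k (j + 1)
    have h3 : T ^ (2 * (n + k)) ≤ T ^ (2 * (n + 1 + k)) := pow_le_pow_right₀ hT (by omega)
    have h4 : (2 : ℝ) ^ n * T ^ (2 * (n + k)) ≤ 2 ^ n * T ^ (2 * (n + 1 + k)) := by gcongr
    rw [show n + (k + 1) = n + 1 + k by ring] at h1
    calc _ ≤ 2 ^ n * T ^ (2 * (n + 1 + k)) + 2 ^ n * T ^ (2 * (n + 1 + k)) := by linarith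
      _ = _ := by ring

theorem continuous_cosExp {X : Type*} [TopologicalSpace X] {b τ σ : X → ℝ} (hb : Continuous b)
    (hτ : Continuous τ) (hσ : Continuous σ) (n k j : ℕ) :
    Continuous (fun x => cosExp (b x) (τ x) (σ x) n k j) := by
  induction n generalizing k j with
  | zero =>
    simp only [cosExp]
    have := continuous_cosSqrt k
    fun_prop
  | succ n ih =>
    simp only [cosExp]
    exact (ih (k + 1) j).sub (ih k (j + 1))

/-- Superpositions of the functions `m ↦ cos (b √(q + m²)) exp (- τ (q + m²))` are smooth
in `m²`. -/
theorem isMassChain_integral_cosExp {X : Type*} [MeasurableSpace X] {ν : Measure X}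
    {b τ q : X → ℝ} {W : X → ℂ} {T : ℝ} (hT : 1 ≤ T) (hb : Measurable b) (hτ : Measurable τ)
    (hq : Measurable q) (hW : Integrable W ν) (hbT : ∀ᵐ x ∂ν, W x ≠ 0 → |b x| ≤ T)
    (hτ1 : ∀ᵐ x ∂ν, τ x ∈ Icc (0 : ℝ) 1) (hq0 : ∀ x, 0 ≤ q x) (K : ℕ) :
    IsMassChain K (fun n m => ∫ x, (cosExp (b x) (τ x) (q x + m ^ 2) n 0 0 : ℂ) * W x ∂ν) := by
  have hmeas : ∀ n m, Measurable fun x => cosExp (b x) (τ x) (q x + m ^ 2) n 0 0 := fun n m =>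
    (continuous_cosExp (X := ℝ × ℝ × ℝ) continuous_fst (continuous_fst.comp continuous_snd)
      (continuous_snd.comp continuous_snd) n 0 0).measurable.comp
      (hb.prodMk (hτ.prodMk (hq.add_const _)))
  refine isMassChain_integral (e := fun n x m => (cosExp (b x) (τ x) (q x + m ^ 2) n 0 0 : ℂ) * W x)
    (g := fun x => 2 ^ K * T ^ (2 * K) * ‖W x‖) (hW.norm.const_mul _) ?_ ?_ ?_
  · intro k _ m
    exact (Complex.measurable_ofReal.comp (hmeas k m)).aestronglyMeasurable.mul
      hW.aestronglyMeasurable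
  · intro k hk
    filter_upwards [hbT, hτ1] with x hx hx1 m
    rw [norm_mul, Complex.norm_real, Real.norm_eq_abs]
    by_cases h0 : W x = 0
    · simp [h0]
    · gcongr
      refine (abs_cosExp_le hT (hx h0) hx1 (by have := hq0 x; positivity) k 0 0).trans ?_
      rw [add_zero]
      exact mul_le_mul (pow_le_pow_right₀ one_le_two hk) (pow_le_pow_right₀ hT (by omega))
        (by positivity) (by positivity)
  · intro x
    refine ⟨fun k _ => ?_, fun k _ m => ?_⟩
    · exact (Complex.continuous_ofReal.comp (continuous_cosExp continuous_const continuous_const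
        (by fun_prop) k 0 0)).mul continuous_const
    · refine ((hasDerivAt_cosExp (b x) (τ x) (hq0 x) k 0 0 m).ofReal_comp.mul_const
        (W x)).congr_deriv ?_
      push_cast
      ring

theorem contDiff_infty_of_isMassChain {Φ : ℕ → ℝ → ℂ} (h : ∀ K, IsMassChain K Φ) :
    ContDiff ℝ ∞ (Φ 0) :=
  contDiff_infty.2 fun K => (h K).contDiff

/-! ### Exponential integrals -/

/-- The generalised exponential integral `E_s(z) = ∫_1^∞ τ ^ (-s) exp (- z τ) dτ`. -/
noncomputable def expIntegral (s z : ℝ) : ℝ :=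
  ∫ τ in Ioi (1 : ℝ), τ ^ (-s) * Real.exp (-(z * τ))

theorem tendsto_rpow_mul_exp_neg (s : ℝ) {z : ℝ} (hz : 0 < z) :
    Tendsto (fun τ : ℝ => τ ^ s * Real.exp (-(z * τ))) atTop (𝓝 0) := by
  simpa using tendsto_rpow_mul_exp_neg_mul_atTop_nhds_zero s z hz

theorem integrableOn_rpow_mul_exp_neg (s : ℝ) {z : ℝ} (hz : 0 < z) :
    IntegrableOn (fun τ : ℝ => τ ^ s * Real.exp (-(z * τ))) (Ioi 1) := by
  refine integrable_of_isBigO_exp_neg (b := z / 2) (by positivity) ?_ ?_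
  · intro τ hτ
    have : τ ≠ 0 := by have := mem_Ici.1 hτ; positivity
    exact ((Real.continuousAt_rpow_const τ s (Or.inl this)).mul
      (by fun_prop)).continuousWithinAt
  · have h := (tendsto_rpow_mul_exp_neg s (half_pos hz)).isBigO_one ℝ
    have h2 := h.mul (Asymptotics.isBigO_refl (fun τ : ℝ => Real.exp (-(z / 2) * τ)) atTop)
    simp only [one_mul] at h2
    refine h2.congr_left fun τ => ?_
    rw [mul_assoc, ← Real.exp_add]
    congr 2
    ring

/-- Integration by parts: `s E_{s+1}(z) = exp (-z) - z E_s(z)`. -/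
theorem expIntegral_add_one (s : ℝ) {z : ℝ} (hz : 0 < z) :
    s * expIntegral (s + 1) z = Real.exp (-z) - z * expIntegral s z := by
  have hd : ∀ τ ∈ Ici (1 : ℝ), HasDerivAt (fun τ : ℝ => τ ^ (-s) * Real.exp (-(z * τ)))
      (-s * (τ ^ (-(s + 1)) * Real.exp (-(z * τ))) + -z * (τ ^ (-s) * Real.exp (-(z * τ)))) τ := by
    intro τ hτ
    have h0 : 0 < τ := lt_of_lt_of_le one_pos hτ
    have h1 : HasDerivAt (fun τ : ℝ => -(z * τ)) (-z) τ := (hasDerivAt_const_mul z).fun_neg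
    refine ((Real.hasDerivAt_rpow_const (p := -s) (Or.inl h0.ne')).mul h1.exp).congr_deriv ?_
    rw [show -(s + 1) = -s - 1 by ring]
    ring
  have hi1 := integrableOn_rpow_mul_exp_neg (-(s + 1)) hz
  have hi2 := integrableOn_rpow_mul_exp_neg (-s) hz
  have key := integral_Ioi_of_hasDerivAt_of_tendsto' hd
    ((hi1.const_mul _).add (hi2.const_mul _)) (tendsto_rpow_mul_exp_neg (-s) hz)
  rw [integral_add (hi1.const_mul _) (hi2.const_mul _), integral_const_mul, integral_const_mul]
    at key
  simp only [Real.one_rpow, mul_one, one_mul, zero_sub] at key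
  rw [expIntegral, expIntegral]
  linear_combination -key

/-- Up to a smooth function of `m`, the exponential integral `E_{s+k}(m²)` is a multiple of
`m ^ (2k) E_s(m²)`. -/
theorem expIntegral_add_nat {s : ℝ} (hs : 0 < s) (k : ℕ) :
    ∃ (G : ℝ → ℂ) (κ : ℂ), ContDiff ℝ ∞ G ∧ ∀ m : ℝ, 0 < m →
      (expIntegral (s + k) (m ^ 2) : ℂ) =
        G m + κ * ((m ^ (2 * k) : ℝ) : ℂ) * (expIntegral s (m ^ 2) : ℂ) := by
  induction k with
  | zero => exact ⟨0, 1, contDiff_const, fun m _ => by simp⟩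
  | succ k ih =>
    obtain ⟨G, κ, hG, h⟩ := ih
    have hsk : s + k ≠ 0 := by positivity
    refine ⟨fun m => ((s + k : ℝ) : ℂ)⁻¹ *
        (((Real.exp (-m ^ 2) : ℝ) : ℂ) - ((m ^ 2 : ℝ) : ℂ) * G m),
      -((s + k : ℝ) : ℂ)⁻¹ * κ, ?_, fun m hm => ?_⟩
    · refine contDiff_const.mul (ContDiff.sub ?_ (ContDiff.mul ?_ hG))
      · exact Complex.ofRealCLM.contDiff.comp (Real.contDiff_exp.comp (contDiff_id.pow 2).neg)
      · exact Complex.ofRealCLM.contDiff.comp (contDiff_id.pow 2)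
    · have h1 := expIntegral_add_one (s + k) (z := m ^ 2) (by positivity)
      have h2 : expIntegral (s + (k + 1 : ℕ)) (m ^ 2) =
          (s + k)⁻¹ * (Real.exp (-m ^ 2) - m ^ 2 * expIntegral (s + k) (m ^ 2)) := by
        rw [← h1, ← mul_assoc, inv_mul_cancel₀ hsk, one_mul]
        push_cast
        ring_nf
      rw [h2]
      push_cast
      rw [h m hm]
      push_cast
      ring

theorem contDiff_integral_rpow_mul_exp {s : ℝ} (hs : -1 < s) :
    ContDiff ℝ ∞ fun m : ℝ =>
      ((∫ τ in Ioc (0 : ℝ) 1, Real.exp (-(m ^ 2 * τ)) * τ ^ s : ℝ) : ℂ) := by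
  have hW : Integrable (fun τ : ℝ => ((τ ^ s : ℝ) : ℂ)) (volume.restrict (Ioc (0 : ℝ) 1)) := by
    have := (intervalIntegral.intervalIntegrable_rpow' (a := 0) (b := 1) hs)
    rw [intervalIntegrable_iff_integrableOn_Ioc_of_le zero_le_one] at this
    exact this.ofReal
  have h := contDiff_infty_of_isMassChain fun K => isMassChain_integral_cosExp
    (ν := volume.restrict (Ioc (0 : ℝ) 1)) (b := fun _ => 0) (τ := fun τ => τ) (q := fun _ => 0)
    (T := 1) le_rfl measurable_const measurable_id measurable_const hW
    (Eventually.of_forall fun _ _ => by simp)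
    ((ae_restrict_iff' measurableSet_Ioc).2 (Eventually.of_forall fun τ hτ => ⟨hτ.1.le, hτ.2⟩))
    (fun _ => le_rfl) K
  convert! h using 2 with m
  rw [← integral_complex_ofReal]
  congr 1
  funext τ
  simp [cosExp, cosSqrt, mul_comm τ]

theorem expIntegral_half {z : ℝ} (hz : 0 < z) :
    expIntegral (1 / 2) z = Real.sqrt Real.pi / Real.sqrt z -
      ∫ τ in Ioc (0 : ℝ) 1, Real.exp (-(z * τ)) * τ ^ (-(1 / 2) : ℝ) := by
  have h1 := Real.integral_rpow_mul_exp_neg_mul_Ioi (a := 1 / 2) (r := z) (by norm_num) hz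
  have h2 : IntegrableOn (fun τ : ℝ => τ ^ (-(1 / 2) : ℝ) * Real.exp (-(z * τ))) (Ioi 0) := by
    have := integrableOn_rpow_mul_exp_neg_mul_rpow (s := -(1 / 2)) (p := 1) (b := z)
      (by norm_num) one_pos hz
    simpa using this
  have h3 : ∫ τ in Ioi (0 : ℝ), τ ^ (-(1 / 2) : ℝ) * Real.exp (-(z * τ)) =
      (∫ τ in Ioc (0 : ℝ) 1, τ ^ (-(1 / 2) : ℝ) * Real.exp (-(z * τ))) +
        expIntegral (1 / 2) z := by
    rw [← Ioc_union_Ioi_eq_Ioi (zero_le_one' ℝ), setIntegral_union (Ioc_disjoint_Ioi le_rfl)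
      measurableSet_Ioi (h2.mono_set Ioc_subset_Ioi_self)
      (h2.mono_set (Ioi_subset_Ioi zero_le_one)), expIntegral]
  norm_num at h1 h3 ⊢
  rw [h3, Real.Gamma_one_half_eq] at h1
  simp only [mul_comm (Real.exp _)]
  rw [eq_sub_iff_add_eq, add_comm, h1, ← Real.sqrt_eq_rpow, Real.sqrt_inv]
  field_simp

/-- `(1 - exp (-u)) / u`, continued smoothly to `u = 0`. -/
theorem integral_exp_neg_mul {u : ℝ} (hu : u ≠ 0) :
    ∫ θ in (0 : ℝ)..1, Real.exp (-(u * θ)) = (1 - Real.exp (-u)) / u := by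
  have h : ∀ θ ∈ uIcc (0 : ℝ) 1, HasDerivAt (fun θ : ℝ => -Real.exp (-(u * θ)) / u)
      (Real.exp (-(u * θ))) θ := fun θ _ => by
    have h1 : HasDerivAt (fun τ : ℝ => -(u * τ)) (-u) θ := (hasDerivAt_const_mul u).fun_neg
    refine (h1.exp.fun_neg.div_const u).congr_deriv ?_
    field_simp
  rw [intervalIntegral.integral_eq_sub_of_hasDerivAt h
    (Continuous.intervalIntegrable (by fun_prop) _ _)]
  simp
  ring

/-- `E_1(m²) + 2 log m` extends to a smooth function of `m`. -/
theorem expIntegral_one :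
    ∃ G : ℝ → ℂ, ContDiff ℝ ∞ G ∧ ∀ m : ℝ, 0 < m →
      (expIntegral 1 (m ^ 2) : ℂ) = G m - 2 * (Real.log m : ℂ) := by
  set ein : ℝ → ℝ := fun u => ∫ θ in (0 : ℝ)..1, Real.exp (-(u * θ)) with hein
  have heinc : Continuous ein :=
    intervalIntegral.continuous_parametric_intervalIntegral_of_continuous'
    (f := fun u θ => Real.exp (-(u * θ))) (by fun_prop) 0 1
  set c : ℝ := ∫ u in Ioi (1 : ℝ), u⁻¹ * Real.exp (-u) with hc
  refine ⟨fun m => ((c - ∫ u in (m ^ 2)..1, ein u : ℝ) : ℂ), ?_, fun m hm => ?_⟩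
  · have hd : ∀ m : ℝ, HasDerivAt (fun m : ℝ => ((c - ∫ u in (m ^ 2)..1, ein u : ℝ) : ℂ))
        (((2 * m : ℝ) : ℂ) * ((ein (m ^ 2) : ℝ) : ℂ)) m := by
      intro m
      have h1 : HasDerivAt (fun z : ℝ => ∫ u in z..1, ein u) (-ein (m ^ 2)) (m ^ 2) :=
        intervalIntegral.integral_hasDerivAt_left (heinc.intervalIntegrable _ _)
          heinc.stronglyMeasurable.stronglyMeasurableAtFilter heinc.continuousAt
      have h2 := HasDerivAt.comp (h := fun m : ℝ => m ^ 2) m h1 (hasDerivAt_pow 2 m)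
      refine ((h2.const_sub c).ofReal_comp).congr_deriv ?_
      push_cast
      ring
    rw [contDiff_infty_iff_deriv]
    refine ⟨fun m => (hd m).differentiableAt, ?_⟩
    rw [show deriv (fun m : ℝ => ((c - ∫ u in (m ^ 2)..1, ein u : ℝ) : ℂ)) = _ from
      funext fun m => (hd m).deriv]
    refine ContDiff.mul (Complex.ofRealCLM.contDiff.comp (contDiff_const.mul contDiff_id)) ?_
    have := contDiff_integral_rpow_mul_exp (s := 0) (by norm_num)
    simpa [hein, intervalIntegral.integral_of_le] using this
  · have hz : 0 < m ^ 2 := by positivity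
    have h1 : expIntegral 1 (m ^ 2) = ∫ u in Ioi (m ^ 2), u⁻¹ * Real.exp (-u) := by
      have := integral_comp_mul_left_Ioi (fun u : ℝ => u⁻¹ * Real.exp (-u)) 1 hz
      rw [mul_one] at this
      rw [eq_inv_smul_iff₀ hz.ne'] at this
      rw [← this, expIntegral, smul_eq_mul, ← integral_const_mul]
      refine setIntegral_congr_fun measurableSet_Ioi fun τ hτ => ?_
      have h0 : 0 < τ := lt_trans one_pos hτ
      simp only [Real.rpow_neg_one]
      field_simp
    have hint1 : ∀ a : ℝ, 0 < a → IntegrableOn (fun u : ℝ => u⁻¹ * Real.exp (-u)) (Ioi a) := by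
      intro a ha
      refine integrable_of_isBigO_exp_neg (b := 1) one_pos ?_ ?_
      · intro τ hτ
        have : τ ≠ 0 := (lt_of_lt_of_le ha hτ).ne'
        exact ((continuousAt_inv₀ this).mul (by fun_prop)).continuousWithinAt
      · have h := (tendsto_inv_atTop_zero (𝕜 := ℝ)).isBigO_one ℝ
        simpa using h.mul (Asymptotics.isBigO_refl (fun τ : ℝ => Real.exp (-1 * τ)) atTop)
    have h2 := intervalIntegral.integral_interval_add_Ioi (hint1 _ hz) (hint1 1 one_pos)
    have hne : ∀ u ∈ uIcc (m ^ 2) 1, u ≠ 0 := fun u hu =>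
      (lt_of_lt_of_le (lt_min hz one_pos) hu.1).ne'
    have h3 : ∫ u in (m ^ 2)..1, u⁻¹ * Real.exp (-u) =
        (∫ u in (m ^ 2)..1, u⁻¹) - ∫ u in (m ^ 2)..1, ein u := by
      rw [← intervalIntegral.integral_sub _ (heinc.intervalIntegrable _ _)]
      · refine intervalIntegral.integral_congr fun u hu => ?_
        have := hne u hu
        simp only [hein]
        rw [integral_exp_neg_mul this]
        field_simp
        ring
      · exact (ContinuousOn.inv₀ continuousOn_id hne).intervalIntegrable
    have h4 : ∫ u in (m ^ 2)..1, u⁻¹ = -(2 * Real.log m) := by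
      rw [integral_inv_of_pos hz one_pos, one_div, Real.log_inv, Real.log_pow]
      norm_num
    rw [h1, ← h2, h3, h4]
    push_cast
    ring

/-- The behaviour of `E_{d/2+j}(m²)` at `m = 0`: a single logarithmic term, which is absent if `d`
is odd. -/
theorem expIntegral_half_dim {d : ℕ} (hd : 3 ≤ d) (j : ℕ) :
    ∃ (G : ℝ → ℂ) (κ : ℂ), ContDiff ℝ ∞ G ∧ (Odd d → κ = 0) ∧ ∀ m : ℝ, 0 < m →
      (expIntegral ((d : ℝ) / 2 + j) (m ^ 2) : ℂ) =
        G m + κ * ((m ^ (d - 2 + 2 * j) * Real.log m : ℝ) : ℂ) := by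
  rcases Nat.even_or_odd' d with ⟨e, rfl | rfl⟩
  · obtain ⟨G, κ, hG, h⟩ := expIntegral_add_nat one_pos (e - 1 + j)
    obtain ⟨G', hG', h'⟩ := expIntegral_one
    refine ⟨fun m => G m + κ * ((m ^ (2 * (e - 1 + j)) : ℝ) : ℂ) * G' m, -2 * κ, ?_, ?_, ?_⟩
    · exact hG.add ((contDiff_const.mul
        (Complex.ofRealCLM.contDiff.comp (contDiff_id.pow _))).mul hG')
    · intro h; exact absurd h (by simp)
    · intro m hm
      have h1 : ((2 * e : ℕ) : ℝ) / 2 + j = 1 + ((e - 1 + j : ℕ) : ℝ) := by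
        rw [Nat.cast_add, Nat.cast_sub (by omega)]
        push_cast
        ring
      rw [h1, h m hm, h' m hm, show 2 * e - 2 + 2 * j = 2 * (e - 1 + j) by omega]
      push_cast
      ring
  · -- the term `√π / m` of `E_{1/2}(m²)` cancels against the power of `m`
    obtain ⟨G, κ, hG, h⟩ := expIntegral_add_nat (s := 1 / 2) (by norm_num) (e + j)
    refine ⟨fun m => G m + κ * ((m ^ (2 * (e + j) - 1) : ℝ) : ℂ) * (Real.sqrt Real.pi - (m : ℂ) *
      ((∫ τ in Ioc (0 : ℝ) 1, Real.exp (-(m ^ 2 * τ)) * τ ^ (-(1 / 2) : ℝ) : ℝ) : ℂ)),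
      0, ?_, fun _ => rfl, ?_⟩
    · exact hG.add ((contDiff_const.mul
        (Complex.ofRealCLM.contDiff.comp (contDiff_id.pow _))).mul (contDiff_const.sub
        (Complex.ofRealCLM.contDiff.mul (contDiff_integral_rpow_mul_exp (by norm_num)))))
    · intro m hm
      have h1 : ((2 * e + 1 : ℕ) : ℝ) / 2 + j = 1 / 2 + ((e + j : ℕ) : ℝ) := by
        push_cast
        ring
      have h2 : m ^ (2 * (e + j)) = m ^ (2 * (e + j) - 1) * m := by
        rw [← pow_succ]; congr 1; omega
      rw [h1, h m hm, expIntegral_half (by positivity), Real.sqrt_sq hm.le, h2]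
      have : (m : ℂ) ≠ 0 := by exact_mod_cast hm.ne'
      push_cast
      field_simp
      ring

/-! ### Separating the singular part of `cos (t E) / E` -/

/-- The part `∫_1^∞ τ ^ (-s) exp (- z τ + t² / (4 τ)) dτ` of large Schwinger parameters. -/
noncomputable def schwinger (s z t : ℝ) : ℝ :=
  ∫ τ in Ioi (1 : ℝ), τ ^ (-s) * Real.exp (-(z * τ) + t ^ 2 / (4 * τ))

theorem rpow_mul_exp_add_le {s z t T τ : ℝ} (hτ : 1 < τ) (ht : |t| ≤ T) :
    τ ^ (-s) * Real.exp (-(z * τ) + t ^ 2 / (4 * τ)) ≤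
      Real.exp (T ^ 2 / 4) * (τ ^ (-s) * Real.exp (-(z * τ))) := by
  have h0 : 0 < τ := one_pos.trans hτ
  have h1 : t ^ 2 / (4 * τ) ≤ T ^ 2 / 4 := by
    have h2 : t ^ 2 ≤ T ^ 2 := sq_le_sq' (by linarith [neg_abs_le t]) (by linarith [le_abs_self t])
    exact div_le_div₀ (sq_nonneg _) h2 (by norm_num) (by linarith)
  rw [Real.exp_add]
  have h3 : Real.exp (t ^ 2 / (4 * τ)) ≤ Real.exp (T ^ 2 / 4) := Real.exp_le_exp.2 h1
  have h4 : 0 ≤ τ ^ (-s) * Real.exp (-(z * τ)) := by positivity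
  nlinarith

theorem measurable_rpow_mul_exp_add (s z t : ℝ) :
    Measurable fun τ : ℝ => τ ^ (-s) * Real.exp (-(z * τ) + t ^ 2 / (4 * τ)) := by
  fun_prop

theorem integrableOn_schwinger (s : ℝ) {z : ℝ} (hz : 0 < z) (t : ℝ) :
    IntegrableOn (fun τ : ℝ => τ ^ (-s) * Real.exp (-(z * τ) + t ^ 2 / (4 * τ))) (Ioi 1) := by
  refine Integrable.mono' ((integrableOn_rpow_mul_exp_neg (-s) hz).const_mul
    (Real.exp (|t| ^ 2 / 4))) (measurable_rpow_mul_exp_add s z t).aestronglyMeasurable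
    ((ae_restrict_iff' measurableSet_Ioi).2 (Eventually.of_forall fun τ hτ => ?_))
  have h0 : 0 < τ := one_pos.trans hτ
  rw [Real.norm_of_nonneg (by positivity)]
  exact rpow_mul_exp_add_le hτ le_rfl

theorem hasDerivAt_schwinger (s : ℝ) {z : ℝ} (hz : 0 < z) (t : ℝ) :
    HasDerivAt (schwinger s z) (t / 2 * schwinger (s + 1) z t) t := by
  have key := hasDerivAt_integral_of_dominated_loc_of_deriv_le
    (μ := volume.restrict (Ioi (1 : ℝ))) (x₀ := t)
    (F := fun t τ => τ ^ (-s) * Real.exp (-(z * τ) + t ^ 2 / (4 * τ)))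
    (F' := fun t τ => t / 2 * (τ ^ (-(s + 1)) * Real.exp (-(z * τ) + t ^ 2 / (4 * τ))))
    (bound := fun τ => (|t| + 1) / 2 *
      (Real.exp ((|t| + 1) ^ 2 / 4) * (τ ^ (-(s + 1)) * Real.exp (-(z * τ)))))
    (Metric.ball_mem_nhds t one_pos)
    (Eventually.of_forall fun t' => (measurable_rpow_mul_exp_add s z t').aestronglyMeasurable)
    (integrableOn_schwinger s hz t)
    ((measurable_rpow_mul_exp_add (s + 1) z t).aestronglyMeasurable.const_mul _)
    ((ae_restrict_iff' measurableSet_Ioi).2 (Eventually.of_forall fun τ hτ t' ht' => ?_))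
    (((integrableOn_rpow_mul_exp_neg (-(s + 1)) hz).const_mul _).const_mul _)
    ((ae_restrict_iff' measurableSet_Ioi).2 (Eventually.of_forall fun τ hτ t' ht' => ?_))
  · have h2 := key.2
    rwa [integral_const_mul] at h2
  · have h0 : 0 < τ := one_pos.trans hτ
    have h1 : |t'| ≤ |t| + 1 := by
      have := abs_sub_abs_le_abs_sub t' t
      rw [Metric.mem_ball, Real.dist_eq] at ht'
      linarith
    rw [norm_mul, Real.norm_of_nonneg (r := τ ^ (-(s + 1)) * _) (by positivity), Real.norm_eq_abs,
      abs_div, abs_two]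
    exact mul_le_mul (by linarith) (rpow_mul_exp_add_le hτ h1) (by positivity) (by positivity)
  · have h0 : 0 < τ := one_pos.trans hτ
    have h1 : HasDerivAt (fun t : ℝ => -(z * τ) + t ^ 2 / (4 * τ)) (2 * t' / (4 * τ)) t' := by
      simpa using ((hasDerivAt_pow 2 t').div_const (4 * τ)).const_add (-(z * τ))
    refine (h1.exp.const_mul (τ ^ (-s))).congr_deriv ?_
    rw [show -(s + 1) = -s - 1 by ring, Real.rpow_sub_one h0.ne']
    field_simp
    ring

/-- The wave equation for `schwinger (1 / 2) z`, with an inhomogeneity coming from the lower limit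
`τ = 1` of the integral. -/
theorem schwinger_wave {z : ℝ} (hz : 0 < z) (t : ℝ) :
    1 / 2 * schwinger (3 / 2) z t + t ^ 2 / 4 * schwinger (5 / 2) z t =
      Real.exp (-z + t ^ 2 / 4) - z * schwinger (1 / 2) z t := by
  have hd : ∀ τ ∈ Ici (1 : ℝ),
      HasDerivAt (fun τ : ℝ => τ ^ (-(1 / 2) : ℝ) * Real.exp (-(z * τ) + t ^ 2 / (4 * τ)))
      (-(1 / 2) * (τ ^ (-(3 / 2) : ℝ) * Real.exp (-(z * τ) + t ^ 2 / (4 * τ))) +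
        -(t ^ 2 / 4) * (τ ^ (-(5 / 2) : ℝ) * Real.exp (-(z * τ) + t ^ 2 / (4 * τ))) +
        -z * (τ ^ (-(1 / 2) : ℝ) * Real.exp (-(z * τ) + t ^ 2 / (4 * τ)))) τ := by
    intro τ hτ
    have h0 : 0 < τ := lt_of_lt_of_le one_pos hτ
    have h1 : HasDerivAt (fun τ : ℝ => -(z * τ) + t ^ 2 / (4 * τ))
        (-z + (0 * (4 * τ) - t ^ 2 * 4) / (4 * τ) ^ 2) τ :=
      (hasDerivAt_const_mul z).fun_neg.fun_add
        ((hasDerivAt_const τ (t ^ 2)).fun_div (hasDerivAt_const_mul 4) (by positivity))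
    refine ((Real.hasDerivAt_rpow_const (p := -(1 / 2)) (Or.inl h0.ne')).mul
      h1.exp).congr_deriv ?_
    rw [show (-(3 / 2) : ℝ) = -(1 / 2) - 1 by norm_num,
      show (-(5 / 2) : ℝ) = -(1 / 2) - 1 - 1 by norm_num, Real.rpow_sub_one h0.ne' (-(1 / 2) - 1),
      Real.rpow_sub_one h0.ne' (-(1 / 2))]
    field_simp
    ring
  have i1 := (integrableOn_schwinger (3 / 2) hz t).const_mul (-(1 / 2))
  have i2 := (integrableOn_schwinger (5 / 2) hz t).const_mul (-(t ^ 2 / 4))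
  have i3 := (integrableOn_schwinger (1 / 2) hz t).const_mul (-z)
  have hlim : Tendsto (fun τ : ℝ => τ ^ (-(1 / 2) : ℝ) * Real.exp (-(z * τ) + t ^ 2 / (4 * τ)))
      atTop (𝓝 0) := by
    have h1 := (tendsto_rpow_mul_exp_neg (-(1 / 2)) hz).const_mul (Real.exp (|t| ^ 2 / 4))
    rw [mul_zero] at h1
    refine squeeze_zero' ?_ ?_ h1
    · filter_upwards [eventually_gt_atTop 1] with τ hτ
      have h0 : 0 < τ := one_pos.trans hτ
      positivity
    · filter_upwards [eventually_gt_atTop 1] with τ hτ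
      exact rpow_mul_exp_add_le hτ le_rfl
  have key := integral_Ioi_of_hasDerivAt_of_tendsto' hd ((i1.add i2).add i3) hlim
  have e1 : ∫ τ in Ioi (1 : ℝ),
      (-(1 / 2) * (τ ^ (-(3 / 2) : ℝ) * Real.exp (-(z * τ) + t ^ 2 / (4 * τ))) +
        -(t ^ 2 / 4) * (τ ^ (-(5 / 2) : ℝ) * Real.exp (-(z * τ) + t ^ 2 / (4 * τ))) +
        -z * (τ ^ (-(1 / 2) : ℝ) * Real.exp (-(z * τ) + t ^ 2 / (4 * τ)))) =
      -(1 / 2) * schwinger (3 / 2) z t + -(t ^ 2 / 4) * schwinger (5 / 2) z t +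
        -z * schwinger (1 / 2) z t := by
    have a1 := integral_add (i1.add i2) i3
    have a2 := integral_add i1 i2
    simp only [Pi.add_apply] at a1 a2
    rw [a1, a2, integral_const_mul, integral_const_mul, integral_const_mul]
    rfl
  rw [e1] at key
  simp only [Real.one_rpow, one_mul, mul_one, zero_sub] at key
  linarith

/-- The primitive `∫_0^u exp (w² / 4) dw`. -/
noncomputable def gaussPrimitive (u : ℝ) : ℝ := ∫ w in (0 : ℝ)..u, Real.exp (w ^ 2 / 4)

theorem hasDerivAt_gaussPrimitive (u : ℝ) :
    HasDerivAt gaussPrimitive (Real.exp (u ^ 2 / 4)) u := by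
  have hc : Continuous fun w : ℝ => Real.exp (w ^ 2 / 4) := by fun_prop
  exact intervalIntegral.integral_hasDerivAt_right (hc.intervalIntegrable _ _)
    hc.stronglyMeasurable.stronglyMeasurableAtFilter hc.continuousAt

theorem continuous_gaussPrimitive : Continuous gaussPrimitive :=
  continuous_iff_continuousAt.2 fun u => (hasDerivAt_gaussPrimitive u).continuousAt

theorem schwinger_half_zero {E : ℝ} (hE : 0 < E) :
    schwinger (1 / 2) (E ^ 2) 0 = Real.sqrt Real.pi / E -
      ∫ τ in Ioc (0 : ℝ) 1, Real.exp (-(E ^ 2 * τ)) * τ ^ (-(1 / 2) : ℝ) := by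
  have h := expIntegral_half (z := E ^ 2) (by positivity)
  rw [Real.sqrt_sq hE.le] at h
  rw [← h, schwinger, expIntegral]
  simp

/-- Duhamel's formula for the inhomogeneous wave equation `schwinger_wave`.  It splits
`cos (t E) / E` into the large Schwinger parameters, which are singular at `E = 0`, and a
superposition of functions `cos (b E) exp (- τ E²)` with `|b| ≤ |t|` and `0 ≤ τ ≤ 1`, which are
entire in `E²`. -/
theorem cos_div_eq {E : ℝ} (hE : 0 < E) (t : ℝ) :
    Real.sqrt Real.pi * (Real.cos (t * E) / E) = schwinger (1 / 2) (E ^ 2) t +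
      (∫ τ in Ioc (0 : ℝ) 1, Real.cos (t * E) * Real.exp (-(E ^ 2 * τ)) * τ ^ (-(1 / 2) : ℝ)) -
      ∫ θ in Ioc (0 : ℝ) 1, Real.cos (t * (1 - θ) * E) * Real.exp (-E ^ 2) *
        (t * gaussPrimitive (t * θ)) := by
  have hz : 0 < E ^ 2 := by positivity
  set V := schwinger (1 / 2) (E ^ 2)
  set Q : ℝ → ℝ := fun u => u / 2 * schwinger (3 / 2) (E ^ 2) u -
    Real.exp (-E ^ 2) * gaussPrimitive u with hQ
  have hV : ∀ u, HasDerivAt V (Q u + Real.exp (-E ^ 2) * gaussPrimitive u) u := fun u => by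
    have := hasDerivAt_schwinger (1 / 2) hz u
    rw [show (1 / 2 : ℝ) + 1 = 3 / 2 by norm_num] at this
    exact this.congr_deriv (by rw [hQ]; ring)
  have hQd : ∀ u, HasDerivAt Q (-(E ^ 2 * V u)) u := fun u => by
    have h1 := hasDerivAt_schwinger (3 / 2) hz u
    norm_num at h1
    refine ((((hasDerivAt_id u).div_const 2).mul h1).fun_sub
      ((hasDerivAt_gaussPrimitive u).const_mul (Real.exp (-E ^ 2)))).congr_deriv ?_
    rw [← Real.exp_add]
    have h2 := schwinger_wave hz u
    simp only [id]
    linear_combination h2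
  have hY : ∀ θ ∈ uIcc (0 : ℝ) 1, HasDerivAt (fun θ => V (t * θ) * Real.cos (t * (1 - θ) * E) +
      Q (t * θ) * (Real.sin (t * (1 - θ) * E) / E))
      (Real.cos (t * (1 - θ) * E) * Real.exp (-E ^ 2) * (t * gaussPrimitive (t * θ))) θ := by
    intro θ _
    have h1 : HasDerivAt (fun θ => t * (1 - θ) * E) (-(t * E)) θ := by
      refine ((((hasDerivAt_id θ).const_sub 1).const_mul t).mul_const E).congr_deriv ?_
      ring
    have h2 := HasDerivAt.comp θ (hV (t * θ)) (hasDerivAt_const_mul t)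
    have h3 := HasDerivAt.comp θ (hQd (t * θ)) (hasDerivAt_const_mul t)
    refine ((h2.mul h1.cos).fun_add (h3.mul (h1.sin.div_const E))).congr_deriv ?_
    simp only [Function.comp]
    field_simp
    ring
  have hcont : Continuous fun θ : ℝ =>
      Real.cos (t * (1 - θ) * E) * Real.exp (-E ^ 2) * (t * gaussPrimitive (t * θ)) := by
    have := continuous_gaussPrimitive
    fun_prop
  have key := intervalIntegral.integral_eq_sub_of_hasDerivAt hY (hcont.intervalIntegrable _ _)
  have h0 : V 0 = Real.sqrt Real.pi / E -
      ∫ τ in Ioc (0 : ℝ) 1, Real.exp (-(E ^ 2 * τ)) * τ ^ (-(1 / 2) : ℝ) :=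
    schwinger_half_zero hE
  have hQ0 : Q 0 = 0 := by simp [hQ, gaussPrimitive]
  rw [intervalIntegral.integral_of_le zero_le_one] at key
  simp only [mul_one, sub_self, mul_zero, zero_mul, Real.cos_zero, Real.sin_zero, zero_div,
    add_zero, sub_zero, hQ0, h0] at key
  rw [key]
  simp only [mul_assoc]
  rw [integral_const_mul]
  ring

theorem sin_div_eq {E : ℝ} (hE : E ≠ 0) (b : ℝ) :
    Real.sin (b * E) / E = ∫ θ in Ioc (0 : ℝ) 1, Real.cos (b * θ * E) * b := by
  have h : ∀ θ ∈ uIcc (0 : ℝ) 1, HasDerivAt (fun θ => Real.sin (b * θ * E) / E)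
      (Real.cos (b * θ * E) * b) θ := by
    intro θ _
    have h1 : HasDerivAt (fun θ => b * θ * E) (b * E) θ :=
      (hasDerivAt_const_mul b).mul_const E
    refine (h1.sin.div_const E).congr_deriv ?_
    field_simp
  have := intervalIntegral.integral_eq_sub_of_hasDerivAt h
    (Continuous.intervalIntegrable (by fun_prop) _ _)
  rw [intervalIntegral.integral_of_le zero_le_one] at this
  rw [this]
  simp

/-! ### Distributions from seminorm estimates -/

section

variable {E : Type} [NormedAddCommGroup E] [NormedSpace ℝ E]

/-- The test function `h` is supported in the ball of radius `R`, and its derivatives of order at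
most `N` are bounded by `B`. -/
def TestBound (N : ℕ) (R B : ℝ) (h : Test E) : Prop :=
  (∀ x, h x ≠ 0 → ‖x‖ ≤ R) ∧ ∀ i ≤ N, ∀ x, ‖iteratedFDeriv ℝ i h x‖ ≤ B

theorem TestBound.norm_le {N : ℕ} {R B : ℝ} {h : Test E} (hh : TestBound N R B h) (x : E) :
    ‖h x‖ ≤ B := by
  simpa using hh.2 0 (Nat.zero_le _) x

theorem TestBound.nonneg {N : ℕ} {R B : ℝ} {h : Test E} (hh : TestBound N R B h) : 0 ≤ B :=
  (norm_nonneg _).trans (hh.norm_le 0)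

/-- Every test function satisfies such bounds for some `R` and `B`. -/
theorem exists_testBound (N : ℕ) (h : Test E) : ∃ R B, 1 ≤ R ∧ TestBound N R B h := by
  obtain ⟨R, hR⟩ := h.hasCompactSupport.isCompact.isBounded.exists_norm_le
  have h1 : ∀ i : ℕ, ∃ C, ∀ x, ‖iteratedFDeriv ℝ i h x‖ ≤ C := fun i =>
    Continuous.bounded_above_of_compact_support
      (h.contDiff.continuous_iteratedFDeriv (by exact_mod_cast le_top))
      (h.hasCompactSupport.iteratedFDeriv i)
  choose C hC using h1
  refine ⟨max R 1, ∑ i ∈ Finset.range (N + 1), C i, le_max_right _ _, fun x hx =>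
    (hR x (subset_tsupport _ hx)).trans (le_max_left _ _), fun i hi x => (hC i x).trans ?_⟩
  exact Finset.single_le_sum (f := C) (fun j _ => (norm_nonneg _).trans (hC j 0))
    (Finset.mem_range.2 (Nat.lt_succ_of_le hi))

/-- A linear functional on test functions which is bounded on each ball by finitely many
derivatives is a distribution. -/
theorem exists_dist_of_bound (T : Test E → ℂ) (hadd : ∀ f g, T (f + g) = T f + T g)
    (hsmul : ∀ (c : ℝ) f, T (c • f) = c * T f) (N : ℕ)
    (hT : ∀ R, 1 ≤ R → ∃ C : ℝ, 0 ≤ C ∧ ∀ h B, TestBound N R B h → ‖T h‖ ≤ C * B) :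
    ∃ S : Dist' E, ∀ h, S h = T h := by
  refine ⟨(TestFunction.mkCLM ℝ T hadd (fun c f => by rw [hsmul]; rfl) fun K hK => ?_ :
    Test E →L[ℝ] ℂ), fun h => rfl⟩
  obtain ⟨R, hR⟩ := K.isCompact.isBounded.exists_norm_le
  obtain ⟨C, hC, hT⟩ := hT (max R 1) (le_max_right _ _)
  refine (ContDiffMapSupportedIn.mkCLMtoNormedSpace ℝ
    (T ∘ TestFunction.ofSupportedIn hK)
    (fun f g => hadd (TestFunction.ofSupportedIn hK f) (TestFunction.ofSupportedIn hK g))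
    (fun c f => hsmul c (TestFunction.ofSupportedIn hK f))
    ⟨Finset.range (N + 1), C, hC, fun f => ?_⟩).continuous
  refine hT _ _ ⟨fun x hx => (hR x ?_).trans (le_max_left _ _), fun i hi x => ?_⟩
  · by_contra hxK
    exact hx (f.zero_on_compl hxK)
  · exact (ContDiffMapSupportedIn.norm_iteratedFDeriv_apply_le_seminorm_top ℝ).trans
      (Seminorm.le_finset_sup_apply (Finset.mem_range.2 (Nat.lt_succ_of_le hi)))

theorem smul_dist_apply (c : ℂ) (S : Dist' E) (h : Test E) : (c • S) h = c * S h := rfl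

end

/-! ### The spatial Fourier transform of a test function -/

section

variable {d : ℕ}

/-- The spatial Fourier transform `∫ exp (i p·x) h (t, x) dx`. -/
noncomputable def spaceFourier (h : Test (Minkowski d)) (t : ℝ) (p : Space d) : ℂ :=
  ∫ x : Space d, Complex.exp (Complex.I * (inner ℝ p x : ℝ)) * (h (t, x) : ℂ)

theorem norm_exp_I_mul (a : ℝ) : ‖Complex.exp (Complex.I * (a : ℂ))‖ = 1 := by
  rw [mul_comm]; exact Complex.norm_exp_ofReal_mul_I a

theorem TestBound.slice {N : ℕ} {R B : ℝ} {h : Test (Minkowski d)} (hh : TestBound N R B h)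
    (t : ℝ) {x : Space d} (hx : h (t, x) ≠ 0) : |t| ≤ R ∧ ‖x‖ ≤ R := by
  have := hh.1 _ hx
  rw [Prod.norm_mk, max_le_iff] at this
  exact this

theorem TestBound.norm_le_indicator {N : ℕ} {R B : ℝ} {h : Test (Minkowski d)}
    (hh : TestBound N R B h) (t : ℝ) (x : Space d) :
    ‖h (t, x)‖ ≤ (Metric.closedBall (0 : Space d) R).indicator (fun _ => B) x := by
  by_cases hx : h (t, x) = 0
  · rw [hx, norm_zero]; exact indicator_nonneg (fun _ _ => hh.nonneg) _
  · rw [indicator_of_mem (by simpa using (hh.slice t hx).2)]; exact hh.norm_le _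

theorem integrable_indicator_closedBall (R B : ℝ) :
    Integrable ((Metric.closedBall (0 : Space d) R).indicator (fun _ => B)) :=
  (integrable_indicator_iff Metric.isClosed_closedBall.measurableSet).2
    (integrableOn_const (by exact measure_closedBall_lt_top.ne))

theorem continuous_slice (h : Test (Minkowski d)) (t : ℝ) :
    Continuous fun x : Space d => h (t, x) := h.continuous.comp (by fun_prop)

theorem integrable_slice (h : Test (Minkowski d)) (t : ℝ) :
    Integrable fun x : Space d => (h (t, x) : ℂ) := by
  obtain ⟨R, B, -, hh⟩ := exists_testBound 0 h
  refine (integrable_indicator_closedBall R B).mono'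
    (Complex.continuous_ofReal.comp (continuous_slice h t)).aestronglyMeasurable
    (Eventually.of_forall fun x => ?_)
  rw [Complex.norm_real]
  exact hh.norm_le_indicator t x

theorem integrable_exp_mul_slice (h : Test (Minkowski d)) (t : ℝ) (p : Space d) :
    Integrable fun x : Space d =>
      Complex.exp (Complex.I * (inner ℝ p x : ℝ)) * (h (t, x) : ℂ) := by
  refine (integrable_slice h t).bdd_mul (c := 1) ?_ (Eventually.of_forall fun x => ?_)
  · exact Continuous.aestronglyMeasurable (by fun_prop)
  · rw [norm_exp_I_mul]

theorem spaceFourier_add (f g : Test (Minkowski d)) (t : ℝ) (p : Space d) :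
    spaceFourier (f + g) t p = spaceFourier f t p + spaceFourier g t p := by
  rw [spaceFourier, spaceFourier, spaceFourier,
    ← integral_add (integrable_exp_mul_slice f t p) (integrable_exp_mul_slice g t p)]
  congr 1
  funext x
  rw [show (f + g) (t, x) = f (t, x) + g (t, x) from rfl]
  push_cast
  ring

theorem spaceFourier_smul (c : ℝ) (f : Test (Minkowski d)) (t : ℝ) (p : Space d) :
    spaceFourier (c • f) t p = c * spaceFourier f t p := by
  rw [spaceFourier, spaceFourier, ← integral_const_mul]
  congr 1
  funext x
  rw [show (c • f) (t, x) = c * f (t, x) from rfl]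
  push_cast
  ring

theorem spaceFourier_eq_zero {N : ℕ} {R B : ℝ} {h : Test (Minkowski d)} (hh : TestBound N R B h)
    {t : ℝ} (ht : R < |t|) (p : Space d) : spaceFourier h t p = 0 := by
  rw [spaceFourier]
  refine (integral_congr_ae (Eventually.of_forall fun x => ?_)).trans (integral_zero _ _)
  have : h (t, x) = 0 := by
    by_contra hx
    exact absurd (hh.slice t hx).1 (not_le.2 ht)
  simp [this]

theorem stronglyMeasurable_spaceFourier (h : Test (Minkowski d)) :
    StronglyMeasurable fun y : ℝ × Space d => spaceFourier h y.1 y.2 := by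
  have hc : Continuous fun z : (ℝ × Space d) × Space d =>
      Complex.exp (Complex.I * (inner ℝ z.1.2 z.2 : ℝ)) * (h (z.1.1, z.2) : ℂ) := by
    have := h.continuous
    fun_prop
  exact hc.stronglyMeasurable.integral_prod_right (f := fun (y : ℝ × Space d) (x : Space d) =>
    Complex.exp (Complex.I * (inner ℝ y.2 x : ℝ)) * (h (y.1, x) : ℂ))

theorem norm_iteratedFDeriv_slice_le {N : ℕ} {R B : ℝ} {h : Test (Minkowski d)}
    (hh : TestBound N R B h) (t : ℝ) {i : ℕ} (hi : i ≤ N) (x : Space d) :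
    ‖iteratedFDeriv ℝ i (fun x : Space d => (h (t, x) : ℂ)) x‖ ≤ B := by
  have h1 : (fun x : Space d => (h (t, x) : ℂ)) = Complex.ofRealLI ∘
      ((fun y => h ((t, 0) + y)) ∘ ContinuousLinearMap.inr ℝ ℝ (Space d)) := by
    funext x; simp
  have hs : ContDiff ℝ ∞ fun y : Minkowski d => h ((t, 0) + y) :=
    h.contDiff.comp (contDiff_const.add contDiff_id)
  have hi' : (i : WithTop ℕ∞) ≤ ∞ := by exact_mod_cast le_top
  have hs2 : ContDiff ℝ ∞ ((fun y : Minkowski d => h ((t, 0) + y)) ∘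
      ContinuousLinearMap.inr ℝ ℝ (Space d)) :=
    hs.comp (ContinuousLinearMap.inr ℝ ℝ (Space d)).contDiff
  rw [h1, LinearIsometry.norm_iteratedFDeriv_comp_left _ hs2.contDiffAt hi']
  refine ((congrArg norm (ContinuousLinearMap.iteratedFDeriv_comp_right
    (ContinuousLinearMap.inr ℝ ℝ (Space d)) hs x hi')).le.trans
    (ContinuousMultilinearMap.norm_compContinuousLinearMap_le _ _)).trans ?_
  rw [iteratedFDeriv_comp_add_left]
  have h2 : ‖ContinuousLinearMap.inr ℝ ℝ (Space d)‖ ≤ 1 :=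
    ContinuousLinearMap.opNorm_le_bound _ zero_le_one fun x => by simp
  have h3 : ∏ _j : Fin i, ‖ContinuousLinearMap.inr ℝ ℝ (Space d)‖ ≤ 1 :=
    Finset.prod_le_one (fun _ _ => norm_nonneg _) fun _ _ => h2
  exact (mul_le_of_le_one_right (norm_nonneg _) h3).trans (hh.2 i hi _)

open FourierTransform in
theorem spaceFourier_eq_fourier (h : Test (Minkowski d)) (t : ℝ) (p : Space d) :
    spaceFourier h t p =
      𝓕 (fun x : Space d => (h (t, x) : ℂ)) (-(2 * Real.pi)⁻¹ • p) := by
  rw [spaceFourier, Real.fourier_eq']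
  congr 1
  funext x
  rw [smul_eq_mul, inner_smul_right, real_inner_comm]
  congr 2
  have := Real.pi_pos.ne'
  push_cast
  have h2 : (Real.pi : ℂ) ≠ 0 := by exact_mod_cast this
  field_simp

/-- The spatial Fourier transform decays, uniformly in time, faster than it takes to be integrable
over momentum space. -/
theorem norm_spaceFourier_le (N : ℕ) (R : ℝ) : ∃ C : ℝ, 0 ≤ C ∧
    ∀ (h : Test (Minkowski d)) (B : ℝ), TestBound N R B h → ∀ t p,
      ‖spaceFourier h t p‖ ≤ C * B * (1 + ‖p‖) ^ (-(N : ℝ)) := by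
  set v : ℝ := ∫ x : Space d, (Metric.closedBall (0 : Space d) R).indicator (fun _ => (1 : ℝ)) x
  have hv : 0 ≤ v := integral_nonneg fun x => indicator_nonneg (fun _ _ => zero_le_one) _
  -- the decay of order `n` of the Fourier transform
  have key : ∀ n ≤ N, ∀ (h : Test (Minkowski d)) (B : ℝ), TestBound N R B h → ∀ t p,
      ‖p‖ ^ n * ‖spaceFourier h t p‖ ≤ (2 * Real.pi) ^ n * (2 ^ n * ((n + 1) * (v * B))) := by
    intro n hn h B hh t p
    set f : Space d → ℂ := fun x => (h (t, x) : ℂ)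
    have hsupp : ∀ i ≤ N, ∀ x, ‖iteratedFDeriv ℝ i f x‖ ≤
        (Metric.closedBall (0 : Space d) R).indicator (fun _ => B) x := by
      intro i hi x
      by_cases hx : x ∈ Metric.closedBall (0 : Space d) R
      · rw [indicator_of_mem hx]; exact norm_iteratedFDeriv_slice_le hh t hi x
      · have h1 : tsupport f ⊆ Metric.closedBall (0 : Space d) R := by
          refine closure_minimal (fun y hy => ?_) Metric.isClosed_closedBall
          simp only [f, Function.mem_support, ne_eq, Complex.ofReal_eq_zero] at hy
          simpa using (hh.slice t hy).2
        have h2 : iteratedFDeriv ℝ i f x = 0 := by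
          by_contra h0
          exact hx (h1 (support_iteratedFDeriv_subset i h0))
        rw [h2, norm_zero, indicator_of_notMem hx]
    have hf : ContDiff ℝ ∞ f :=
      Complex.ofRealCLM.contDiff.comp (h.contDiff.comp (contDiff_const.prodMk contDiff_id))
    have hint : ∀ i ≤ N, Integrable fun x => ‖iteratedFDeriv ℝ i f x‖ := fun i hi =>
      (integrable_indicator_closedBall R B).mono'
        (hf.continuous_iteratedFDeriv (by exact_mod_cast le_top)).norm.aestronglyMeasurable
        (Eventually.of_forall fun x => by rw [norm_norm]; exact hsupp i hi x)
    have h1 := Real.pow_mul_norm_iteratedFDeriv_fourier_le (K := 0) (N := (N : ℕ∞))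
      (f := f) (hf.of_le (by exact_mod_cast le_top)) (fun k i hk hi => by
        have hk0 : k = 0 := by simpa using hk
        subst hk0
        simpa using hint i (by exact_mod_cast hi)) (k := 0) (n := n) (by simp)
      (by exact_mod_cast hn) (-(2 * Real.pi)⁻¹ • p)
    rw [norm_iteratedFDeriv_zero, ← spaceFourier_eq_fourier, norm_smul, norm_neg, norm_inv,
      Real.norm_of_nonneg (by positivity), mul_pow, inv_pow] at h1
    have h2 : ∑ q ∈ Finset.range (0 + 1) ×ˢ Finset.range (n + 1),
        ∫ x, ‖x‖ ^ q.1 * ‖iteratedFDeriv ℝ q.2 f x‖ ≤ (n + 1) * (v * B) := by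
      rw [Finset.sum_product]
      simp only [zero_add, Finset.range_one, Finset.sum_singleton, pow_zero, one_mul]
      refine (Finset.sum_le_card_nsmul _ _ (v * B) fun i hi => ?_).trans (by simp)
      have hi' : i ≤ N := (Nat.lt_succ_iff.1 (Finset.mem_range.1 hi)).trans hn
      rw [← integral_mul_const]
      refine integral_mono (hint i hi') ((integrable_indicator_closedBall R 1).mul_const B)
        fun x => (hsupp i hi' x).trans (le_of_eq ?_)
      by_cases hx : x ∈ Metric.closedBall (0 : Space d) R
      · rw [indicator_of_mem hx, indicator_of_mem hx, one_mul]
      · rw [indicator_of_notMem hx, indicator_of_notMem hx, zero_mul]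
    have h3 := h1.trans (mul_le_mul_of_nonneg_left h2 (by positivity))
    simp only [pow_zero, one_mul, Nat.cast_zero, mul_zero, zero_add] at h3
    have hpi : (0 : ℝ) < (2 * Real.pi) ^ n := by positivity
    rwa [mul_assoc, inv_mul_le_iff₀ hpi] at h3
  refine ⟨2 ^ N * (v + (2 * Real.pi) ^ N * (2 ^ N * ((N + 1) * v))), by positivity,
    fun h B hh t p => ?_⟩
  have hB := hh.nonneg
  have h0 := key 0 (Nat.zero_le _) h B hh t p
  have hN := key N le_rfl h B hh t p
  simp only [pow_zero, one_mul, Nat.cast_zero, zero_add] at h0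
  rw [Real.rpow_neg (by positivity), Real.rpow_natCast, ← div_eq_mul_inv,
    le_div_iff₀ (by positivity)]
  have h4 : (1 + ‖p‖) ^ N ≤ 2 ^ N * (1 + ‖p‖ ^ N) := by
    have := add_pow_le zero_le_one (norm_nonneg p) N
    rw [one_pow] at this
    refine this.trans (mul_le_mul_of_nonneg_right ?_ (by positivity))
    exact pow_le_pow_right₀ one_le_two (by omega)
  calc ‖spaceFourier h t p‖ * (1 + ‖p‖) ^ N
      ≤ ‖spaceFourier h t p‖ * (2 ^ N * (1 + ‖p‖ ^ N)) := by gcongr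
    _ = 2 ^ N * (‖spaceFourier h t p‖ + ‖p‖ ^ N * ‖spaceFourier h t p‖) := by ring
    _ ≤ 2 ^ N * (v * B + (2 * Real.pi) ^ N * (2 ^ N * ((N + 1) * (v * B)))) := by gcongr
    _ = _ := by ring

end

/-! ### Superpositions of entire functions of the squared energy -/

section

variable {d : ℕ}

/-- A dominating function on the space of times, momenta and parameters `θ`. -/
noncomputable def parameterMajorant (d : ℕ) (R : ℝ) (y : (ℝ × Space d) × ℝ) : ℝ :=
  (Icc (-R) R).indicator (fun _ => (1 : ℝ)) y.1.1 * (1 + ‖y.1.2‖) ^ (-(d : ℝ)) *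
    y.2 ^ (-(1 / 2) : ℝ)

theorem integrable_momentumMajorant (hd : 1 ≤ d) (R : ℝ) :
    Integrable fun y : ℝ × Space d =>
      (Icc (-R) R).indicator (fun _ => (1 : ℝ)) y.1 * (1 + ‖y.2‖) ^ (-(d : ℝ)) := by
  refine Integrable.mul_prod (f := (Icc (-R) R).indicator (fun _ => (1 : ℝ)))
    (g := fun p : Space d => (1 + ‖p‖) ^ (-(d : ℝ))) ?_ ?_
  · exact (integrable_indicator_iff measurableSet_Icc).2 (integrableOn_const (by simp))
  · refine integrable_one_add_norm ?_
    rw [finrank_euclideanSpace, Fintype.card_fin]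
    exact_mod_cast (by omega : d - 1 < d)

theorem integrable_parameterMajorant (hd : 1 ≤ d) (R : ℝ) :
    Integrable (parameterMajorant d R) (volume.prod (volume.restrict (Ioc (0 : ℝ) 1))) := by
  refine Integrable.mul_prod (g := fun θ : ℝ => θ ^ (-(1 / 2) : ℝ))
    (integrable_momentumMajorant hd R) ?_
  have := (intervalIntegral.intervalIntegrable_rpow' (a := 0) (b := 1)
    (show (-1 : ℝ) < -(1 / 2) by norm_num))
  rwa [intervalIntegrable_iff_integrableOn_Ioc_of_le zero_le_one] at this

theorem parameterMajorant_nonneg (R : ℝ) {y : (ℝ × Space d) × ℝ} (hy : 0 < y.2) :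
    0 ≤ parameterMajorant d R y :=
  mul_nonneg (mul_nonneg (indicator_nonneg (fun _ _ => zero_le_one) _) (by positivity))
    (by positivity)

theorem ae_parameter :
    ∀ᵐ y ∂((volume : Measure (ℝ × Space d)).prod (volume.restrict (Ioc (0 : ℝ) 1))),
      y.2 ∈ Ioc (0 : ℝ) 1 :=
  Measure.quasiMeasurePreserving_snd.ae (ae_restrict_mem measurableSet_Ioc)

theorem energy_sq (m : ℝ) (p : Space d) : energy m p ^ 2 = ‖p‖ ^ 2 + m ^ 2 :=
  Real.sq_sqrt (by positivity)

theorem energy_nonneg (m : ℝ) (p : Space d) : 0 ≤ energy m p := Real.sqrt_nonneg _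

theorem energy_pos (m : ℝ) {p : Space d} (hp : p ≠ 0) : 0 < energy m p :=
  Real.sqrt_pos.2 (by have := norm_pos_iff.2 hp; positivity)

theorem continuous_energy (m : ℝ) : Continuous fun p : Space d => energy m p := by
  unfold energy
  fun_prop

theorem cosExp_zero_eq (b τ m : ℝ) (p : Space d) :
    cosExp b τ (‖p‖ ^ 2 + m ^ 2) 0 0 0 =
      Real.cos (b * energy m p) * Real.exp (-(energy m p ^ 2 * τ)) := by
  have h0 : 0 ≤ ‖p‖ ^ 2 + m ^ 2 := by positivity
  rw [energy_sq, cosExp, cosSqrt, Real.sqrt_mul (sq_nonneg b), Real.sqrt_sq_eq_abs, mul_comm τ]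
  simp only [mul_zero, pow_zero, one_mul]
  congr 1
  rw [show Real.sqrt (‖p‖ ^ 2 + m ^ 2) = energy m p from rfl, ← Real.cos_abs (b * _), abs_mul,
    abs_of_nonneg (energy_nonneg m p)]

/-- If `|b| ≤ |t|`, `0 ≤ τ ≤ 1` and the weight `w` is integrable in `θ`, then
`∫ ∫_0^1 cos (b ω) exp (- τ ω²) w dθ ĥ(t, p) dt dp` with `ω = √(|p|² + m²)` is, together with all
its derivatives with respect to `m²`, a distribution in `h`. -/
theorem exists_dist_chain (hd : 1 ≤ d) {b τ w : ℝ → ℝ → ℝ} (hb : Measurable (Function.uncurry b))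
    (hτ : Measurable (Function.uncurry τ)) (hw : Measurable (Function.uncurry w))
    (hb1 : ∀ θ ∈ Ioc (0 : ℝ) 1, ∀ t, |b θ t| ≤ |t|)
    (hτ1 : ∀ θ ∈ Ioc (0 : ℝ) 1, ∀ t, τ θ t ∈ Icc (0 : ℝ) 1)
    (hw1 : ∀ R : ℝ, ∃ C : ℝ, 0 ≤ C ∧ ∀ θ ∈ Ioc (0 : ℝ) 1, ∀ t, |t| ≤ R →
      |w θ t| ≤ C * θ ^ (-(1 / 2) : ℝ)) :
    ∃ Φ : ℕ → ℝ → Dist' (Minkowski d),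
      (∀ K h, IsMassChain K fun n m => Φ n m h) ∧
      ∀ m h, Integrable (fun y : ℝ × Space d =>
          ((∫ θ in Ioc (0 : ℝ) 1, Real.cos (b θ y.1 * energy m y.2) *
            Real.exp (-(energy m y.2 ^ 2 * τ θ y.1)) * w θ y.1 : ℝ) : ℂ) *
            spaceFourier h y.1 y.2) ∧
        Φ 0 m h = ∫ y : ℝ × Space d,
          ((∫ θ in Ioc (0 : ℝ) 1, Real.cos (b θ y.1 * energy m y.2) *
            Real.exp (-(energy m y.2 ^ 2 * τ θ y.1)) * w θ y.1 : ℝ) : ℂ) *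
            spaceFourier h y.1 y.2 := by
  set ν : Measure ((ℝ × Space d) × ℝ) := volume.prod (volume.restrict (Ioc (0 : ℝ) 1)) with hν
  set W : Test (Minkowski d) → (ℝ × Space d) × ℝ → ℂ := fun h y =>
    (w y.2 y.1.1 : ℂ) * spaceFourier h y.1.1 y.1.2 with hWdef
  have hmt : Measurable fun y : (ℝ × Space d) × ℝ => (y.2, y.1.1) := by fun_prop
  have hWm : ∀ h, Measurable (W h) := fun h =>
    (Complex.measurable_ofReal.comp (hw.comp hmt)).mul
      ((stronglyMeasurable_spaceFourier h).measurable.comp measurable_fst)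
  have hWsupp : ∀ {R B h}, TestBound d R B h → ∀ y, W h y ≠ 0 → |y.1.1| ≤ R := by
    intro R B h hh y hy
    by_contra hlt
    exact hy (by simp only [hWdef]; rw [spaceFourier_eq_zero hh (not_le.1 hlt), mul_zero])
  have hWb : ∀ R, ∃ C : ℝ, 0 ≤ C ∧ ∀ h B, TestBound d R B h →
      ∀ᵐ y ∂ν, ‖W h y‖ ≤ C * B * parameterMajorant d R y := by
    intro R
    obtain ⟨C₁, hC₁, h₁⟩ := hw1 R
    obtain ⟨C₂, hC₂, h₂⟩ := norm_spaceFourier_le (d := d) d R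
    refine ⟨C₁ * C₂, by positivity, fun h B hh => ?_⟩
    filter_upwards [ae_parameter (d := d)] with y hy
    have hB := hh.nonneg
    by_cases h0 : W h y = 0
    · rw [h0, norm_zero]
      have := parameterMajorant_nonneg (d := d) R hy.1
      positivity
    · have ht := hWsupp hh y h0
      rw [parameterMajorant, indicator_of_mem (s := Icc (-R) R) (abs_le.1 ht), one_mul, norm_mul,
        Complex.norm_real]
      calc ‖w y.2 y.1.1‖ * ‖spaceFourier h y.1.1 y.1.2‖
          ≤ (C₁ * y.2 ^ (-(1 / 2) : ℝ)) * (C₂ * B * (1 + ‖y.1.2‖) ^ (-(d : ℝ))) :=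
            mul_le_mul (h₁ _ hy _ ht) (h₂ h B hh _ _) (norm_nonneg _)
              (mul_nonneg hC₁ (Real.rpow_nonneg hy.1.le _))
        _ = _ := by ring
  have hWi : ∀ h, Integrable (W h) ν := by
    intro h
    obtain ⟨R, B, -, hh⟩ := exists_testBound d h
    obtain ⟨C, -, hC⟩ := hWb R
    exact ((integrable_parameterMajorant hd R).const_mul _).mono' (hWm h).aestronglyMeasurable
      (hC h B hh)
  set I : ℕ → ℝ → Test (Minkowski d) → ℂ := fun n m h =>
    ∫ y, (cosExp (b y.2 y.1.1) (τ y.2 y.1.1) (‖y.1.2‖ ^ 2 + m ^ 2) n 0 0 : ℂ) * W h y ∂ν with hI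
  have hcm : ∀ n m, Measurable fun y : (ℝ × Space d) × ℝ =>
      cosExp (b y.2 y.1.1) (τ y.2 y.1.1) (‖y.1.2‖ ^ 2 + m ^ 2) n 0 0 := fun n m =>
    (continuous_cosExp (X := ℝ × ℝ × ℝ) continuous_fst (continuous_fst.comp continuous_snd)
      (continuous_snd.comp continuous_snd) n 0 0).measurable.comp
      ((hb.comp hmt).prodMk ((hτ.comp hmt).prodMk (by fun_prop)))
  have hcb : ∀ {R : ℝ}, 1 ≤ R → ∀ n m, ∀ᵐ y ∂ν, |y.1.1| ≤ R →
      |cosExp (b y.2 y.1.1) (τ y.2 y.1.1) (‖y.1.2‖ ^ 2 + m ^ 2) n 0 0| ≤ 2 ^ n * R ^ (2 * n) := by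
    intro R hR n m
    filter_upwards [ae_parameter (d := d)] with y hy ht
    exact abs_cosExp_le hR ((hb1 _ hy _).trans ht) (hτ1 _ hy _) (by positivity) n 0 0
  have hbd : ∀ {R B h}, 1 ≤ R → TestBound d R B h → ∀ n m, ∀ᵐ y ∂ν,
      ‖(cosExp (b y.2 y.1.1) (τ y.2 y.1.1) (‖y.1.2‖ ^ 2 + m ^ 2) n 0 0 : ℂ) * W h y‖ ≤
        2 ^ n * R ^ (2 * n) * ‖W h y‖ := by
    intro R B h hR hh n m
    filter_upwards [hcb hR n m] with y hy
    rw [norm_mul, Complex.norm_real]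
    by_cases h0 : W h y = 0
    · simp [h0]
    · exact mul_le_mul_of_nonneg_right (hy (hWsupp hh y h0)) (norm_nonneg _)
  have hIi : ∀ n m h, Integrable (fun y =>
      (cosExp (b y.2 y.1.1) (τ y.2 y.1.1) (‖y.1.2‖ ^ 2 + m ^ 2) n 0 0 : ℂ) * W h y) ν := by
    intro n m h
    obtain ⟨R, B, hR, hh⟩ := exists_testBound d h
    exact ((hWi h).norm.const_mul _).mono' ((Complex.measurable_ofReal.comp (hcm n m)).mul
      (hWm h)).aestronglyMeasurable (hbd hR hh n m)
  have hdist : ∀ n m, ∃ S : Dist' (Minkowski d), ∀ h, S h = I n m h := by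
    intro n m
    refine exists_dist_of_bound (I n m) (fun f g => ?_) (fun c f => ?_) d fun R hR => ?_
    · simp only [hI]
      rw [← integral_add (hIi n m f) (hIi n m g)]
      congr 1
      funext y
      simp only [hWdef, spaceFourier_add]
      ring
    · simp only [hI]
      rw [← integral_const_mul]
      congr 1
      funext y
      simp only [hWdef, spaceFourier_smul]
      ring
    · obtain ⟨C, hC, hCb⟩ := hWb R
      set A := ∫ y, parameterMajorant d R y ∂ν
      have hA : 0 ≤ A := integral_nonneg_of_ae (by
        filter_upwards [ae_parameter (d := d)] with y hy
        exact parameterMajorant_nonneg R hy.1)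
      refine ⟨2 ^ n * R ^ (2 * n) * (C * A), by positivity, fun h B hh => ?_⟩
      have h1 : ∀ᵐ y ∂ν,
          ‖(cosExp (b y.2 y.1.1) (τ y.2 y.1.1) (‖y.1.2‖ ^ 2 + m ^ 2) n 0 0 : ℂ) * W h y‖ ≤
            2 ^ n * R ^ (2 * n) * (C * B) * parameterMajorant d R y := by
        filter_upwards [hbd hR hh n m, hCb h B hh] with y h1 h2
        refine h1.trans ((mul_le_mul_of_nonneg_left h2 (by positivity)).trans (le_of_eq ?_))
        ring
      refine (norm_integral_le_of_norm_le
        ((integrable_parameterMajorant hd R).const_mul _) h1).trans (le_of_eq ?_)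
      rw [integral_const_mul]
      ring
  choose Φ hΦ using hdist
  refine ⟨Φ, fun K h => ?_, fun m h => ?_⟩
  · obtain ⟨R, B, hR, hh⟩ := exists_testBound d h
    simp only [hΦ, hI]
    refine isMassChain_integral_cosExp (T := R) hR (hb.comp hmt) (hτ.comp hmt) (by fun_prop)
      (hWi h) ?_ ?_ (fun y => by positivity) K
    · filter_upwards [ae_parameter (d := d)] with y hy h0
      exact (hb1 _ hy _).trans (hWsupp hh y h0)
    · filter_upwards [ae_parameter (d := d)] with y hy
      exact hτ1 _ hy _
  · have h1 : ∀ y : ℝ × Space d, ∫ θ in Ioc (0 : ℝ) 1,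
        (cosExp (b θ y.1) (τ θ y.1) (‖y.2‖ ^ 2 + m ^ 2) 0 0 0 : ℂ) * W h (y, θ) =
        ((∫ θ in Ioc (0 : ℝ) 1, Real.cos (b θ y.1 * energy m y.2) *
            Real.exp (-(energy m y.2 ^ 2 * τ θ y.1)) * w θ y.1 : ℝ) : ℂ) *
            spaceFourier h y.1 y.2 := by
      intro y
      rw [← integral_complex_ofReal, ← integral_mul_const]
      congr 1
      funext θ
      rw [cosExp_zero_eq]
      simp only [hWdef]
      push_cast
      ring
    have h2 := (hIi 0 m h).integral_prod_left
    have h3 := integral_prod _ (hIi 0 m h)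
    simp only [h1] at h2 h3
    exact ⟨h2, by rw [hΦ]; exact h3⟩

end

/-! ### Large Schwinger parameters in position space -/

section

variable {d : ℕ}

theorem integrable_exp_neg_mul_sq_norm {τ : ℝ} (hτ : 0 < τ) :
    Integrable fun p : Space d => Real.exp (-(τ * ‖p‖ ^ 2)) := by
  have h := (GaussianFourier.integrable_cexp_neg_mul_sq_norm_add (V := Space d)
    (b := (τ : ℂ)) (by simpa using hτ) 0 0).norm
  refine h.congr (Eventually.of_forall fun p => ?_)
  simp only [Complex.norm_exp]
  congr 1
  simp [← Complex.ofReal_pow]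

theorem integral_exp_neg_mul_sq_norm {τ : ℝ} (hτ : 0 < τ) :
    ∫ p : Space d, Real.exp (-(τ * ‖p‖ ^ 2)) = (Real.pi / τ) ^ (((d - 1 : ℕ) : ℝ) / 2) := by
  have := GaussianFourier.integral_rexp_neg_mul_sq_norm (V := Space d) hτ
  simpa [neg_mul] using this

/-- The Gaussian regularisation of the momentum integral is a Gaussian average in position
space. -/
theorem integral_gaussian_mul_spaceFourier (h : Test (Minkowski d)) (t : ℝ) {τ : ℝ} (hτ : 0 < τ) :
    ∫ p : Space d, (Real.exp (-(τ * ‖p‖ ^ 2)) : ℂ) * spaceFourier h t p =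
      (((Real.pi / τ) ^ (((d - 1 : ℕ) : ℝ) / 2) *
        ∫ x : Space d, Real.exp (-‖x‖ ^ 2 / (4 * τ)) * h (t, x) : ℝ) : ℂ) := by
  have hi : Integrable (Function.uncurry fun (p x : Space d) =>
      (Real.exp (-(τ * ‖p‖ ^ 2)) : ℂ) *
        (Complex.exp (Complex.I * (inner ℝ p x : ℝ)) * (h (t, x) : ℂ)))
      (volume.prod volume) := by
    have h1 := (integrable_exp_neg_mul_sq_norm (d := d) hτ).mul_prod (integrable_slice h t).norm
    refine h1.mono' (Continuous.aestronglyMeasurable ?_) (Eventually.of_forall fun z => ?_)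
    · have := h.continuous
      fun_prop
    · rw [Function.uncurry, norm_mul, norm_mul, norm_exp_I_mul, one_mul, Complex.norm_real,
        Real.norm_of_nonneg (Real.exp_pos _).le]
  have h2 : ∀ p : Space d, (Real.exp (-(τ * ‖p‖ ^ 2)) : ℂ) * spaceFourier h t p =
      ∫ x : Space d, (Real.exp (-(τ * ‖p‖ ^ 2)) : ℂ) *
        (Complex.exp (Complex.I * (inner ℝ p x : ℝ)) * (h (t, x) : ℂ)) := fun p => by
    rw [spaceFourier, integral_const_mul]
  simp only [h2]
  rw [integral_integral_swap hi]
  have h3 : ∀ x : Space d, ∫ p : Space d, (Real.exp (-(τ * ‖p‖ ^ 2)) : ℂ) *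
        (Complex.exp (Complex.I * (inner ℝ p x : ℝ)) * (h (t, x) : ℂ)) =
      ((((Real.pi / τ) ^ (((d - 1 : ℕ) : ℝ) / 2) *
        (Real.exp (-‖x‖ ^ 2 / (4 * τ)) * h (t, x)) : ℝ)) : ℂ) := by
    intro x
    have h4 := GaussianFourier.integral_cexp_neg_mul_sq_norm_add (V := Space d)
      (b := (τ : ℂ)) (by simpa using hτ) Complex.I x
    have h5 : ∀ p : Space d, (Real.exp (-(τ * ‖p‖ ^ 2)) : ℂ) *
        (Complex.exp (Complex.I * (inner ℝ p x : ℝ)) * (h (t, x) : ℂ)) =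
        Complex.exp (-(τ : ℂ) * (‖p‖ : ℂ) ^ 2 + Complex.I * (inner ℝ x p : ℝ)) *
          (h (t, x) : ℂ) := by
      intro p
      rw [← mul_assoc, Complex.ofReal_exp, ← Complex.exp_add, real_inner_comm]
      congr 2
      push_cast
      ring
    simp only [h5]
    rw [integral_mul_const, h4, finrank_euclideanSpace, Fintype.card_fin]
    push_cast
    rw [Complex.ofReal_cpow (by positivity), ← mul_assoc]
    push_cast
    congr 3
    rw [Complex.I_sq]
    ring
  simp only [h3]
  rw [integral_complex_ofReal, integral_const_mul]

/-- The Gaussian average `∫ exp (v (t² - |x|²) / 4) h (t, x) dt dx`. -/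
noncomputable def lorentzAverage (h : Test (Minkowski d)) (v : ℝ) : ℝ :=
  ∫ y : Minkowski d, Real.exp ((y.1 ^ 2 - ‖y.2‖ ^ 2) / 4 * v) * h y

/-- The Taylor coefficients of `lorentzAverage h` at `v = 0`. -/
noncomputable def lorentzMoment (j : ℕ) (h : Test (Minkowski d)) : ℝ :=
  ∫ y : Minkowski d, ((y.1 ^ 2 - ‖y.2‖ ^ 2) / 4) ^ j / (j ! : ℝ) * h y

theorem integrable_continuous_mul {k : Minkowski d → ℝ} (hk : Continuous k)
    (h : Test (Minkowski d)) : Integrable fun y => k y * h y := by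
  refine (hk.mul h.continuous).integrable_of_hasCompactSupport ?_
  exact h.hasCompactSupport.mul_left

/-- `lorentzAverage h v` without its first `J` Taylor coefficients. -/
noncomputable def lorentzRemainder (J : ℕ) (h : Test (Minkowski d)) (v : ℝ) : ℝ :=
  lorentzAverage h v - ∑ j ∈ Finset.range J, v ^ j * lorentzMoment j h

theorem lorentzAverage_add (f g : Test (Minkowski d)) (v : ℝ) :
    lorentzAverage (f + g) v = lorentzAverage f v + lorentzAverage g v := by
  have hk : Continuous fun y : Minkowski d => Real.exp ((y.1 ^ 2 - ‖y.2‖ ^ 2) / 4 * v) := by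
    fun_prop
  rw [lorentzAverage, lorentzAverage, lorentzAverage,
    ← integral_add (integrable_continuous_mul hk f) (integrable_continuous_mul hk g)]
  exact integral_congr_ae (Eventually.of_forall fun y => mul_add _ _ _)

theorem lorentzAverage_smul (c : ℝ) (f : Test (Minkowski d)) (v : ℝ) :
    lorentzAverage (c • f) v = c * lorentzAverage f v := by
  rw [lorentzAverage, lorentzAverage, ← integral_const_mul]
  exact integral_congr_ae (Eventually.of_forall fun y => mul_left_comm _ c _)

theorem continuous_lorentzMoment_kernel (j : ℕ) :
    Continuous fun y : Minkowski d => ((y.1 ^ 2 - ‖y.2‖ ^ 2) / 4) ^ j / (j ! : ℝ) := by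
  fun_prop

theorem lorentzMoment_add (j : ℕ) (f g : Test (Minkowski d)) :
    lorentzMoment j (f + g) = lorentzMoment j f + lorentzMoment j g := by
  rw [lorentzMoment, lorentzMoment, lorentzMoment, ← integral_add
    (integrable_continuous_mul (continuous_lorentzMoment_kernel j) f)
    (integrable_continuous_mul (continuous_lorentzMoment_kernel j) g)]
  exact integral_congr_ae (Eventually.of_forall fun y => mul_add _ _ _)

theorem lorentzMoment_smul (j : ℕ) (c : ℝ) (f : Test (Minkowski d)) :
    lorentzMoment j (c • f) = c * lorentzMoment j f := by
  rw [lorentzMoment, lorentzMoment, ← integral_const_mul]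
  exact integral_congr_ae (Eventually.of_forall fun y => mul_left_comm _ c _)

theorem lorentzRemainder_add (J : ℕ) (f g : Test (Minkowski d)) (v : ℝ) :
    lorentzRemainder J (f + g) v = lorentzRemainder J f v + lorentzRemainder J g v := by
  simp only [lorentzRemainder, lorentzAverage_add, lorentzMoment_add, mul_add,
    Finset.sum_add_distrib]
  ring

theorem lorentzRemainder_smul (J : ℕ) (c : ℝ) (f : Test (Minkowski d)) (v : ℝ) :
    lorentzRemainder J (c • f) v = c * lorentzRemainder J f v := by
  simp only [lorentzRemainder, lorentzAverage_smul, lorentzMoment_smul, mul_sub, Finset.mul_sum]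
  congr 1
  exact Finset.sum_congr rfl fun j _ => by ring

theorem integrable_indicator_minkowski (R B : ℝ) :
    Integrable ((Metric.closedBall (0 : Minkowski d) R).indicator (fun _ => B)) :=
  (integrable_indicator_iff Metric.isClosed_closedBall.measurableSet).2
    (integrableOn_const (by exact measure_closedBall_lt_top.ne))

/-- An integral against a kernel bounded by `c` on the ball of radius `R` is bounded by the
volume of that ball. -/
theorem abs_integral_mul_le {N : ℕ} {R B c : ℝ} {h : Test (Minkowski d)} (hh : TestBound N R B h)
    {k : Minkowski d → ℝ} (hk : ∀ y : Minkowski d, ‖y‖ ≤ R → |k y| ≤ c) :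
    |∫ y, k y * h y| ≤
      c * B * ∫ y, (Metric.closedBall (0 : Minkowski d) R).indicator (fun _ => (1 : ℝ)) y := by
  rw [← integral_const_mul, ← Real.norm_eq_abs]
  refine norm_integral_le_of_norm_le ((integrable_indicator_minkowski R 1).const_mul _)
    (Eventually.of_forall fun y => ?_)
  rw [norm_mul, Real.norm_eq_abs]
  by_cases hy : h y = 0
  · rw [hy, norm_zero, mul_zero]
    by_cases h1 : ‖y‖ ≤ R
    · rw [indicator_of_mem (by simpa using h1), mul_one]
      exact mul_nonneg ((abs_nonneg _).trans (hk y h1)) hh.nonneg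
    · rw [indicator_of_notMem (by simpa using h1), mul_zero]
  · have h1 := hh.1 y hy
    rw [indicator_of_mem (by simpa using h1), mul_one]
    exact mul_le_mul (hk y h1) (hh.norm_le y) (norm_nonneg _) ((abs_nonneg _).trans (hk y h1))

theorem abs_lorentz_le {R : ℝ} {y : Minkowski d} (hy : ‖y‖ ≤ R) :
    |(y.1 ^ 2 - ‖y.2‖ ^ 2) / 4| ≤ R ^ 2 := by
  have h1 : |y.1| ≤ R := (norm_fst_le y).trans hy
  have h2 : ‖y.2‖ ≤ R := (norm_snd_le y).trans hy
  have h3 : y.1 ^ 2 ≤ R ^ 2 :=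
    sq_le_sq' (by linarith [neg_abs_le y.1]) (by linarith [le_abs_self y.1])
  have h4 : ‖y.2‖ ^ 2 ≤ R ^ 2 := by gcongr
  rw [abs_le]
  constructor <;> nlinarith [sq_nonneg y.1, sq_nonneg ‖y.2‖]

theorem exists_dist_lorentzMoment (j : ℕ) :
    ∃ S : Dist' (Minkowski d), ∀ h, S h = (lorentzMoment j h : ℂ) := by
  refine exists_dist_of_bound _ (fun f g => by rw [lorentzMoment_add]; push_cast; rfl)
    (fun c f => by rw [lorentzMoment_smul]; push_cast; rfl) 0 fun R hR => ?_
  refine ⟨(R ^ 2) ^ j *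
    ∫ y, (Metric.closedBall (0 : Minkowski d) R).indicator (fun _ => (1 : ℝ)) y,
    mul_nonneg (by positivity)
      (integral_nonneg fun y => indicator_nonneg (fun _ _ => zero_le_one) _),
    fun h B hh => ?_⟩
  rw [Complex.norm_real, Real.norm_eq_abs]
  refine (abs_integral_mul_le (c := (R ^ 2) ^ j) hh fun y hy => ?_).trans (le_of_eq (by ring))
  rw [abs_div, abs_pow, Nat.abs_cast]
  refine (div_le_self (by positivity) (by exact_mod_cast j.factorial_pos)).trans ?_
  gcongr
  exact abs_lorentz_le hy

theorem abs_lorentzRemainder_le (J : ℕ) (R : ℝ) : ∃ C : ℝ, 0 ≤ C ∧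
    ∀ (h : Test (Minkowski d)) (B : ℝ), TestBound 0 R B h → ∀ v ∈ Icc (0 : ℝ) 1,
      |lorentzRemainder J h v| ≤ C * B * v ^ J := by
  set V := ∫ y, (Metric.closedBall (0 : Minkowski d) R).indicator (fun _ => (1 : ℝ)) y
  refine ⟨(R ^ 2) ^ J * Real.exp (R ^ 2) * V, mul_nonneg (by positivity)
    (integral_nonneg fun y => indicator_nonneg (fun _ _ => zero_le_one) _), fun h B hh v hv => ?_⟩
  have hk : Continuous fun y : Minkowski d => Real.exp ((y.1 ^ 2 - ‖y.2‖ ^ 2) / 4 * v) := by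
    fun_prop
  have h1 : lorentzRemainder J h v = ∫ y : Minkowski d,
      (Real.exp ((y.1 ^ 2 - ‖y.2‖ ^ 2) / 4 * v) -
        ∑ j ∈ Finset.range J, ((y.1 ^ 2 - ‖y.2‖ ^ 2) / 4 * v) ^ j / (j ! : ℝ)) * h y := by
    have h2 : ∀ j, v ^ j * lorentzMoment j h = ∫ y : Minkowski d,
        ((y.1 ^ 2 - ‖y.2‖ ^ 2) / 4 * v) ^ j / (j ! : ℝ) * h y := fun j => by
      rw [lorentzMoment, ← integral_const_mul]
      exact integral_congr_ae (Eventually.of_forall fun y => by simp only [mul_pow]; ring)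
    rw [lorentzRemainder, lorentzAverage]
    simp only [h2]
    rw [← integral_finsetSum _ fun j _ => integrable_continuous_mul (by fun_prop) h,
      ← integral_sub (integrable_continuous_mul hk h)
        (integrable_finsetSum _ fun j _ => integrable_continuous_mul (by fun_prop) h)]
    exact integral_congr_ae (Eventually.of_forall fun y => by
      simp only [sub_mul, Finset.sum_mul])
  rw [h1]
  refine (abs_integral_mul_le (c := (R ^ 2) ^ J * Real.exp (R ^ 2) * v ^ J) hh
    fun y hy => ?_).trans (le_of_eq (by ring))
  have h3 := Complex.norm_exp_sub_sum_le_norm_mul_exp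
    ((((y.1 ^ 2 - ‖y.2‖ ^ 2) / 4 * v : ℝ)) : ℂ) J
  rw [Complex.norm_real, Real.norm_eq_abs, abs_mul, abs_of_nonneg hv.1, mul_pow] at h3
  have h4 : |Real.exp ((y.1 ^ 2 - ‖y.2‖ ^ 2) / 4 * v) -
        ∑ j ∈ Finset.range J, ((y.1 ^ 2 - ‖y.2‖ ^ 2) / 4 * v) ^ j / (j ! : ℝ)| =
      ‖Complex.exp ((((y.1 ^ 2 - ‖y.2‖ ^ 2) / 4 * v : ℝ)) : ℂ) - ∑ j ∈ Finset.range J,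
        ((((y.1 ^ 2 - ‖y.2‖ ^ 2) / 4 * v : ℝ)) : ℂ) ^ j / (j ! : ℂ)‖ := by
    rw [← Real.norm_eq_abs, ← Complex.norm_real]
    push_cast
    rfl
  rw [h4]
  refine h3.trans ?_
  have h5 := abs_lorentz_le hy
  have h6 : |(y.1 ^ 2 - ‖y.2‖ ^ 2) / 4| * v ≤ R ^ 2 :=
    (mul_le_of_le_one_right (abs_nonneg _) hv.2).trans h5
  calc _ ≤ ((R ^ 2) ^ J * v ^ J) * Real.exp (R ^ 2) := by
        have := hv.1
        gcongr
    _ = _ := by ring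

end

/-! ### The singular part as a sum of exponential integrals -/

section

variable {d : ℕ}

theorem rpow_mul_pi_div_rpow (hd : 1 ≤ d) {τ : ℝ} (hτ : 0 < τ) :
    τ ^ (-(1 / 2) : ℝ) * (Real.pi / τ) ^ (((d - 1 : ℕ) : ℝ) / 2) =
      Real.pi ^ (((d - 1 : ℕ) : ℝ) / 2) * τ ^ (-((d : ℝ) / 2)) := by
  rw [Real.div_rpow Real.pi_pos.le hτ.le, div_eq_mul_inv (Real.pi ^ _),
    ← Real.rpow_neg hτ.le, mul_left_comm, ← Real.rpow_add hτ, Nat.cast_sub hd]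
  congr 2
  push_cast
  ring

theorem integrableOn_rpow_half_dim (hd : 3 ≤ d) :
    IntegrableOn (fun τ : ℝ => τ ^ (-((d : ℝ) / 2))) (Ioi 1) := by
  refine integrableOn_Ioi_rpow_of_lt ?_ one_pos
  have : (3 : ℝ) ≤ d := by exact_mod_cast hd
  linarith

/-- The integrand of the Schwinger representation, as a function of time, momentum and the
Schwinger parameter. -/
noncomputable def schwingerIntegrand (m : ℝ) (h : Test (Minkowski d)) (y : (ℝ × Space d) × ℝ) : ℂ :=
  ((y.2 ^ (-(1 / 2) : ℝ) *
    Real.exp (-(energy m y.1.2 ^ 2 * y.2) + y.1.1 ^ 2 / (4 * y.2)) : ℝ) : ℂ) *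
    spaceFourier h y.1.1 y.1.2

/-- Convergence at `τ = ∞` is due to `∫ exp (- τ |p|²) dp ∼ τ ^ (- (d - 1) / 2)` and `d ≥ 3`, also
for `m = 0`. -/
theorem integrable_schwingerIntegrand (hd : 3 ≤ d) (m : ℝ) (h : Test (Minkowski d)) :
    Integrable (schwingerIntegrand m h)
      ((volume : Measure (ℝ × Space d)).prod (volume.restrict (Ioi (1 : ℝ)))) := by
  obtain ⟨R, B, -, hh⟩ := exists_testBound 0 h
  obtain ⟨C, hC, hF⟩ := norm_spaceFourier_le (d := d) 0 R
  have hB := hh.nonneg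
  set G : (ℝ × Space d) × ℝ → ℝ := fun y => (Icc (-R) R).indicator (fun _ => (1 : ℝ)) y.1.1 *
    (y.2 ^ (-(1 / 2) : ℝ) * Real.exp (-(y.2 * ‖y.1.2‖ ^ 2))) with hG
  have hGm : Measurable G := by
    refine Measurable.mul ?_ (by fun_prop)
    exact (measurable_const.indicator measurableSet_Icc).comp (by fun_prop)
  have hGi : Integrable G
      ((volume : Measure (ℝ × Space d)).prod (volume.restrict (Ioi (1 : ℝ)))) := by
    rw [integrable_prod_iff' hGm.aestronglyMeasurable]
    have hind : Integrable ((Icc (-R) R).indicator fun _ : ℝ => (1 : ℝ)) :=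
      (integrable_indicator_iff measurableSet_Icc).2 (integrableOn_const (by simp))
    constructor
    · refine (ae_restrict_iff' measurableSet_Ioi).2 (Eventually.of_forall fun τ hτ => ?_)
      exact hind.mul_prod (g := fun p : Space d => τ ^ (-(1 / 2) : ℝ) * Real.exp (-(τ * ‖p‖ ^ 2)))
        ((integrable_exp_neg_mul_sq_norm (one_pos.trans hτ)).const_mul _)
    · refine ((integrableOn_rpow_half_dim hd).const_mul
        ((∫ t, (Icc (-R) R).indicator (fun _ : ℝ => (1 : ℝ)) t) *
          Real.pi ^ (((d - 1 : ℕ) : ℝ) / 2))).congr ?_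
      refine (ae_restrict_iff' measurableSet_Ioi).2 (Eventually.of_forall fun τ hτ => ?_)
      have hτ0 : 0 < τ := one_pos.trans hτ
      have h1 : ∀ y : ℝ × Space d, ‖G (y, τ)‖ = (Icc (-R) R).indicator (fun _ => (1 : ℝ)) y.1 *
          (τ ^ (-(1 / 2) : ℝ) * Real.exp (-(τ * ‖y.2‖ ^ 2))) := fun y =>
        Real.norm_of_nonneg (mul_nonneg (indicator_nonneg (fun _ _ => zero_le_one) _)
          (by positivity))
      simp only [h1]
      have h2 := integral_prod_mul (μ := volume) (ν := volume)
        ((Icc (-R) R).indicator (fun _ : ℝ => (1 : ℝ)))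
        (fun p : Space d => τ ^ (-(1 / 2) : ℝ) * Real.exp (-(τ * ‖p‖ ^ 2)))
      rw [← Measure.volume_eq_prod] at h2
      rw [h2, integral_const_mul, integral_exp_neg_mul_sq_norm hτ0,
        rpow_mul_pi_div_rpow (by omega) hτ0]
      ring
  have hfm : AEStronglyMeasurable (schwingerIntegrand m h)
      ((volume : Measure (ℝ × Space d)).prod (volume.restrict (Ioi (1 : ℝ)))) := by
    refine Measurable.aestronglyMeasurable (Measurable.mul ?_ ?_)
    · have := (continuous_energy (d := d) m).measurable
      refine Complex.measurable_ofReal.comp ?_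
      fun_prop
    · exact (stronglyMeasurable_spaceFourier h).measurable.comp measurable_fst
  refine (hGi.const_mul (Real.exp (R ^ 2 / 4) * (C * B))).mono' hfm ?_
  filter_upwards [Measure.quasiMeasurePreserving_snd.ae (ae_restrict_mem measurableSet_Ioi)]
    with y hy
  have hy0 : 0 < y.2 := one_pos.trans hy
  rw [schwingerIntegrand, norm_mul, Complex.norm_real, Real.norm_of_nonneg (by positivity)]
  by_cases ht : |y.1.1| ≤ R
  · simp only [hG]
    rw [indicator_of_mem (s := Icc (-R) R) (abs_le.1 ht), one_mul]
    have h1 := rpow_mul_exp_add_le (s := 1 / 2) (z := energy m y.1.2 ^ 2) hy ht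
    have h2 : Real.exp (-(energy m y.1.2 ^ 2 * y.2)) ≤ Real.exp (-(y.2 * ‖y.1.2‖ ^ 2)) := by
      rw [energy_sq]
      refine Real.exp_le_exp.2 (neg_le_neg ?_)
      nlinarith [mul_nonneg hy0.le (sq_nonneg m)]
    have h3 := hF h B hh y.1.1 y.1.2
    simp only [Nat.cast_zero, neg_zero, Real.rpow_zero, mul_one] at h3
    calc _ ≤ (Real.exp (R ^ 2 / 4) * (y.2 ^ (-(1 / 2) : ℝ) *
          Real.exp (-(energy m y.1.2 ^ 2 * y.2)))) * (C * B) :=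
          mul_le_mul h1 h3 (norm_nonneg _) (by positivity)
      _ ≤ (Real.exp (R ^ 2 / 4) * (y.2 ^ (-(1 / 2) : ℝ) *
          Real.exp (-(y.2 * ‖y.1.2‖ ^ 2)))) * (C * B) := by gcongr
      _ = _ := by ring
  · rw [spaceFourier_eq_zero hh (not_le.1 ht), norm_zero, mul_zero]
    simp only [hG]
    have := indicator_nonneg (s := Icc (-R) R) (f := fun _ => (1 : ℝ))
      (fun _ _ => zero_le_one) y.1.1
    positivity

theorem integral_prod_minkowski {f : ℝ × Space d → ℂ} (hf : Integrable f) :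
    ∫ y, f y = ∫ t, ∫ p, f (t, p) := by
  rw [Measure.volume_eq_prod] at hf ⊢
  exact integral_prod f hf

/-- The contribution of the large Schwinger parameters, in position space. -/
theorem integral_schwinger_mul_spaceFourier (hd : 3 ≤ d) (m : ℝ) (h : Test (Minkowski d)) :
    Integrable (fun y : ℝ × Space d =>
      (schwinger (1 / 2) (energy m y.2 ^ 2) y.1 : ℂ) * spaceFourier h y.1 y.2) ∧
    ∫ y : ℝ × Space d, (schwinger (1 / 2) (energy m y.2 ^ 2) y.1 : ℂ) * spaceFourier h y.1 y.2 =
      ((Real.pi ^ (((d - 1 : ℕ) : ℝ) / 2) * ∫ τ in Ioi (1 : ℝ),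
        τ ^ (-((d : ℝ) / 2)) * Real.exp (-(m ^ 2 * τ)) * lorentzAverage h τ⁻¹ : ℝ) : ℂ) := by
  have hi := integrable_schwingerIntegrand hd m h
  have h1 : ∀ y : ℝ × Space d, ∫ τ in Ioi (1 : ℝ), schwingerIntegrand m h (y, τ) =
      (schwinger (1 / 2) (energy m y.2 ^ 2) y.1 : ℂ) * spaceFourier h y.1 y.2 := fun y => by
    simp only [schwingerIntegrand]
    rw [integral_mul_const, integral_complex_ofReal]
    rfl
  have hl := hi.integral_prod_left
  have h2 := integral_prod _ hi
  simp only [h1] at hl h2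
  refine ⟨hl, h2.symm.trans ((integral_prod_symm _ hi).trans ?_)⟩
  have h3 : ∀ᵐ τ ∂(volume.restrict (Ioi (1 : ℝ))),
      ∫ y : ℝ × Space d, schwingerIntegrand m h (y, τ) =
      ((Real.pi ^ (((d - 1 : ℕ) : ℝ) / 2) *
        (τ ^ (-((d : ℝ) / 2)) * Real.exp (-(m ^ 2 * τ)) * lorentzAverage h τ⁻¹) : ℝ) : ℂ) := by
    filter_upwards [hi.prod_left_ae, ae_restrict_mem measurableSet_Ioi] with τ hτi hτ
    have hτ0 : 0 < τ := one_pos.trans hτ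
    rw [integral_prod_minkowski hτi]
    have h4 : ∀ t : ℝ, ∫ p : Space d, schwingerIntegrand m h ((t, p), τ) =
        ((τ ^ (-(1 / 2) : ℝ) * (Real.pi / τ) ^ (((d - 1 : ℕ) : ℝ) / 2) *
          Real.exp (-(m ^ 2 * τ)) * ∫ x : Space d,
            Real.exp ((t ^ 2 - ‖x‖ ^ 2) / 4 * τ⁻¹) * h (t, x) : ℝ) : ℂ) := by
      intro t
      have h5 : ∀ p : Space d, schwingerIntegrand m h ((t, p), τ) =
          ((τ ^ (-(1 / 2) : ℝ) * Real.exp (-(m ^ 2 * τ)) * Real.exp (t ^ 2 / (4 * τ)) : ℝ) : ℂ) *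
            ((Real.exp (-(τ * ‖p‖ ^ 2)) : ℂ) * spaceFourier h t p) := by
        intro p
        have h6 : Real.exp (-(energy m p ^ 2 * τ) + t ^ 2 / (4 * τ)) =
            Real.exp (-(m ^ 2 * τ)) * Real.exp (t ^ 2 / (4 * τ)) * Real.exp (-(τ * ‖p‖ ^ 2)) := by
          rw [energy_sq, ← Real.exp_add, ← Real.exp_add]
          congr 1
          ring
        simp only [schwingerIntegrand]
        rw [h6]
        push_cast
        ring
      simp only [h5]
      rw [integral_const_mul, integral_gaussian_mul_spaceFourier h t hτ0, ← Complex.ofReal_mul]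
      congr 1
      have h7 : ∫ x : Space d, Real.exp ((t ^ 2 - ‖x‖ ^ 2) / 4 * τ⁻¹) * h (t, x) =
          Real.exp (t ^ 2 / (4 * τ)) *
            ∫ x : Space d, Real.exp (-‖x‖ ^ 2 / (4 * τ)) * h (t, x) := by
        rw [← integral_const_mul]
        congr 1
        funext x
        rw [← mul_assoc, ← Real.exp_add]
        congr 2
        field_simp
        ring
      rw [h7]
      ring
    simp only [h4]
    rw [integral_complex_ofReal, integral_const_mul, rpow_mul_pi_div_rpow (by omega) hτ0]
    have h8 : lorentzAverage h τ⁻¹ =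
        ∫ t : ℝ, ∫ x : Space d, Real.exp ((t ^ 2 - ‖x‖ ^ 2) / 4 * τ⁻¹) * h (t, x) := by
      have hk : Continuous fun y : Minkowski d =>
        Real.exp ((y.1 ^ 2 - ‖y.2‖ ^ 2) / 4 * τ⁻¹) := by fun_prop
      have h9 := integrable_continuous_mul hk h
      rw [lorentzAverage]
      rw [Measure.volume_eq_prod] at h9 ⊢
      exact integral_prod _ h9
    rw [← h8]
    congr 1
    ring
  rw [integral_congr_ae h3, integral_complex_ofReal, integral_const_mul]

theorem measurable_lorentzRemainder (J : ℕ) (h : Test (Minkowski d)) :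
    Measurable (lorentzRemainder J h) := by
  have hc : Continuous fun z : ℝ × Minkowski d =>
      Real.exp ((z.2.1 ^ 2 - ‖z.2.2‖ ^ 2) / 4 * z.1) * h z.2 := by
    have := h.continuous
    fun_prop
  have h1 : Measurable (lorentzAverage h) :=
    (hc.stronglyMeasurable.integral_prod_right (f := fun (v : ℝ) (y : Minkowski d) =>
      Real.exp ((y.1 ^ 2 - ‖y.2‖ ^ 2) / 4 * v) * h y)).measurable
  unfold lorentzRemainder
  fun_prop

/-- The contribution of the large Schwinger parameters: the Taylor polynomial of
`lorentzAverage h` produces exponential integrals of `m²`, and the Taylor remainder produces a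
function which is `J` times differentiable with respect to `m²`. -/
theorem exists_dist_chain_largeSchwinger (hd : 3 ≤ d) (J : ℕ) :
    ∃ (A : ℕ → Dist' (Minkowski d)) (Φ : ℕ → ℝ → Dist' (Minkowski d)),
      (∀ h, IsMassChain J fun n m => Φ n m h) ∧
      ∀ m h, ((∫ τ in Ioi (1 : ℝ),
        τ ^ (-((d : ℝ) / 2)) * Real.exp (-(m ^ 2 * τ)) * lorentzAverage h τ⁻¹ : ℝ) : ℂ) =
        ∑ j ∈ Finset.range J, (expIntegral ((d : ℝ) / 2 + j) (m ^ 2) : ℂ) * A j h + Φ 0 m h := by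
  choose A hA using exists_dist_lorentzMoment (d := d)
  set e : ℕ → Test (Minkowski d) → ℝ → ℝ → ℂ := fun n h τ m =>
    (((-τ) ^ n * (τ ^ (-((d : ℝ) / 2)) * Real.exp (-(m ^ 2 * τ))) *
      lorentzRemainder J h τ⁻¹ : ℝ) : ℂ) with he
  have hem : ∀ n h m,
      AEStronglyMeasurable (fun τ => e n h τ m) (volume.restrict (Ioi (1 : ℝ))) := by
    intro n h m
    refine (Complex.measurable_ofReal.comp (Measurable.mul (by fun_prop) ?_)).aestronglyMeasurable
    exact (measurable_lorentzRemainder J h).comp measurable_inv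
  have heb : ∀ R, ∃ C : ℝ, 0 ≤ C ∧ ∀ h B, TestBound 0 R B h → ∀ n ≤ J,
      ∀ᵐ τ ∂(volume.restrict (Ioi (1 : ℝ))), ∀ m,
        ‖e n h τ m‖ ≤ C * B * τ ^ (-((d : ℝ) / 2)) := by
    intro R
    obtain ⟨C, hC, hCb⟩ := abs_lorentzRemainder_le (d := d) J R
    refine ⟨C, hC, fun h B hh n hn => ?_⟩
    filter_upwards [ae_restrict_mem measurableSet_Ioi] with τ hτ m
    have hτ0 : 0 < τ := one_pos.trans hτ
    have h1 := hCb h B hh τ⁻¹ ⟨by positivity, inv_le_one_of_one_le₀ (le_of_lt hτ)⟩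
    have h2 : Real.exp (-(m ^ 2 * τ)) ≤ 1 := Real.exp_le_one_iff.2 (by
      have : 0 ≤ m ^ 2 * τ := by positivity
      linarith)
    have h3 : τ ^ n ≤ τ ^ J := pow_le_pow_right₀ (le_of_lt hτ) hn
    rw [Complex.norm_real, Real.norm_eq_abs, abs_mul, abs_mul, abs_pow, abs_neg,
      abs_of_pos hτ0, abs_of_pos (by positivity)]
    have hB := hh.nonneg
    calc τ ^ n * (τ ^ (-((d : ℝ) / 2)) * Real.exp (-(m ^ 2 * τ))) * |lorentzRemainder J h τ⁻¹|
        ≤ τ ^ J * (τ ^ (-((d : ℝ) / 2)) * 1) * (C * B * τ⁻¹ ^ J) := by gcongr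
      _ = C * B * τ ^ (-((d : ℝ) / 2)) * (τ * τ⁻¹) ^ J := by rw [mul_pow]; ring
      _ = _ := by rw [mul_inv_cancel₀ hτ0.ne', one_pow, mul_one]
  have hei : ∀ n ≤ J, ∀ h m, Integrable (fun τ => e n h τ m) (volume.restrict (Ioi (1 : ℝ))) := by
    intro n hn h m
    obtain ⟨R, B, -, hh⟩ := exists_testBound 0 h
    obtain ⟨C, -, hC⟩ := heb R
    exact ((integrableOn_rpow_half_dim hd).const_mul (C * B)).mono' (hem n h m)
      ((hC h B hh n hn).mono fun τ hτ => hτ m)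
  have hdist : ∀ n m, ∃ S : Dist' (Minkowski d), n ≤ J →
      ∀ h, S h = ∫ τ in Ioi (1 : ℝ), e n h τ m := by
    intro n m
    by_cases hn : n ≤ J
    · obtain ⟨S, hS⟩ := exists_dist_of_bound (fun h => ∫ τ in Ioi (1 : ℝ), e n h τ m)
        (fun f g => by
          rw [← integral_add (hei n hn f m) (hei n hn g m)]
          congr 1
          funext τ
          simp only [he, lorentzRemainder_add]
          push_cast
          ring)
        (fun c f => by
          rw [← integral_const_mul]
          congr 1
          funext τ
          simp only [he, lorentzRemainder_smul]
          push_cast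
          ring) 0 (fun R hR => by
          obtain ⟨C, hC, hCb⟩ := heb R
          refine ⟨C * ∫ τ in Ioi (1 : ℝ), τ ^ (-((d : ℝ) / 2)), mul_nonneg hC
            (setIntegral_nonneg measurableSet_Ioi fun τ hτ =>
              Real.rpow_nonneg (one_pos.trans hτ).le _), fun h B hh => ?_⟩
          refine (norm_integral_le_of_norm_le ((integrableOn_rpow_half_dim hd).const_mul (C * B))
            ((hCb h B hh n hn).mono fun τ hτ => hτ m)).trans (le_of_eq ?_)
          rw [integral_const_mul]
          ring)
      exact ⟨S, fun _ => hS⟩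
    · -- the indices `n > J` do not enter the chain
      exact ⟨0, fun h => absurd h hn⟩
  choose Φ hΦ using hdist
  refine ⟨A, Φ, fun h => ?_, fun m h => ?_⟩
  · obtain ⟨R, B, -, hh⟩ := exists_testBound 0 h
    obtain ⟨C, -, hC⟩ := heb R
    have key := isMassChain_integral (K := J) (e := fun n τ m => e n h τ m)
      ((integrableOn_rpow_half_dim hd).const_mul (C * B)) (fun n _ m => hem n h m)
      (fun n hn => hC h B hh n hn) (fun τ => ⟨fun n _ => ?_, fun n _ m => ?_⟩)
    · refine ⟨fun n hn => ?_, fun n hn m => ?_⟩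
      · exact (key.1 n hn).congr fun m => (hΦ n m hn h).symm
      · change HasDerivAt (fun m => Φ n m h) (((2 * m : ℝ) : ℂ) * Φ (n + 1) m h) m
        rw [hΦ (n + 1) m hn h]
        refine (key.2 n hn m).congr_of_eventuallyEq (Eventually.of_forall fun m' => ?_)
        exact hΦ n m' hn.le h
    · simp only [he]
      fun_prop
    · have h0 : HasDerivAt (fun m : ℝ => -(m ^ 2 * τ)) (-(2 * m * τ)) m := by
        simpa using ((hasDerivAt_pow 2 m).mul_const τ).fun_neg
      refine (((h0.exp.const_mul (τ ^ (-((d : ℝ) / 2)))).const_mul ((-τ) ^ n)).mul_const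
        (lorentzRemainder J h τ⁻¹)).ofReal_comp.congr_deriv ?_
      simp only [he]
      push_cast
      ring
  · rw [hΦ 0 m (Nat.zero_le _) h]
    have hexp : ∀ j : ℕ, IntegrableOn (fun τ : ℝ => τ ^ (-((d : ℝ) / 2 + j)) *
        Real.exp (-(m ^ 2 * τ))) (Ioi 1) := by
      intro j
      refine Integrable.mono' (integrableOn_rpow_half_dim hd)
        (by fun_prop : Measurable _).aestronglyMeasurable ?_
      filter_upwards [ae_restrict_mem measurableSet_Ioi] with τ hτ
      have hτ0 : 0 < τ := one_pos.trans hτ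
      rw [Real.norm_of_nonneg (by positivity)]
      have h2 : Real.exp (-(m ^ 2 * τ)) ≤ 1 := Real.exp_le_one_iff.2 (by
        have : 0 ≤ m ^ 2 * τ := by positivity
        linarith)
      refine (mul_le_of_le_one_right (by positivity) h2).trans ?_
      refine Real.rpow_le_rpow_of_exponent_le (le_of_lt hτ) ?_
      have : (0 : ℝ) ≤ j := Nat.cast_nonneg j
      linarith
    have hsum : ∀ j : ℕ, (expIntegral ((d : ℝ) / 2 + j) (m ^ 2) : ℂ) * A j h =
        ∫ τ in Ioi (1 : ℝ), ((τ ^ (-((d : ℝ) / 2 + j)) * Real.exp (-(m ^ 2 * τ)) *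
          lorentzMoment j h : ℝ) : ℂ) := fun j => by
      rw [integral_complex_ofReal, integral_mul_const, hA]
      push_cast
      rfl
    have hsumi : ∀ j : ℕ, Integrable (fun τ : ℝ => ((τ ^ (-((d : ℝ) / 2 + j)) *
        Real.exp (-(m ^ 2 * τ)) * lorentzMoment j h : ℝ) : ℂ)) (volume.restrict (Ioi 1)) :=
      fun j => ((hexp j).mul_const (lorentzMoment j h)).ofReal
    simp only [hsum]
    rw [← integral_finsetSum _ fun j _ => hsumi j,
      ← integral_add (integrable_finsetSum _ fun j _ => hsumi j) (hei 0 (Nat.zero_le _) h m),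
      ← integral_complex_ofReal]
    refine setIntegral_congr_fun measurableSet_Ioi fun τ hτ => ?_
    have hτ0 : 0 < τ := one_pos.trans hτ
    simp only [he]
    rw [← Complex.ofReal_sum, ← Complex.ofReal_add]
    congr 1
    have h9 : ∀ j : ℕ, τ ^ (-((d : ℝ) / 2 + j)) = τ ^ (-((d : ℝ) / 2)) * τ⁻¹ ^ j := fun j => by
      rw [neg_add, Real.rpow_add hτ0, Real.rpow_neg hτ0.le (j : ℝ), Real.rpow_natCast, inv_pow]
    simp only [h9, lorentzRemainder, mul_sub, Finset.mul_sum, pow_zero, one_mul]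
    have h10 : ∑ j ∈ Finset.range J, τ ^ (-((d : ℝ) / 2)) * τ⁻¹ ^ j * Real.exp (-(m ^ 2 * τ)) *
        lorentzMoment j h = ∑ j ∈ Finset.range J,
        τ ^ (-((d : ℝ) / 2)) * Real.exp (-(m ^ 2 * τ)) * (τ⁻¹ ^ j * lorentzMoment j h) :=
      Finset.sum_congr rfl fun j _ => by ring
    rw [h10]
    ring

end

/-! ### The two-point functions as a sum of exponential integrals and a smooth part -/

section

variable {d : ℕ}

/-- The common form `∫ Δ⁺_m(a(t), x) h(t, x) dt dx` of the Wightman two-point function, `a(t) = t`,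
and of the Feynman propagator, `a(t) = |t|`. -/
noncomputable def twoPoint (d : ℕ) (a : ℝ → ℝ) (m : ℝ) (h : Test (Minkowski d)) : ℂ :=
  ∫ t : ℝ, wightmanAt d m (a t) (fun x => h (t, x))

/-- The momentum-space integrand of `twoPoint`. -/
noncomputable def twoPointIntegrand (a : ℝ → ℝ) (m : ℝ) (h : Test (Minkowski d))
    (y : ℝ × Space d) : ℂ :=
  ((2 * energy m y.2)⁻¹ : ℝ) * Complex.exp (-Complex.I * (energy m y.2 * a y.1 : ℝ)) *
    spaceFourier h y.1 y.2

theorem wightmanAt_eq (a : ℝ → ℝ) (m t : ℝ) (h : Test (Minkowski d)) :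
    wightmanAt d m (a t) (fun x => h (t, x)) = (((2 * Real.pi) ^ (d - 1))⁻¹ : ℝ) *
      ∫ p : Space d, twoPointIntegrand a m h (t, p) := rfl

/-- The Wightman kernel as a sum of its singular part and of three superpositions of entire
functions of the squared energy. -/
theorem exp_div_energy_eq {E : ℝ} (hE : 0 < E) {t b : ℝ} (hb : |b| = |t|) :
    ((2 * E)⁻¹ : ℝ) * Complex.exp (-Complex.I * (E * b : ℝ)) =
      (2 * Real.sqrt Real.pi : ℂ)⁻¹ * ((schwinger (1 / 2) (E ^ 2) t : ℂ) +
        ((∫ θ in Ioc (0 : ℝ) 1, Real.cos (t * E) * Real.exp (-(E ^ 2 * θ)) *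
          θ ^ (-(1 / 2) : ℝ) : ℝ) : ℂ) -
        ((∫ θ in Ioc (0 : ℝ) 1, Real.cos (t * (1 - θ) * E) * Real.exp (-(E ^ 2 * 1)) *
          (t * gaussPrimitive (t * θ)) : ℝ) : ℂ)) -
      Complex.I / 2 * ((∫ θ in Ioc (0 : ℝ) 1, Real.cos (b * θ * E) * Real.exp (-(E ^ 2 * 0)) *
        b : ℝ) : ℂ) := by
  have h1 := cos_div_eq hE t
  have h2 := sin_div_eq hE.ne' b
  simp only [mul_one, mul_zero, neg_zero, Real.exp_zero]
  rw [← h2]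
  have h3 : Real.cos (t * E) = Real.cos (b * E) := by
    rw [← Real.cos_abs, ← Real.cos_abs (b * E), abs_mul, abs_mul, hb]
  have h4 : Complex.exp (-Complex.I * (E * b : ℝ)) =
      (Real.cos (b * E) : ℂ) - (Real.sin (b * E) : ℂ) * Complex.I := by
    rw [show -Complex.I * (E * b : ℝ) = ((-(b * E) : ℝ) : ℂ) * Complex.I by push_cast; ring,
      Complex.exp_mul_I, ← Complex.ofReal_cos, ← Complex.ofReal_sin, Real.cos_neg, Real.sin_neg]
    push_cast
    ring
  have hpi : (Real.sqrt Real.pi : ℂ) ≠ 0 := by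
    exact_mod_cast (Real.sqrt_pos.2 Real.pi_pos).ne'
  have hE' : (E : ℂ) ≠ 0 := by exact_mod_cast hE.ne'
  rw [← Complex.ofReal_add, ← Complex.ofReal_sub, ← h1, h4, h3]
  push_cast
  field_simp

theorem measurable_gaussPrimitive_weight :
    Measurable (Function.uncurry fun θ t : ℝ => t * gaussPrimitive (t * θ)) := by
  have := continuous_gaussPrimitive
  have h : Continuous (Function.uncurry fun θ t : ℝ => t * gaussPrimitive (t * θ)) := by
    simp only [Function.uncurry_def]
    fun_prop
  exact h.measurable

theorem one_le_rpow_neg_half {θ : ℝ} (hθ : θ ∈ Ioc (0 : ℝ) 1) : 1 ≤ θ ^ (-(1 / 2) : ℝ) :=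
  Real.one_le_rpow_of_pos_of_le_one_of_nonpos hθ.1 hθ.2 (by norm_num)

theorem abs_gaussPrimitive_weight_le (R : ℝ) : ∃ C : ℝ, 0 ≤ C ∧ ∀ θ ∈ Ioc (0 : ℝ) 1, ∀ t : ℝ,
    |t| ≤ R → |t * gaussPrimitive (t * θ)| ≤ C * θ ^ (-(1 / 2) : ℝ) := by
  obtain ⟨C, hC⟩ := (isCompact_Icc (a := -|R|) (b := |R|)).exists_bound_of_continuousOn
    continuous_gaussPrimitive.continuousOn
  have hC0 : 0 ≤ C := (norm_nonneg _).trans (hC 0 ⟨by simp, by simp⟩)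
  refine ⟨|R| * C, by positivity, fun θ hθ t ht => ?_⟩
  have ht' : |t| ≤ |R| := ht.trans (le_abs_self R)
  have h1 : |t * θ| ≤ |R| := by
    rw [abs_mul, abs_of_pos hθ.1]
    exact (mul_le_of_le_one_right (abs_nonneg _) hθ.2).trans ht'
  have h2 := hC (t * θ) (abs_le.1 h1)
  rw [abs_mul]
  refine (mul_le_mul ht' h2 (norm_nonneg _) (abs_nonneg _)).trans ?_
  exact le_mul_of_one_le_right (by positivity) (one_le_rpow_neg_half hθ)

theorem ae_momentum_ne_zero (hd : 2 ≤ d) : ∀ᵐ y : ℝ × Space d, y.2 ≠ 0 := by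
  have : Nontrivial (Space d) := by
    have : Nonempty (Fin (d - 1)) := ⟨⟨0, by omega⟩⟩
    infer_instance
  rw [Measure.volume_eq_prod]
  exact Measure.quasiMeasurePreserving_snd.ae (Measure.ae_ne volume 0)

theorem integral_add_sub_sub {X : Type*} [MeasurableSpace X] {μ : Measure X} {f g k l : X → ℂ}
    (hf : Integrable f μ) (hg : Integrable g μ) (hk : Integrable k μ) (hl : Integrable l μ)
    (c c' : ℂ) : ∫ x, c * (f x + g x - k x) - c' * l x ∂μ =
      c * (∫ x, f x ∂μ + ∫ x, g x ∂μ - ∫ x, k x ∂μ) - c' * ∫ x, l x ∂μ := by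
  have h1 : Integrable (fun x => f x + g x) μ := hf.add hg
  have h2 : Integrable (fun x => f x + g x - k x) μ := h1.sub hk
  rw [integral_sub (h2.const_mul c) (hl.const_mul c'), integral_const_mul, integral_const_mul,
    integral_sub h1 hk, integral_add hf hg]

/-- For every `J`, the two-point function is a finite sum of exponential integrals of `m²` and of a
function which is `J` times differentiable with respect to `m²`, with coefficients and derivatives
which are distributions. -/
theorem twoPoint_decomposition (hd : 3 ≤ d) {a : ℝ → ℝ} (ha : Measurable a)
    (ha1 : ∀ t, |a t| = |t|) (J : ℕ) :
    (∀ m h, Integrable (twoPointIntegrand (d := d) a m h)) ∧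
    ∃ (A : ℕ → Dist' (Minkowski d)) (Φ : ℕ → ℝ → Dist' (Minkowski d)),
      (∀ h, IsMassChain J fun n m => Φ n m h) ∧
      ∀ m h, twoPoint d a m h =
        ∑ j ∈ Finset.range J, (expIntegral ((d : ℝ) / 2 + j) (m ^ 2) : ℂ) * A j h + Φ 0 m h := by
  obtain ⟨Φ₁, hΦ₁, h₁⟩ := exists_dist_chain (d := d) (by omega) (b := fun θ t => a t * θ)
    (τ := fun _ _ => 0) (w := fun _ t => a t) (by simp only [Function.uncurry_def]; fun_prop)
    measurable_const (by simp only [Function.uncurry_def]; fun_prop)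
    (fun θ hθ t => by
      rw [abs_mul, ha1, abs_of_pos hθ.1]
      exact mul_le_of_le_one_right (abs_nonneg _) hθ.2)
    (fun _ _ _ => ⟨le_rfl, zero_le_one⟩)
    (fun R => ⟨|R|, abs_nonneg _, fun θ hθ t ht => by
      rw [ha1]
      exact (ht.trans (le_abs_self R)).trans
        (le_mul_of_one_le_right (abs_nonneg _) (one_le_rpow_neg_half hθ))⟩)
  obtain ⟨Φ₂, hΦ₂, h₂⟩ := exists_dist_chain (d := d) (by omega) (b := fun _ t => t)
    (τ := fun θ _ => θ) (w := fun θ _ => θ ^ (-(1 / 2) : ℝ)) measurable_snd measurable_fst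
    (by simp only [Function.uncurry_def]; fun_prop) (fun _ _ _ => le_rfl)
    (fun θ hθ _ => ⟨hθ.1.le, hθ.2⟩)
    (fun R => ⟨1, zero_le_one, fun θ hθ t _ => by
      rw [one_mul, abs_of_nonneg (Real.rpow_nonneg hθ.1.le _)]⟩)
  obtain ⟨Φ₃, hΦ₃, h₃⟩ := exists_dist_chain (d := d) (by omega) (b := fun θ t => t * (1 - θ))
    (τ := fun _ _ => 1) (w := fun θ t => t * gaussPrimitive (t * θ))
    (by simp only [Function.uncurry_def]; fun_prop) measurable_const
    measurable_gaussPrimitive_weight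
    (fun θ hθ t => by
      rw [abs_mul, abs_of_nonneg (a := 1 - θ) (by linarith [hθ.2])]
      exact mul_le_of_le_one_right (abs_nonneg _) (by linarith [hθ.1]))
    (fun _ _ _ => ⟨zero_le_one, le_rfl⟩) abs_gaussPrimitive_weight_le
  obtain ⟨A, Φ₀, hΦ₀, h₀⟩ := exists_dist_chain_largeSchwinger hd J
  have hS := integral_schwinger_mul_spaceFourier hd
  set c₀ : ℂ := ((((2 * Real.pi) ^ (d - 1))⁻¹ : ℝ) : ℂ)
  set c₁ : ℂ := (2 * Real.sqrt Real.pi : ℂ)⁻¹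
  set c₂ : ℂ := ((Real.pi ^ (((d - 1 : ℕ) : ℝ) / 2) : ℝ) : ℂ)
  -- the pointwise decomposition of the integrand, away from `p = 0`
  have hK : ∀ m h, twoPointIntegrand (d := d) a m h =ᵐ[volume] fun y =>
      c₁ * (((schwinger (1 / 2) (energy m y.2 ^ 2) y.1 : ℂ) * spaceFourier h y.1 y.2 +
        ((∫ θ in Ioc (0 : ℝ) 1, Real.cos (y.1 * energy m y.2) *
          Real.exp (-(energy m y.2 ^ 2 * θ)) * θ ^ (-(1 / 2) : ℝ) : ℝ) : ℂ) *
          spaceFourier h y.1 y.2) -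
        ((∫ θ in Ioc (0 : ℝ) 1, Real.cos (y.1 * (1 - θ) * energy m y.2) *
          Real.exp (-(energy m y.2 ^ 2 * 1)) * (y.1 * gaussPrimitive (y.1 * θ)) : ℝ) : ℂ) *
          spaceFourier h y.1 y.2) -
      Complex.I / 2 * (((∫ θ in Ioc (0 : ℝ) 1, Real.cos (a y.1 * θ * energy m y.2) *
        Real.exp (-(energy m y.2 ^ 2 * 0)) * a y.1 : ℝ) : ℂ) * spaceFourier h y.1 y.2) := by
    intro m h
    filter_upwards [ae_momentum_ne_zero (d := d) (by omega)] with y hy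
    rw [twoPointIntegrand, exp_div_energy_eq (energy_pos m hy) (ha1 y.1)]
    ring
  have hKi : ∀ m h, Integrable (twoPointIntegrand (d := d) a m h) := fun m h =>
    ((((((hS m h).1.add (h₂ m h).1).sub (h₃ m h).1).const_mul c₁).sub
      ((h₁ m h).1.const_mul (Complex.I / 2))).congr (hK m h).symm)
  refine ⟨hKi, fun j => (c₀ * c₁ * c₂) • A j, fun n m => (c₀ * c₁ * c₂) • Φ₀ n m +
    (c₀ * c₁) • Φ₂ n m + (-(c₀ * c₁)) • Φ₃ n m + (-(c₀ * (Complex.I / 2))) • Φ₁ n m,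
    fun h => ?_, fun m h => ?_⟩
  · exact ((((hΦ₀ h).const_mul (c₀ * c₁ * c₂)).add ((hΦ₂ J h).const_mul (c₀ * c₁))).add
      ((hΦ₃ J h).const_mul (-(c₀ * c₁)))).add ((hΦ₁ J h).const_mul (-(c₀ * (Complex.I / 2))))
  · have e1 : twoPoint d a m h = c₀ * ∫ y : ℝ × Space d, twoPointIntegrand a m h y := by
      rw [twoPoint, integral_prod_minkowski (hKi m h), ← integral_const_mul]
      rfl
    have e2 := h₀ m h
    rw [e1, integral_congr_ae (hK m h),
      integral_add_sub_sub (hS m h).1 (h₂ m h).1 (h₃ m h).1 (h₁ m h).1, (hS m h).2,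
      ← (h₁ m h).2, ← (h₂ m h).2, ← (h₃ m h).2, Complex.ofReal_mul, e2]
    change _ = _ + (c₀ * c₁ * c₂ * Φ₀ 0 m h + c₀ * c₁ * Φ₂ 0 m h + -(c₀ * c₁) * Φ₃ 0 m h +
      -(c₀ * (Complex.I / 2)) * Φ₁ 0 m h)
    have e3 : ∑ j ∈ Finset.range J, (expIntegral ((d : ℝ) / 2 + j) (m ^ 2) : ℂ) *
        ((c₀ * c₁ * c₂) • A j) h = c₀ * c₁ * c₂ * ∑ j ∈ Finset.range J,
        (expIntegral ((d : ℝ) / 2 + j) (m ^ 2) : ℂ) * A j h := by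
      rw [Finset.mul_sum]
      refine Finset.sum_congr rfl fun j _ => ?_
      rw [smul_dist_apply]
      ring
    rw [e3]
    ring

end

/-! ### Expansions in powers of the mass and of its logarithm -/

section

open Polynomial Asymptotics

/-- `g(m) = o(m ^ s)` as `m ↓ 0`, for all `s < L`. -/
def NearlyO (L : ℕ) (g : ℝ → ℂ) : Prop :=
  ∀ s : ℝ, s < L → g =o[𝓝[>] 0] fun m : ℝ => m ^ s

theorem isLittleO_rpow_rpow {s t : ℝ} (h : s < t) :
    (fun m : ℝ => m ^ t) =o[𝓝[>] 0] fun m : ℝ => m ^ s := by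
  refine (isLittleO_iff_tendsto' ?_).2 ?_
  · filter_upwards [self_mem_nhdsWithin] with m hm h0
    exact absurd h0 (Real.rpow_pos_of_pos hm s).ne'
  · have h1 : Tendsto (fun m : ℝ => m ^ (t - s)) (𝓝[>] 0) (𝓝 0) := by
      have := (Real.continuousAt_rpow_const 0 (t - s) (Or.inr (by linarith))).tendsto
      rw [Real.zero_rpow (by linarith)] at this
      exact this.mono_left nhdsWithin_le_nhds
    refine h1.congr' ?_
    filter_upwards [self_mem_nhdsWithin] with m hm
    exact Real.rpow_sub hm t s

theorem NearlyO.zero (L : ℕ) : NearlyO L fun _ => 0 := fun _ _ => isLittleO_zero _ _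

theorem NearlyO.add {L : ℕ} {f g : ℝ → ℂ} (hf : NearlyO L f) (hg : NearlyO L g) :
    NearlyO L fun m => f m + g m := fun s hs => (hf s hs).add (hg s hs)

theorem NearlyO.sub {L : ℕ} {f g : ℝ → ℂ} (hf : NearlyO L f) (hg : NearlyO L g) :
    NearlyO L fun m => f m - g m := fun s hs => (hf s hs).sub (hg s hs)

theorem NearlyO.const_mul {L : ℕ} {f : ℝ → ℂ} (c : ℂ) (hf : NearlyO L f) :
    NearlyO L fun m => c * f m := fun s hs => (hf s hs).const_mul_left c

theorem NearlyO.mono {L L' : ℕ} (h : L ≤ L') {f : ℝ → ℂ} (hf : NearlyO L' f) : NearlyO L f :=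
  fun s hs => hf s (hs.trans_le (by exact_mod_cast h))

theorem NearlyO.congr {L : ℕ} {f g : ℝ → ℂ} (hf : NearlyO L f) (h : ∀ m, 0 < m → f m = g m) :
    NearlyO L g := fun s hs => (hf s hs).congr' (by
      filter_upwards [self_mem_nhdsWithin] with m hm using h m hm) EventuallyEq.rfl

theorem NearlyO.comp_div {L : ℕ} {f : ℝ → ℂ} (hf : NearlyO L f) {ρ : ℝ} (hρ : 0 < ρ) :
    NearlyO L fun m => f (m / ρ) := by
  intro s hs
  have h1 : Tendsto (fun m : ℝ => m / ρ) (𝓝[>] 0) (𝓝[>] 0) := by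
    refine tendsto_nhdsWithin_iff.2 ⟨?_, ?_⟩
    · exact ((continuous_id.div_const ρ).tendsto' 0 0 (by simp)).mono_left nhdsWithin_le_nhds
    · filter_upwards [self_mem_nhdsWithin] with m hm using div_pos hm hρ
  refine ((hf s hs).comp_tendsto h1).trans_isBigO ?_
  refine IsBigO.of_bound (‖(ρ ^ s)⁻¹‖) ?_
  filter_upwards [self_mem_nhdsWithin] with m hm
  rw [Function.comp_apply, Real.div_rpow (le_of_lt hm) hρ.le, div_eq_mul_inv, norm_mul, mul_comm]

theorem nearlyO_of_norm_le {L : ℕ} {f : ℝ → ℂ} {C : ℝ} (n : ℕ) (hn : L ≤ n)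
    (h : ∀ᶠ m in 𝓝[>] (0 : ℝ), ‖f m‖ ≤ C * m ^ n) : NearlyO L f := by
  intro s hs
  have h1 : f =O[𝓝[>] 0] fun m : ℝ => m ^ (n : ℝ) := by
    refine IsBigO.of_bound C ?_
    filter_upwards [h, self_mem_nhdsWithin] with m hm hm0
    rwa [Real.rpow_natCast, Real.norm_of_nonneg (pow_nonneg (le_of_lt hm0) n)]
  exact h1.trans_isLittleO (isLittleO_rpow_rpow (hs.trans_le (by exact_mod_cast hn)))

/-- Polynomials of `log (m / M)` grow more slowly than all negative powers of `m`. -/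
theorem isLittleO_eval_log (M : ℝ) (q : ℂ[X]) : ∀ {s : ℝ}, s < 0 →
    (fun m : ℝ => q.eval (Real.log (m / M) : ℂ)) =o[𝓝[>] 0] fun m : ℝ => m ^ s := by
  have hconst : ∀ (c : ℂ) {s : ℝ}, s < 0 →
      (fun _ : ℝ => c) =o[𝓝[>] 0] fun m : ℝ => m ^ s := fun c s hs => by
    refine (IsBigO.of_bound ‖c‖ ?_ : (fun _ : ℝ => c) =O[𝓝[>] 0] fun m : ℝ => m ^ (0 : ℝ))
      |>.trans_isLittleO (isLittleO_rpow_rpow hs)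
    exact Eventually.of_forall fun m => by simp
  have hlog : ∀ {s : ℝ}, s < 0 →
      (fun m : ℝ => (Real.log (m / M) : ℂ)) =o[𝓝[>] 0] fun m : ℝ => m ^ s := fun {s} hs => by
    rcases eq_or_ne M 0 with rfl | hM
    · simp
    have h1 : (fun m : ℝ => (Real.log m : ℂ)) =o[𝓝[>] 0] fun m : ℝ => m ^ s :=
      IsLittleO.of_norm_left (by simpa using (isLittleO_log_rpow_nhdsGT_zero hs).norm_left)
    refine (h1.sub (hconst (Real.log M) hs)).congr' ?_ EventuallyEq.rfl
    filter_upwards [self_mem_nhdsWithin] with m hm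
    rw [Real.log_div (ne_of_gt hm) hM, Complex.ofReal_sub]
  induction q using Polynomial.induction_on with
  | C a => intro s hs; simpa using hconst a hs
  | add p q hp hq => intro s hs; simpa using (hp hs).add (hq hs)
  | monomial n a ih =>
    intro s hs
    refine ((ih (by linarith : s / 2 < 0)).mul (hlog (by linarith : s / 2 < 0))).congr' ?_ ?_
    · exact Eventually.of_forall fun m => by simp [pow_succ, mul_assoc]
    · filter_upwards [self_mem_nhdsWithin] with m hm
      rw [← Real.rpow_add hm, add_halves]

theorem nearlyO_pow_mul_eval_log (M : ℝ) (q : ℂ[X]) {L n : ℕ} (h : L ≤ n) :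
    NearlyO L fun m => ((m ^ n : ℝ) : ℂ) * q.eval (Real.log (m / M) : ℂ) := by
  intro s hs
  have hs' : s - n < 0 := by
    have : (L : ℝ) ≤ n := by exact_mod_cast h
    linarith
  have h1 : (fun m : ℝ => ((m ^ n : ℝ) : ℂ)) =O[𝓝[>] 0] fun m : ℝ => m ^ (n : ℝ) :=
    IsBigO.of_bound 1 (Eventually.of_forall fun m => by simp)
  refine (h1.mul_isLittleO (isLittleO_eval_log M q hs')).congr' EventuallyEq.rfl ?_
  filter_upwards [self_mem_nhdsWithin] with m hm
  rw [← Real.rpow_add hm, add_sub_cancel]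

theorem tendsto_log_div_nhdsGT {M : ℝ} (hM : 0 < M) :
    Tendsto (fun m : ℝ => Real.log (m / M)) (𝓝[>] 0) atBot := by
  refine Real.tendsto_log_nhdsGT_zero.comp (tendsto_nhdsWithin_iff.2 ⟨?_, ?_⟩)
  · exact ((continuous_id.div_const M).tendsto' 0 0 (by simp)).mono_left nhdsWithin_le_nhds
  · filter_upwards [self_mem_nhdsWithin] with m hm using div_pos hm hM

/-- A polynomial of `log m` which tends to zero as `m ↓ 0` is zero. -/
theorem eq_zero_of_tendsto_eval_log {M : ℝ} (hM : 0 < M) {q : ℂ[X]}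
    (h : Tendsto (fun m : ℝ => q.eval (Real.log (m / M) : ℂ)) (𝓝[>] 0) (𝓝 0)) : q = 0 := by
  by_cases hq : 0 < q.degree
  · have h1 : Tendsto (fun m : ℝ => ‖(Real.log (m / M) : ℂ)‖) (𝓝[>] 0) atTop := by
      simpa [Function.comp_def] using tendsto_abs_atBot_atTop.comp (tendsto_log_div_nhdsGT hM)
    exact absurd (by simpa using h.norm) (not_tendsto_nhds_of_tendsto_atTop
      (q.tendsto_norm_atTop hq h1) 0)
  · rw [eq_C_of_degree_le_zero (not_lt.1 hq)] at h ⊢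
    simp only [eval_C] at h
    rw [tendsto_nhds_unique tendsto_const_nhds h, C_0]

/-- `g(m) = ∑_{l < L} m ^ l q_l(log (m / M))` up to terms of order almost `m ^ L`, as `m ↓ 0`. -/
def IsLogExpansion (M : ℝ) (L : ℕ) (g : ℝ → ℂ) (q : ℕ → ℂ[X]) : Prop :=
  NearlyO L fun m => g m -
    ∑ l ∈ Finset.range L, ((m ^ l : ℝ) : ℂ) * (q l).eval (Real.log (m / M) : ℂ)

namespace IsLogExpansion

variable {M : ℝ} {L : ℕ} {f g : ℝ → ℂ} {q q' : ℕ → ℂ[X]}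

theorem add (hf : IsLogExpansion M L f q) (hg : IsLogExpansion M L g q') :
    IsLogExpansion M L (fun m => f m + g m) fun l => q l + q' l := by
  refine (NearlyO.add hf hg).congr fun m _ => ?_
  simp only [eval_add, mul_add, Finset.sum_add_distrib]
  ring

theorem const_mul (c : ℂ) (hf : IsLogExpansion M L f q) :
    IsLogExpansion M L (fun m => c * f m) fun l => C c * q l := by
  refine (NearlyO.const_mul c hf).congr fun m _ => ?_
  simp only [eval_mul, eval_C, mul_sub, Finset.mul_sum, mul_left_comm]

theorem sub (hf : IsLogExpansion M L f q) (hg : IsLogExpansion M L g q') :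
    IsLogExpansion M L (fun m => f m - g m) fun l => q l - q' l := by
  refine (NearlyO.sub hf hg).congr fun m _ => ?_
  simp only [eval_sub, mul_sub, Finset.sum_sub_distrib]
  ring

theorem of_nearlyO (hf : NearlyO L f) : IsLogExpansion M L f fun _ => 0 :=
  hf.congr fun m _ => by simp

theorem congr (hf : IsLogExpansion M L f q) (h : ∀ m, 0 < m → f m = g m) :
    IsLogExpansion M L g q :=
  NearlyO.congr hf fun m hm => by rw [h m hm]

theorem sum {ι : Type*} (s : Finset ι) {f : ι → ℝ → ℂ} {q : ι → ℕ → ℂ[X]}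
    (h : ∀ i ∈ s, IsLogExpansion M L (f i) (q i)) :
    IsLogExpansion M L (fun m => ∑ i ∈ s, f i m) fun l => ∑ i ∈ s, q i l := by
  classical
  induction s using Finset.induction_on with
  | empty => simpa using of_nearlyO (NearlyO.zero L)
  | insert i s hi ih =>
    simp only [Finset.sum_insert hi]
    exact (h i (Finset.mem_insert_self i s)).add
      (ih fun j hj => h j (Finset.mem_insert_of_mem hj))

theorem pow_mul_eval (M : ℝ) (L n : ℕ) (p : ℂ[X]) :
    IsLogExpansion M L (fun m => ((m ^ n : ℝ) : ℂ) * p.eval (Real.log (m / M) : ℂ))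
      fun l => if l = n then p else 0 := by
  rcases lt_or_ge n L with h | h
  · refine (NearlyO.zero L).congr fun m _ => ?_
    rw [Finset.sum_eq_single_of_mem n (Finset.mem_range.2 h) fun l _ hl => by simp [hl]]
    simp
  · refine (nearlyO_pow_mul_eval_log M p h).congr fun m _ => ?_
    rw [Finset.sum_eq_zero fun l hl => ?_, sub_zero]
    have hl' : l ≠ n := ((Finset.mem_range.1 hl).trans_le h).ne
    simp [hl']

theorem truncate (hf : IsLogExpansion M (L + 1) f q) : IsLogExpansion M L f q := by
  refine ((NearlyO.mono (Nat.le_succ L) hf).add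
    (nearlyO_pow_mul_eval_log M (q L) le_rfl)).congr fun m _ => ?_
  rw [Finset.sum_range_succ]
  ring

theorem mono {L' : ℕ} (h : L ≤ L') (hf : IsLogExpansion M L' f q) : IsLogExpansion M L f q := by
  induction L', h using Nat.le_induction with
  | base => exact hf
  | succ n _ ih => exact ih hf.truncate

/-- Rescaling the mass shifts the argument `log (m / M)` of the coefficients by `log ρ`. -/
theorem comp_div (hf : IsLogExpansion M L f q) {ρ : ℝ} (hρ : 0 < ρ) (hM : M ≠ 0) :
    IsLogExpansion M L (fun m => f (m / ρ)) fun l =>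
      C (((ρ ^ l)⁻¹ : ℝ) : ℂ) * (q l).comp (X - C (Real.log ρ : ℂ)) := by
  refine (NearlyO.comp_div hf hρ).congr fun m hm => ?_
  congr 1
  refine Finset.sum_congr rfl fun l _ => ?_
  have h1 : Real.log (m / ρ / M) = Real.log (m / M) - Real.log ρ := by
    rw [div_right_comm, Real.log_div (div_ne_zero hm.ne' hM) hρ.ne']
  rw [h1, div_pow, div_eq_mul_inv]
  simp only [eval_mul, eval_C, eval_comp, eval_sub, eval_X]
  push_cast
  ring

/-- If the sum of an expansion is negligible, then all its coefficients vanish. -/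
theorem eq_zero (hM : 0 < M) (hf : IsLogExpansion M L (fun _ => 0) q) : ∀ l < L, q l = 0 := by
  induction L with
  | zero => intro l hl; omega
  | succ L ih =>
    have h0 := ih hf.truncate
    intro l hl
    rcases Nat.lt_succ_iff_lt_or_eq.1 hl with hl | rfl
    · exact h0 l hl
    -- the lower coefficients vanish, so that `q_l` is the sum divided by `m ^ l`
    refine eq_zero_of_tendsto_eval_log hM ?_
    have h1 := (hf l (by push_cast; linarith)).tendsto_inv_smul_nhds_zero.neg
    rw [neg_zero] at h1
    refine h1.congr' ?_
    filter_upwards [self_mem_nhdsWithin] with m hm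
    rw [Finset.sum_range_succ, Finset.sum_eq_zero fun j hj => by
      rw [h0 j (Finset.mem_range.1 hj), eval_zero, mul_zero], Real.rpow_natCast]
    have : ((m : ℂ) ^ l) ≠ 0 := pow_ne_zero _ (by exact_mod_cast ne_of_gt hm)
    rw [Complex.real_smul]
    push_cast
    field_simp
    ring

theorem unique (hM : 0 < M) (hf : IsLogExpansion M L f q) (hf' : IsLogExpansion M L f q') :
    ∀ l < L, q l = q' l := fun l hl =>
  sub_eq_zero.1 (eq_zero hM ((hf.sub hf').congr fun _ _ => sub_self _) l hl)

/-- Taylor's theorem at `m = 0`, from the right. -/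
theorem of_contDiffOn (M : ℝ) (hf : ContDiffOn ℝ L f (Ici 0)) :
    IsLogExpansion M L f fun l => C (iteratedDerivWithin l f (Ici 0) 0 / (l ! : ℂ)) := by
  have h1 := taylor_isLittleO (convex_Ici (0 : ℝ)) self_mem_Ici hf
  have h2 : NearlyO L fun m => f m - taylorWithinEval f L (Ici 0) 0 m := by
    intro s hs
    refine (h1.mono (nhdsWithin_mono _ Ioi_subset_Ici_self)).trans ?_
    refine (isLittleO_rpow_rpow hs).congr' ?_ EventuallyEq.rfl
    exact Eventually.of_forall fun m => by simp
  refine (h2.add (nearlyO_pow_mul_eval_log M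
    (C (iteratedDerivWithin L f (Ici 0) 0 / (L ! : ℂ))) le_rfl)).congr fun m _ => ?_
  rw [taylor_within_apply, Finset.sum_range_succ]
  simp only [eval_C, sub_zero, Complex.real_smul]
  push_cast
  have : ∀ l : ℕ, ((l ! : ℂ)⁻¹ * (m : ℂ) ^ l) * iteratedDerivWithin l f (Ici 0) 0 =
      (m : ℂ) ^ l * (iteratedDerivWithin l f (Ici 0) 0 / (l ! : ℂ)) := fun l => by ring
  simp only [this]
  ring

end IsLogExpansion

/-- A function of `m²` has an expansion in even powers of `m`, without logarithms. -/
theorem IsMassChain.isLogExpansion {L : ℕ} {Φ : ℕ → ℝ → ℂ} (h : IsMassChain L Φ) (M : ℝ) :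
    IsLogExpansion M L (Φ 0) fun l =>
      ∑ k ∈ Finset.range L, if l = 2 * k then C (Φ k 0 / (k ! : ℂ)) else 0 := by
  obtain ⟨B, hB⟩ := h.taylor
  have h1 : NearlyO L fun m =>
      Φ 0 m - ∑ k ∈ Finset.range L, ((m ^ (2 * k) : ℝ) : ℂ) * (Φ k 0 / (k ! : ℂ)) := by
    refine nearlyO_of_norm_le (C := B) (2 * L) (by omega) ?_
    filter_upwards [Ioc_mem_nhdsGT one_pos] with m hm using hB m ⟨hm.1.le, hm.2⟩
  have h2 := (IsLogExpansion.of_nearlyO (M := M) h1).add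
    (IsLogExpansion.sum (M := M) (L := L) (Finset.range L) fun k _ =>
      IsLogExpansion.pow_mul_eval M L (2 * k) (C (Φ k 0 / (k ! : ℂ))))
  simp only [zero_add] at h2
  exact h2.congr fun m _ => by simp

theorem exists_isLogExpansion_expIntegral {d : ℕ} (hd : 3 ≤ d) {M : ℝ} (hM : M ≠ 0) (L j : ℕ) :
    ∃ e e' : ℕ → ℂ, IsLogExpansion M L (fun m => (expIntegral ((d : ℝ) / 2 + j) (m ^ 2) : ℂ))
      fun l => C (e l) + C (e' l) * X := by
  obtain ⟨G, κ, hG, -, h⟩ := expIntegral_half_dim hd j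
  have h1 := (IsLogExpansion.of_contDiffOn (L := L) M
    ((hG.of_le (by exact_mod_cast le_top)).contDiffOn)).add (IsLogExpansion.pow_mul_eval M L
      (d - 2 + 2 * j) (C (κ * (Real.log M : ℂ)) + C κ * X))
  refine ⟨fun l => iteratedDerivWithin l G (Ici 0) 0 / (l ! : ℂ) +
    if l = d - 2 + 2 * j then κ * (Real.log M : ℂ) else 0,
    fun l => if l = d - 2 + 2 * j then κ else 0, ?_⟩
  have h2 : ∀ l, (C (iteratedDerivWithin l G (Ici 0) 0 / (l ! : ℂ) +
      if l = d - 2 + 2 * j then κ * (Real.log M : ℂ) else 0) +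
      C (if l = d - 2 + 2 * j then κ else 0) * X : ℂ[X]) =
      C (iteratedDerivWithin l G (Ici 0) 0 / (l ! : ℂ)) +
      if l = d - 2 + 2 * j then C (κ * (Real.log M : ℂ)) + C κ * X else 0 := fun l => by
    split_ifs <;> simp [add_assoc]
  simp only [h2]
  refine h1.congr fun m hm => ?_
  rw [h m hm, Real.log_div hm.ne' hM]
  simp only [eval_add, eval_mul, eval_C, eval_X]
  push_cast
  ring

end

/-! ### The sm-expansion of an exactly homogeneous family -/

section

open Polynomial Asymptotics

variable {E : Type} [NormedAddCommGroup E] [NormedSpace ℝ E]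

/-- The remainder estimate of a logarithmic expansion, in the form of `IsSmExpansion`. -/
theorem IsLogExpansion.tendsto {M : ℝ} (hM : 0 < M) {L : ℕ} {g : ℝ → ℂ} {q : ℕ → ℂ[X]} {s : ℝ}
    (hs : s < L) (hg : IsLogExpansion M L g q) :
    Tendsto (fun m : ℝ => (((m / M) ^ (-s) : ℝ) : ℂ) * (g m -
      ∑ l ∈ Finset.range L, ((m ^ l : ℝ) : ℂ) * (q l).eval (Real.log (m / M) : ℂ)))
      (𝓝[>] 0) (𝓝 0) := by
  have h1 := ((hg s hs).tendsto_inv_smul_nhds_zero).const_mul ((M ^ s : ℝ) : ℂ)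
  rw [mul_zero] at h1
  refine h1.congr' ?_
  filter_upwards [self_mem_nhdsWithin] with m hm
  have hm : 0 < m := hm
  rw [Real.div_rpow hm.le hM.le, Real.rpow_neg hm.le, Real.rpow_neg hM.le, Complex.real_smul]
  have : ((M ^ s : ℝ) : ℂ) ≠ 0 := by exact_mod_cast (Real.rpow_pos_of_pos hM s).ne'
  push_cast
  field_simp

/-- Families whose pairings scale like a polynomial of degree one in `log ρ` are almost
homogeneous. -/
theorem almostHomogeneous_of_forall {D : ℝ} {f : ℝ → Dist' E} (a b : ℝ → Test E → ℂ)
    (h : ∀ m, 0 ≤ m → ∀ h : Test E, ∀ ρ : ℝ, 0 < ρ →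
      scaledPairing D f m h ρ = a m h + b m h * (Real.log ρ : ℂ)) : AlmostHomogeneous D f := by
  have hlog : ∀ {ρ : ℝ}, 0 < ρ → HasDerivAt (fun ρ : ℝ => (Real.log ρ : ℂ)) ((ρ⁻¹ : ℝ) : ℂ) ρ :=
    fun hρ => (Real.hasDerivAt_log hρ.ne').ofReal_comp
  refine ⟨2, fun m hm g => ⟨?_, fun ρ hρ => ?_⟩⟩
  · have h1 : ContDiffOn ℝ ∞ (fun ρ : ℝ => a m g + b m g * (Real.log ρ : ℂ)) (Ioi 0) := by
      refine contDiffOn_const.add (contDiffOn_const.mul ?_)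
      exact Complex.ofRealCLM.contDiff.comp_contDiffOn
        (contDiffOn_id.log fun x hx => ne_of_gt hx)
    exact h1.congr fun ρ hρ => h m hm g ρ hρ
  · have h1 : ∀ ρ : ℝ, 0 < ρ → rhoDeriv (scaledPairing D f m g) ρ = b m g := fun ρ hρ => by
      have h2 : scaledPairing D f m g =ᶠ[𝓝 ρ] fun ρ => a m g + b m g * (Real.log ρ : ℂ) := by
        filter_upwards [Ioi_mem_nhds hρ] with x hx using h m hm g x hx
      rw [rhoDeriv, h2.deriv_eq, (((hlog hρ).const_mul (b m g)).const_add (a m g)).deriv]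
      have : (ρ : ℂ) ≠ 0 := by exact_mod_cast hρ.ne'
      push_cast
      field_simp
    have h3 : rhoDeriv (scaledPairing D f m g) =ᶠ[𝓝 ρ] fun _ => b m g := by
      filter_upwards [Ioi_mem_nhds hρ] with x hx using h1 x hx
    rw [Function.iterate_succ, Function.comp_apply, Function.iterate_one, rhoDeriv, h3.deriv_eq,
      deriv_const, mul_zero]

/-- A family which is continuous in the mass at `m = 0`, smooth in `m > 0`, exactly homogeneous
under `(x, m) ↦ (ρ x, m / ρ)`, and which has expansions to all orders with at most one power of
`log m` for each power of `m`, fulfils the sm-expansion.  The coefficients are unique, hence they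
inherit the scaling behaviour of the family, up to the shift of `log m` by `log ρ`. -/
theorem fulfilsSmExpansion_of_isLogExpansion {M D : ℝ} (hM : 0 < M) (F : ℝ → Dist' E)
    (hhom : ∀ m, 0 ≤ m → ∀ h : Test E, ∀ ρ : ℝ, 0 < ρ → scaledPairing D F m h ρ = F m h)
    (hexp : ∀ L : ℕ, ∃ α β : ℕ → Dist' E, ∀ h : Test E,
      IsLogExpansion M L (fun m => F m h) fun l => C (α l h) + C (β l h) * X)
    (hcont : ∀ h : Test E, Tendsto (fun m => F m h) (𝓝[>] 0) (𝓝 (F 0 h)))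
    (hsmooth : ∀ h : Test E, ContDiffOn ℝ ∞ (fun m => F m h) (Ioi 0)) :
    FulfilsSmExpansion M D fun m h => F m h := by
  choose α' β' hexp' using hexp
  -- by uniqueness, the coefficient of `m ^ l` may be taken from the expansion of order `l + 1`
  set α : ℕ → Dist' E := fun l => α' (l + 1) l
  set β : ℕ → Dist' E := fun l => β' (l + 1) l
  have hcoef : ∀ {a b a' b' : ℂ}, (C a + C b * X : ℂ[X]) = C a' + C b' * X → a = a' ∧ b = b' := by
    intro a b a' b' h
    exact ⟨by simpa using congrArg (fun p => coeff p 0) h,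
      by simpa using congrArg (fun p => coeff p 1) h⟩
  have hlog : ∀ (L : ℕ) (h : Test E),
      IsLogExpansion M L (fun m => F m h) fun l => C (α l h) + C (β l h) * X := by
    intro L h
    refine NearlyO.congr (hexp' L h) fun m _ => ?_
    congr 1
    refine Finset.sum_congr rfl fun l hl => ?_
    have hl' := Finset.mem_range.1 hl
    have h1 := IsLogExpansion.unique hM (IsLogExpansion.mono (show l + 1 ≤ L by omega) (hexp' L h))
      (hexp' (l + 1) h) l (Nat.lt_succ_self l)
    exact congrArg (fun p : ℂ[X] => ((m ^ l : ℝ) : ℂ) * p.eval (Real.log (m / M) : ℂ)) h1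
  -- the coefficients for `l = 0`, from the continuity at `m = 0`
  have hzero : ∀ h : Test E, α 0 h = F 0 h ∧ β 0 h = 0 := by
    intro h
    have h1 := (hlog 1 h).tendsto hM (s := 0) (by simp)
    have h2 : (C (F 0 h - α 0 h) - C (β 0 h) * X : ℂ[X]) = 0 := by
      refine eq_zero_of_tendsto_eval_log hM ?_
      have h3 := h1.sub ((hcont h).sub_const (F 0 h))
      simp only [sub_self] at h3
      refine h3.congr fun m => ?_
      simp
      ring
    refine ⟨?_, ?_⟩
    · have := congrArg (fun p => coeff p 0) h2
      exact (sub_eq_zero.1 (by simpa using this)).symm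
    · simpa using congrArg (fun p => coeff p 1) h2
  -- the coefficients under dilations, from uniqueness
  have hdil : ∀ (l : ℕ) (h : Test E) (ρ : ℝ), 0 < ρ →
      ((ρ ^ (D - l) * (ρ ^ Module.finrank ℝ E)⁻¹ : ℝ) : ℂ) * β l (dilate ρ h) = β l h ∧
      ((ρ ^ (D - l) * (ρ ^ Module.finrank ℝ E)⁻¹ : ℝ) : ℂ) * α l (dilate ρ h) =
        α l h + β l h * (Real.log ρ : ℂ) := by
    intro l h ρ hρ
    have h1 := (((hlog (l + 1) (dilate ρ h)).comp_div hρ hM.ne').const_mul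
      ((ρ ^ D * (ρ ^ Module.finrank ℝ E)⁻¹ : ℝ) : ℂ)).congr (g := fun m => F m h)
      fun m hm => hhom m hm.le h ρ hρ
    have h2 := h1.unique hM (hlog (l + 1) h) l (Nat.lt_succ_self l)
    set k : ℂ := ((ρ ^ (D - l) * (ρ ^ Module.finrank ℝ E)⁻¹ : ℝ) : ℂ) with hk
    have h3 : ((ρ ^ D * (ρ ^ Module.finrank ℝ E)⁻¹ : ℝ) : ℂ) * (((ρ ^ l)⁻¹ : ℝ) : ℂ) = k := by
      rw [hk, Real.rpow_sub hρ, Real.rpow_natCast]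
      push_cast
      ring
    have h4 : (C (k * (α l (dilate ρ h) - Real.log ρ * β l (dilate ρ h))) +
        C (k * β l (dilate ρ h)) * X : ℂ[X]) = C (α l h) + C (β l h) * X := by
      rw [← h2, ← h3]
      simp only [add_comp, mul_comp, C_comp, X_comp, map_mul, map_sub]
      ring
    obtain ⟨h5, h6⟩ := hcoef h4
    refine ⟨h6, ?_⟩
    rw [← h5, ← h6]
    ring
  set P : ℕ → ℕ := fun l => if l = 0 then 0 else 1
  set u : ℕ → ℕ → Dist' E := fun l p => if p = 0 then α l else β l
  have hpoly : ∀ (l : ℕ) (m : ℝ) (h : Test E), logPoly M (P l) (u l) m h =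
      (C (α l h) + C (β l h) * X : ℂ[X]).eval (Real.log (m / M) : ℂ) := by
    intro l m h
    rcases eq_or_ne l 0 with rfl | hl
    · rw [show P 0 = 0 from rfl, logPoly, zero_add, Finset.sum_range_one, pow_zero, one_smul,
        (hzero h).2, C_0, zero_mul, add_zero, eval_C]
      rfl
    · have : logPoly M (P l) (u l) m = α l + Real.log (m / M) • β l := by
        rw [show P l = 1 from if_neg hl, logPoly, Finset.sum_range_succ, Finset.sum_range_one,
          pow_zero, one_smul, pow_one]
        rfl
      rw [this, show (α l + Real.log (m / M) • β l) h =
        α l h + (Real.log (m / M) : ℂ) * β l h from rfl]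
      rw [eval_add, eval_mul, eval_C, eval_C, eval_X, mul_comm (Real.log (m / M) : ℂ)]
  -- the remainder `r_L`
  set r : ℕ → ℝ → Dist' E := fun L m =>
    F m - ∑ l ∈ Finset.range L, ((m ^ l : ℝ) : ℂ) • logPoly M (P l) (u l) m
  have hr : ∀ L m (h : Test E), r L m h = F m h -
      ∑ l ∈ Finset.range L, ((m ^ l : ℝ) : ℂ) * logPoly M (P l) (u l) m h := by
    intro L m h
    have : ∀ s : Finset ℕ, (∑ l ∈ s, ((m ^ l : ℝ) : ℂ) • logPoly M (P l) (u l) m) h =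
        ∑ l ∈ s, ((m ^ l : ℝ) : ℂ) * logPoly M (P l) (u l) m h := by
      intro s
      induction s using Finset.induction_on with
      | empty => rfl
      | insert a s ha ih =>
        rw [Finset.sum_insert ha, Finset.sum_insert ha, ← ih]
        rfl
    rw [← this]
    rfl
  refine ⟨P, u, r, ⟨fun m _ => ⟨F m, fun _ => rfl⟩, fun L m _ h => ?_, ⟨rfl, fun h => ?_⟩,
    fun l p hp => ?_, fun L => ?_, fun L h => ?_, fun L h ε hε => ?_⟩⟩
  · rw [hr]
    ring
  · exact (hzero h).1
  · by_cases hp0 : p = 0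
    · exact almostHomogeneous_of_forall (fun _ h => α l h) (fun _ h => β l h)
        fun m _ h ρ hρ => by
          simp only [u, hp0, if_true, scaledPairing]
          exact (hdil l h ρ hρ).2
    · exact almostHomogeneous_of_forall (fun _ h => β l h) (fun _ _ => 0)
        fun m _ h ρ hρ => by
          simp only [u, hp0, if_false, scaledPairing]
          rw [zero_mul, add_zero]
          exact (hdil l h ρ hρ).1
  · refine almostHomogeneous_of_forall (fun m h => r (L + 1) m h) (fun _ _ => 0)
      fun m hm h ρ hρ => ?_
    rw [zero_mul, add_zero, scaledPairing, hr, hr, mul_sub, ← hhom m hm h ρ hρ, scaledPairing,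
      Finset.mul_sum]
    congr 1
    refine Finset.sum_congr rfl fun l _ => ?_
    have hk : ((ρ ^ D * (ρ ^ Module.finrank ℝ E)⁻¹ : ℝ) : ℂ) * (((m / ρ) ^ l : ℝ) : ℂ) =
        ((m ^ l : ℝ) : ℂ) * ((ρ ^ (D - l) * (ρ ^ Module.finrank ℝ E)⁻¹ : ℝ) : ℂ) := by
      rw [Real.rpow_sub hρ, Real.rpow_natCast, div_pow]
      push_cast
      ring
    rw [← mul_assoc, hk, mul_assoc]
    rcases hm.eq_or_lt with rfl | hm
    · -- for `m = 0` only `l = 0` contributes, without logarithm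
      rcases eq_or_ne l 0 with rfl | hl
      · rw [hpoly, hpoly, (hzero _).2, (hzero _).2]
        have := (hdil 0 h ρ hρ).2
        rw [(hzero h).2, zero_mul, add_zero] at this
        simpa using this
      · simp [hl]
    · have h1 : Real.log (m / ρ / M) = Real.log (m / M) - Real.log ρ := by
        rw [div_right_comm, Real.log_div (div_ne_zero hm.ne' hM.ne') hρ.ne']
      obtain ⟨h2, h3⟩ := hdil l h ρ hρ
      rw [hpoly, hpoly, h1]
      simp only [eval_add, eval_mul, eval_C, eval_X]
      rw [mul_add, mul_left_comm, ← mul_assoc, h3, ← h2]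
      push_cast
      ring
  · simp only [hr, hpoly, eval_add, eval_mul, eval_C, eval_X]
    refine (hsmooth h).sub (ContDiffOn.sum fun l _ => ContDiffOn.mul ?_
      (contDiffOn_const.add (contDiffOn_const.mul ?_)))
    · exact (Complex.ofRealCLM.contDiff.comp (contDiff_id.pow l)).contDiffOn
    · exact Complex.ofRealCLM.contDiff.comp_contDiffOn ((contDiffOn_id.div_const M).log
        fun m hm => (div_pos hm hM).ne')
  · have h1 := (hlog (L + 1) h).tendsto hM (s := (L : ℝ) + 1 - ε) (by push_cast; linarith)
    refine h1.congr fun m => ?_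
    simp only [hr, hpoly]
    congr 3
    ring

/-- In any sm-expansion of a family which is smooth on `m ≥ 0` the coefficients are those of the
Taylor expansion at `m = 0`. -/
theorem IsSmExpansion.logPoly_eq_taylor {M D : ℝ} (hM : 0 < M) {f : ℝ → Test E → ℂ} {P : ℕ → ℕ}
    {u : ℕ → ℕ → Dist' E} {r : ℕ → ℝ → Dist' E} (H : IsSmExpansion M D f P u r) {h : Test E}
    (hf : ContDiffOn ℝ ∞ (fun m => f m h) (Ici 0)) (l : ℕ) (m : ℝ) :
    logPoly M (P l) (u l) m h =
      iteratedDerivWithin l (fun m' => f m' h) (Ici 0) 0 / (l ! : ℂ) := by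
  set q : ℕ → ℂ[X] := fun l => ∑ p ∈ Finset.range (P l + 1), C (u l p h) * X ^ p
  have hq : ∀ (l : ℕ) (m : ℝ),
      logPoly M (P l) (u l) m h = (q l).eval (Real.log (m / M) : ℂ) := by
    intro l m
    have h1 : ∀ s : Finset ℕ, (∑ p ∈ s, (Real.log (m / M)) ^ p • u l p) h =
        ∑ p ∈ s, ((Real.log (m / M)) ^ p : ℂ) * u l p h := by
      intro s
      induction s using Finset.induction_on with
      | empty => rfl
      | insert a s ha ih =>
        rw [Finset.sum_insert ha, Finset.sum_insert ha, ← ih, ← Complex.ofReal_pow]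
        rfl
    rw [logPoly, h1]
    simp only [q, eval_finsetSum, eval_mul, eval_C, eval_pow, eval_X, mul_comm]
  have h1 : IsLogExpansion M (l + 1) (fun m => f m h) q := by
    intro s hs
    have h2 := H.remainder_limit l h ((l : ℝ) + 1 - s) (by push_cast at hs; linarith)
    have h3 : (fun m => r (l + 1) m h) =o[𝓝[>] 0] fun m : ℝ => m ^ s := by
      refine IsLittleO.of_norm_left ((isLittleO_iff_tendsto' ?_).2 ?_)
      · filter_upwards [self_mem_nhdsWithin] with m hm h0
        exact absurd h0 (Real.rpow_pos_of_pos hm s).ne'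
      · have h4 := (h2.norm.const_mul (M ^ (-s)))
        rw [norm_zero, mul_zero] at h4
        refine h4.congr' ?_
        filter_upwards [self_mem_nhdsWithin] with m hm
        have hm : 0 < m := hm
        have hMs := Real.rpow_pos_of_pos hM s
        have hms := Real.rpow_pos_of_pos hm s
        rw [norm_mul, Complex.norm_real, Real.norm_of_nonneg (by positivity),
          show -((l : ℝ) + 1) + ((l : ℝ) + 1 - s) = -s by ring, Real.div_rpow hm.le hM.le,
          Real.rpow_neg hm.le, Real.rpow_neg hM.le]
        field_simp
    refine h3.congr' ?_ EventuallyEq.rfl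
    filter_upwards [self_mem_nhdsWithin] with m hm
    rw [H.expansion l m (le_of_lt hm) h]
    simp only [hq]
    ring
  have h2 := h1.unique hM (IsLogExpansion.of_contDiffOn M
    (hf.of_le (by exact_mod_cast le_top))) l (Nat.lt_succ_self l)
  rw [hq, h2, eval_C]

end

/-! ### Homogeneity and symmetry of the two-point functions -/

section

variable {d : ℕ}

theorem energy_div_smul {ρ : ℝ} (hρ : 0 < ρ) (m : ℝ) (p : Space d) :
    energy (m / ρ) p = energy m (ρ • p) / ρ := by
  rw [energy, energy, eq_div_iff hρ.ne', ← Real.sqrt_sq hρ.le, ← Real.sqrt_mul (by positivity),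
    Real.sqrt_sq hρ.le, norm_smul, Real.norm_of_nonneg hρ.le]
  congr 1
  field_simp

/-- Substituting `x ↦ ρ x` and `p ↦ p / ρ` gives the factors `ρ ^ (d - 1)` and `ρ ^ (-(d - 1))`;
what remains is the factor `ρ` of `1 / ω`. -/
theorem wightmanAt_div_mass {ρ : ℝ} (hρ : 0 < ρ) (m s : ℝ) (g : Space d → ℝ) :
    wightmanAt d (m / ρ) s (fun x => g (ρ⁻¹ • x)) = ρ * wightmanAt d m (s / ρ) g := by
  set n := Module.finrank ℝ (Space d)
  have hρn : (ρ : ℂ) ^ n ≠ 0 := pow_ne_zero _ (by exact_mod_cast hρ.ne')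
  have hρ' : (ρ : ℂ) ≠ 0 := by exact_mod_cast hρ.ne'
  have h1 : ∀ p : Space d,
      (∫ x : Space d, Complex.exp (Complex.I * (inner ℝ p x : ℝ)) * (g (ρ⁻¹ • x) : ℂ)) =
      (ρ : ℂ) ^ n *
        ∫ x : Space d, Complex.exp (Complex.I * (inner ℝ (ρ • p) x : ℝ)) * (g x : ℂ) := by
    intro p
    have h2 := Measure.integral_comp_inv_smul (volume : Measure (Space d))
      (fun x => Complex.exp (Complex.I * (inner ℝ (ρ • p) x : ℝ)) * (g x : ℂ)) ρ
    rw [abs_of_pos (pow_pos hρ _), Complex.real_smul, Complex.ofReal_pow] at h2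
    rw [← h2]
    congr 1
    funext x
    rw [real_inner_smul_left, real_inner_smul_right, mul_inv_cancel_left₀ hρ.ne']
  set Ψ : Space d → ℂ := fun q => ((2 * energy m q)⁻¹ : ℝ) *
    Complex.exp (-Complex.I * (energy m q * (s / ρ) : ℝ)) *
      ∫ x : Space d, Complex.exp (Complex.I * (inner ℝ q x : ℝ)) * (g x : ℂ) with hΨ
  have h3 : ∀ p : Space d, ((2 * energy (m / ρ) p)⁻¹ : ℝ) *
      Complex.exp (-Complex.I * (energy (m / ρ) p * s : ℝ)) *
      (∫ x : Space d, Complex.exp (Complex.I * (inner ℝ p x : ℝ)) * (g (ρ⁻¹ • x) : ℂ)) =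
      (ρ * (ρ : ℂ) ^ n) * Ψ (ρ • p) := by
    intro p
    rw [h1, hΨ, energy_div_smul hρ]
    have e1 : (2 * (energy m (ρ • p) / ρ))⁻¹ = ρ * (2 * energy m (ρ • p))⁻¹ := by
      rw [← mul_div_assoc, inv_div, div_eq_mul_inv]
    have e2 : energy m (ρ • p) / ρ * s = energy m (ρ • p) * (s / ρ) := by ring
    rw [e1, e2]
    push_cast
    ring
  have h4 : wightmanAt d m (s / ρ) g =
      (((2 * Real.pi) ^ (d - 1))⁻¹ : ℝ) * ∫ q : Space d, Ψ q := rfl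
  rw [h4, wightmanAt]
  simp only [h3]
  rw [integral_const_mul, Measure.integral_comp_smul, abs_of_pos (by positivity),
    Complex.real_smul]
  push_cast
  change _ * (ρ * (ρ : ℂ) ^ n * (((ρ : ℂ) ^ n)⁻¹ * _)) = _
  field_simp

theorem dilate_apply {E : Type} [NormedAddCommGroup E] [NormedSpace ℝ E] {ρ : ℝ} (hρ : ρ ≠ 0)
    (h : Test E) (x : E) : dilate ρ h x = h (ρ⁻¹ • x) := by
  rw [dilate, dif_neg hρ]
  rfl

/-- Exact homogeneity of the two-point functions, of degree `d - 2`: the dilation of the test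
function contributes `ρ ^ d`. -/
theorem twoPoint_div_mass {a : ℝ → ℝ} (ha : ∀ ρ : ℝ, 0 < ρ → ∀ t, a (ρ * t) = ρ * a t) {ρ : ℝ}
    (hρ : 0 < ρ) (m : ℝ) (h : Test (Minkowski d)) :
    twoPoint d a (m / ρ) (dilate ρ h) = (ρ : ℂ) ^ 2 * twoPoint d a m h := by
  have h1 : ∀ t : ℝ, wightmanAt d (m / ρ) (a t) (fun x => dilate ρ h (t, x)) =
      ρ * wightmanAt d m (a (ρ⁻¹ * t)) (fun x => h (ρ⁻¹ * t, x)) := by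
    intro t
    rw [ha _ (inv_pos.2 hρ), ← div_eq_inv_mul, ← wightmanAt_div_mass hρ m (a t)]
    congr 1
    funext x
    rw [dilate_apply hρ.ne']
    rfl
  rw [twoPoint, twoPoint]
  simp only [h1]
  rw [integral_const_mul, Measure.integral_comp_inv_mul_left
    (fun t => wightmanAt d m (a t) (fun x => h (t, x))) ρ, abs_of_pos hρ, Complex.real_smul]
  ring

theorem wightmanAt_comp_neg (m s : ℝ) (g : Space d → ℝ) :
    wightmanAt d m s (fun x => g (-x)) = wightmanAt d m s g := by
  rw [wightmanAt, wightmanAt, ← integral_neg_eq_self]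
  congr 2
  funext p
  have h1 : energy m (-p) = energy m p := by rw [energy, energy, norm_neg]
  rw [h1, ← integral_neg_eq_self]
  congr 2
  funext x
  rw [neg_neg, inner_neg_neg]

theorem integrable_wightmanAt (hd : 3 ≤ d) {a : ℝ → ℝ} (ha : Measurable a)
    (ha1 : ∀ t, |a t| = |t|) (m : ℝ) (h : Test (Minkowski d)) :
    Integrable fun t : ℝ => wightmanAt d m (a t) (fun x => h (t, x)) := by
  simp only [wightmanAt_eq]
  have h1 := (twoPoint_decomposition hd ha ha1 0).1 m h
  rw [Measure.volume_eq_prod] at h1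
  exact h1.integral_prod_left.const_mul _

theorem feynman_eq_twoPoint (hd : 3 ≤ d) : feynman d = twoPoint d fun t => |t| := by
  funext m h
  have hi := integrable_wightmanAt hd (a := fun t => |t|) measurable_norm (fun t => abs_abs t) m h
  rw [feynman, twoPoint, ← intervalIntegral.integral_Iic_add_Ioi (b := 0) hi.integrableOn
    hi.integrableOn, add_comm, integral_Iic_eq_integral_Iio]
  congr 1
  · refine setIntegral_congr_fun measurableSet_Iio fun t ht => ?_
    rw [wightmanAt_comp_neg m (-t) fun x => h (t, x), abs_of_neg (mem_Iio.1 ht)]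
  · refine setIntegral_congr_fun measurableSet_Ioi fun t ht => ?_
    rw [abs_of_pos (mem_Ioi.1 ht)]

end

/-! ### The sm-expansion of the two-point functions -/

section

open Polynomial

variable {d : ℕ} {a : ℝ → ℝ}

theorem sum_dist_apply {E ι : Type} [NormedAddCommGroup E] [NormedSpace ℝ E] (s : Finset ι)
    (T : ι → Dist' E) (h : Test E) : (∑ i ∈ s, T i) h = ∑ i ∈ s, T i h := by
  classical
  induction s using Finset.induction_on with
  | empty => rfl
  | insert i s hi ih => rw [Finset.sum_insert hi, Finset.sum_insert hi, ← ih]; rfl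

/-- With no singular term split off, the decomposition says that the two-point function is a
distribution which is continuous in the mass, including `m = 0`. -/
theorem exists_dist_eq_twoPoint (hd : 3 ≤ d) (ha : Measurable a) (ha1 : ∀ t, |a t| = |t|) :
    ∃ F : ℝ → Dist' (Minkowski d), (∀ m h, twoPoint d a m h = F m h) ∧
      ∀ h, Continuous fun m => F m h := by
  obtain ⟨-, A, Φ, hΦ, h⟩ := twoPoint_decomposition hd ha ha1 0
  exact ⟨Φ 0, fun m g => by simpa using h m g, fun g => (hΦ g).1 0 le_rfl⟩

theorem contDiffOn_twoPoint (hd : 3 ≤ d) (ha : Measurable a) (ha1 : ∀ t, |a t| = |t|)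
    (h : Test (Minkowski d)) : ContDiffOn ℝ ∞ (fun m => twoPoint d a m h) (Ioi 0) := by
  choose G κ hG hκ hE using fun j => expIntegral_half_dim hd j
  -- for `n` derivatives, `n` exponential integrals are split off
  refine contDiffOn_infty.2 fun n => ?_
  obtain ⟨-, A, Φ, hΦ, hF⟩ := twoPoint_decomposition hd ha ha1 n
  have h1 : ContDiffOn ℝ n (fun m : ℝ => ∑ j ∈ Finset.range n,
      (G j m + κ j * ((m ^ (d - 2 + 2 * j) * Real.log m : ℝ) : ℂ)) * A j h + Φ 0 m h) (Ioi 0) := by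
    refine (ContDiffOn.sum fun j _ => ContDiffOn.mul (ContDiffOn.add ?_ (contDiffOn_const.mul ?_))
      contDiffOn_const).add (hΦ h).contDiff.contDiffOn
    · exact ((hG j).of_le (by exact_mod_cast le_top)).contDiffOn
    · exact Complex.ofRealCLM.contDiff.comp_contDiffOn ((contDiffOn_id.pow _).mul
        (contDiffOn_id.log fun m hm => ne_of_gt hm))
  refine h1.congr fun m hm => ?_
  rw [hF]
  simp only [hE _ m hm]

/-- In odd dimensions the exponential integrals contain no logarithm. -/
theorem contDiffOn_twoPoint_of_odd (hd : 3 ≤ d) (hodd : Odd d) (ha : Measurable a)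
    (ha1 : ∀ t, |a t| = |t|) (h : Test (Minkowski d)) :
    ContDiffOn ℝ ∞ (fun m => twoPoint d a m h) (Ici 0) := by
  choose G κ hG hκ hE using fun j => expIntegral_half_dim hd j
  obtain ⟨F, hF, hFc⟩ := exists_dist_eq_twoPoint hd ha ha1
  refine contDiffOn_infty.2 fun n => ?_
  obtain ⟨-, A, Φ, hΦ, hF'⟩ := twoPoint_decomposition hd ha ha1 n
  have h1 : ContDiff ℝ n (fun m : ℝ => ∑ j ∈ Finset.range n, G j m * A j h + Φ 0 m h) :=
    (ContDiff.sum fun j _ => ((hG j).of_le (by exact_mod_cast le_top)).mul contDiff_const).add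
      (hΦ h).contDiff
  have h2 : ∀ m : ℝ, 0 < m →
      twoPoint d a m h = ∑ j ∈ Finset.range n, G j m * A j h + Φ 0 m h := by
    intro m hm
    rw [hF']
    simp only [hE _ m hm, hκ _ hodd, zero_mul, add_zero]
  refine h1.contDiffOn.congr fun m hm => ?_
  rcases (mem_Ici.1 hm).eq_or_lt with rfl | hm
  · -- at `m = 0` both sides are determined by continuity
    have h3 : Continuous fun m => twoPoint d a m h := by simpa only [hF] using hFc h
    refine tendsto_nhds_unique ((h3.tendsto 0).mono_left nhdsWithin_le_nhds)
      (((h1.continuous.tendsto 0).mono_left (nhdsWithin_le_nhds (s := Ioi 0))).congr' ?_)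
    filter_upwards [self_mem_nhdsWithin] with m hm using (h2 m hm).symm
  · exact h2 m hm

theorem exists_isLogExpansion_twoPoint (hd : 3 ≤ d) (ha : Measurable a) (ha1 : ∀ t, |a t| = |t|)
    {M : ℝ} (hM : M ≠ 0) (L : ℕ) : ∃ α β : ℕ → Dist' (Minkowski d), ∀ h,
      IsLogExpansion M L (fun m => twoPoint d a m h) fun l => C (α l h) + C (β l h) * X := by
  choose e e' he using exists_isLogExpansion_expIntegral hd hM L
  obtain ⟨-, A, Φ, hΦ, hF⟩ := twoPoint_decomposition hd ha ha1 L
  refine ⟨fun l => (∑ j ∈ Finset.range L, e j l • A j) +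
    ∑ k ∈ Finset.range L, (if l = 2 * k then (k ! : ℂ)⁻¹ else 0) • Φ k 0,
    fun l => ∑ j ∈ Finset.range L, e' j l • A j, fun h => ?_⟩
  have h1 := (IsLogExpansion.sum (Finset.range L) fun j _ => (he j).const_mul (A j h)).add
    ((hΦ h).isLogExpansion M)
  have h2 : ∀ l, (C (((∑ j ∈ Finset.range L, e j l • A j) +
      ∑ k ∈ Finset.range L, (if l = 2 * k then (k ! : ℂ)⁻¹ else 0) • Φ k 0) h) +
      C ((∑ j ∈ Finset.range L, e' j l • A j) h) * X : ℂ[X]) =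
      ∑ j ∈ Finset.range L, C (A j h) * (C (e j l) + C (e' j l) * X) +
      ∑ k ∈ Finset.range L, if l = 2 * k then C (Φ k 0 h / (k ! : ℂ)) else 0 := by
    intro l
    have h3 : ∀ S T : Dist' (Minkowski d), (S + T) h = S h + T h := fun _ _ => rfl
    rw [h3, sum_dist_apply, sum_dist_apply, sum_dist_apply]
    simp only [smul_dist_apply, map_add, map_sum, map_mul, mul_add, Finset.sum_add_distrib,
      Finset.sum_mul]
    have h4 : ∀ k, (C (if l = 2 * k then (k ! : ℂ)⁻¹ else 0) * C (Φ k 0 h) : ℂ[X]) =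
        if l = 2 * k then C (Φ k 0 h / (k ! : ℂ)) else 0 := fun k => by
      split_ifs
      · rw [← C_mul, div_eq_inv_mul]
      · rw [C_0, zero_mul]
    simp only [h4, mul_comm (C (A _ h)), mul_right_comm _ X]
    ring
  simp only [h2]
  exact h1.congr fun m _ => by rw [hF]; simp only [mul_comm]

theorem fulfilsSmExpansion_const_mul_twoPoint (hd : 3 ≤ d) (ha : Measurable a)
    (ha1 : ∀ t, |a t| = |t|) (ha2 : ∀ ρ : ℝ, 0 < ρ → ∀ t, a (ρ * t) = ρ * a t) {M : ℝ}
    (hM : 0 < M) (c : ℂ) :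
    FulfilsSmExpansion M ((d : ℝ) - 2) fun m h => c * twoPoint d a m h := by
  obtain ⟨F, hF, hFc⟩ := exists_dist_eq_twoPoint hd ha ha1
  have key : (fun m h => c * twoPoint d a m h) = fun m h => (c • F m) h := by
    funext m h
    rw [hF, smul_dist_apply]
  rw [key]
  refine fulfilsSmExpansion_of_isLogExpansion hM (fun m => c • F m) (fun m _ h ρ hρ => ?_)
    (fun L => ?_) (fun h => ?_) fun h => ?_
  · rw [scaledPairing, smul_dist_apply, smul_dist_apply, ← hF, ← hF, twoPoint_div_mass ha2 hρ]
    have hfin : Module.finrank ℝ (Minkowski d) = d := by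
      rw [Module.finrank_prod, Module.finrank_self, finrank_euclideanSpace_fin]
      omega
    have h1 : ρ ^ ((d : ℝ) - 2) * (ρ ^ d)⁻¹ * ρ ^ 2 = 1 := by
      rw [Real.rpow_sub hρ, Real.rpow_natCast, Real.rpow_ofNat]
      field_simp
    rw [hfin]
    calc _ = ((ρ ^ ((d : ℝ) - 2) * (ρ ^ d)⁻¹ * ρ ^ 2 : ℝ) : ℂ) * (c * twoPoint d a m h) := by
          push_cast
          ring
      _ = _ := by rw [h1, Complex.ofReal_one, one_mul]
  · obtain ⟨α, β, h⟩ := exists_isLogExpansion_twoPoint hd ha ha1 hM.ne' L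
    refine ⟨fun l => c • α l, fun l => c • β l, fun g => ?_⟩
    have h1 := (h g).const_mul c
    simp only [mul_add, ← mul_assoc, ← C_mul] at h1
    exact h1.congr fun m _ => by rw [hF, smul_dist_apply]
  · have h1 : Continuous fun m => (c • F m) h := by
      simp only [smul_dist_apply]
      exact continuous_const.mul (hFc h)
    exact (h1.tendsto 0).mono_left nhdsWithin_le_nhds
  · simp only [smul_dist_apply, ← hF]
    exact contDiffOn_const.mul (contDiffOn_twoPoint hd ha ha1 h)

theorem massDim_basicField (d : ℕ) : massDim (basicField d) = ((d : ℝ) - 2) / 2 := by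
  simp [massDim, basicField]

end

theorem mainTheorem4 (d : ℕ) (hd : 3 ≤ d) (M : ℝ) (hM : 0 < M) :
    FulfilsSmExpansion M ((d : ℝ) - 2) (wightman d) ∧
    (Odd d →
      (∀ h : Test (Minkowski d), ContDiffOn ℝ ∞ (fun m => wightman d m h) (Ici 0)) ∧
      ∀ (P : ℕ → ℕ) (u : ℕ → ℕ → Dist' (Minkowski d)) (r : ℕ → ℝ → Dist' (Minkowski d)),
        IsSmExpansion M ((d : ℝ) - 2) (wightman d) P u r →
        ∀ (l : ℕ) (m : ℝ), 0 < m → ∀ h : Test (Minkowski d),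
          logPoly M (P l) (u l) m h =
            iteratedDerivWithin l (fun m' => wightman d m' h) (Ici 0) 0 / (l ! : ℂ)) ∧
    ∀ ħ : ℝ, FulfilsSmExpansion M (massDim (basicField d) + massDim (basicField d))
      (timeOrderedVev d ħ) := by
  refine ⟨?_, fun hodd => ?_, fun ħ => ?_⟩
  · have h1 := fulfilsSmExpansion_const_mul_twoPoint hd (a := id) measurable_id (fun _ => rfl)
      (fun _ _ _ => rfl) hM 1
    simp only [one_mul] at h1
    exact h1
  · have h1 : ∀ h : Test (Minkowski d), ContDiffOn ℝ ∞ (fun m => wightman d m h) (Ici 0) :=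
      contDiffOn_twoPoint_of_odd hd hodd (a := id) measurable_id fun _ => rfl
    exact ⟨h1, fun P u r H l m _ h => H.logPoly_eq_taylor hM (h1 h) l m⟩
  · have h1 := fulfilsSmExpansion_const_mul_twoPoint hd (a := fun t => |t|) measurable_norm
      (fun t => abs_abs t) (fun ρ hρ t => by rw [abs_mul, abs_of_pos hρ]) hM ħ
    rw [massDim_basicField, add_halves]
    have h2 : timeOrderedVev d ħ = fun m h => (ħ : ℂ) * twoPoint d (fun t => |t|) m h := by
      funext m h
      rw [timeOrderedVev, feynman_eq_twoPoint hd]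
    rwa [h2]
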